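/- Let $R$ be a commutative ring. Let $\mathsf{FI}$ be the category of finite sets and injections. An $R$-valued $\mathsf{FI}$-module is a functor $M\colon \mathsf{FI}\to \mathrm{Mod}_R$. It is presented in finite degree if for some $d\in\mathbb N$ there is an exact sequence $F_1\to F_0\to M\to 0$ in which $F_0$ and $F_1$ are (possibly infinite) direct sums of $\mathsf{FI}$-modules of the form $R\,\mathsf{FI}([n],-)$ with $n\le d$. It is supported in finite degree if for some $d$ we have $M_S=0$ whenever $|S|>d$. The category of $R$-valued $\mathsf{FI}$-tails is the Serre quotient of the category of $R$-valued $\mathsf{FI}$-modules presented in finite degree by those supported in finite degree, i.e. its localization at the morphisms whose kernel and cokernel are supported in finite degree. For $\ell\in\mathbb N$ let $\Xi(\ell)\colon \mathsf{FI}^{\mathrm{op}}\to\mathsf{Ab}$ be given by $\Xi(\ell)_S=H_0(X_S,A_S)$ (singular homology with integer coefficients), where $X_S$ is the space of embeddings of the discrete space $S$ into $[\ell]\sqcup\mathbb R$, with $[\ell]=\{1,\dots,\ell\}$ discrete, and $A_S\subseteq X_S$ is the subspace of those $\phi$ with $[\ell]\not\subseteq \operatorname{im}\phi$; injections act by precomposition.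 Let $\mathsf{FJ}$ be the $\mathbb Z$-linear category whose objects are the natural numbers and whose morphisms are $\mathsf{FJ}(\ell,m)=\operatorname{Hom}_{\mathsf{FI}^{\mathrm{op}}}(\Xi(\ell),\Xi(m))$. An $R$-valued $\mathsf{FJ}$-module is an additive functor $N\colon\mathsf{FJ}\to\mathrm{Mod}_R$; it is supported in finite degree if for some $d$ we have $N_\ell=0$ for all $\ell>d$. For an $R$-valued $\mathsf{FI}$-module $M$ let $M\otimes_{\mathsf{FI}}\Xi(\ell)$ be the quotient of $\bigoplus_{n\in\mathbb N} M_{[n]}\otimes_{\mathbb Z}\Xi(\ell)_{[n]}$ by the relations $M_f(a)\otimes\xi-a\otimes \Xi(\ell)_f(\xi)$ for all injections $f\colon[m]\to[n]$, $a\in M_{[m]}$, $\xi\in\Xi(\ell)_{[n]}$. The morphisms of $\mathsf{FJ}$ act on the second factor, and so $M\otimes_{\mathsf{FI}}\Xi(-)$ is an $R$-valued $\mathsf{FJ}$-module. Theorem. The functor $M\mapsto M\otimes_{\mathsf{FI}}\Xi(-)$ induces an equivalence of categories from the category of $R$-valued $\mathsf{FI}$-tails to the category of $R$-valued $\mathsf{FJ}$-modules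 supported in finite degree. -/

import Mathlib

open CategoryTheory CategoryTheory.Limits Opposite
open scoped TensorProduct DirectSum

universe u

/-! ### The category `FI` of finite sets and injections -/

/-- A finite set, as an object of the category `FI`. -/
structure FI : Type 1 where
  /-- The underlying set. -/
  carrier : Type
  /-- The underlying set is finite. -/
  [finite : Finite carrier]

namespace FI

attribute [instance] FI.finite

/-- Morphisms of `FI` are injections. -/
instance : Category FI where
  Hom S T := S.carrier ↪ T.carrier
  id S := Function.Embedding.refl S.carrier
  comp f g := Function.Embedding.trans f g

/-- The injection underlying a morphism of `FI`. -/
def toEmb {S T : FI} (f : S ⟶ T) : S.carrier ↪ T.carrier := f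

@[simp] lemma toEmb_id (S : FI) (x : S.carrier) : toEmb (𝟙 S) x = x := rfl

@[simp] lemma toEmb_comp {S T U : FI} (f : S ⟶ T) (g : T ⟶ U) (x : S.carrier) :
    toEmb (f ≫ g) x = toEmb g (toEmb f x) := rfl

/-- The standard finite set with `n` elements. -/
def std (n : ℕ) : FI := ⟨Fin n⟩

/-- The cardinality of a finite set. -/
noncomputable def card (S : FI) : ℕ := Nat.card S.carrier

end FI

/-- `R`-valued `FI`-modules: functors from `FI` to `R`-modules. -/
abbrev FIMod (R : Type u) [CommRing R] := FI ⥤ ModuleCat.{u} R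

namespace FIMod

variable (R : Type u) [CommRing R]

/-- The free `FI`-module with one generator in degree `deg i` for each `i : ι`, that is,
the direct sum over `i` of the principal `FI`-modules `R FI([deg i], -)`. -/
noncomputable def free {ι : Type u} (deg : ι → ℕ) : FIMod R where
  obj S := ModuleCat.of R ((Σ i, (FI.std (deg i) ⟶ S)) →₀ R)
  map f := ModuleCat.ofHom (Finsupp.lmapDomain R R fun p => ⟨p.1, p.2 ≫ f⟩)
  map_id S := by
    ext : 1
    simp only [Category.comp_id, Sigma.eta]
    exact Finsupp.lmapDomain_id R R
  map_comp f g := by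
    ext : 1
    simp only [← Category.assoc]
    exact Finsupp.lmapDomain_comp R R (fun p : Σ i, (FI.std (deg i) ⟶ _) =>
      (⟨p.1, p.2 ≫ f⟩ : Σ i, (FI.std (deg i) ⟶ _))) (fun p =>
      (⟨p.1, p.2 ≫ g⟩ : Σ i, (FI.std (deg i) ⟶ _)))

variable {R}

/-- `M` is presented in degrees `≤ d`: there is an exact sequence `F₁ ⟶ F₀ ⟶ M ⟶ 0` with `F₁` and
`F₀` free on (possibly infinite) families of generators of degrees `≤ d`. -/
def IsPresentedInDegreesLE (M : FIMod R) (d : ℕ) : Prop :=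
  ∃ (ι κ : Type u) (deg₀ : ι → ℕ) (deg₁ : κ → ℕ)
    (r : free R deg₁ ⟶ free R deg₀) (p : free R deg₀ ⟶ M),
    (∀ i, deg₀ i ≤ d) ∧ (∀ k, deg₁ k ≤ d) ∧
    ∀ S : FI, Function.Exact (r.app S) (p.app S) ∧ Function.Surjective (p.app S)

variable (R)

/-- The `FI`-modules presented in finite degree. -/
def presentedInFiniteDegree : ObjectProperty (FIMod R) :=
  fun M => ∃ d : ℕ, IsPresentedInDegreesLE M d

/-- The `FI`-modules supported in finite degree. -/
def supportedInFiniteDegree : ObjectProperty (FIMod R) :=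
  fun M => ∃ d : ℕ, ∀ S : FI, d < S.card → IsZero (M.obj S)

/-- The `FI`-modules supported in finite degree form a Serre class. -/
instance : (supportedInFiniteDegree R).IsSerreClass where
  exists_zero := by
    obtain ⟨Z, hZ⟩ := HasZeroObject.zero (C := FIMod R)
    exact ⟨Z, hZ, 0, fun S _ => hZ.obj S⟩
  prop_of_mono := by
    rintro X Y f _ ⟨d, hd⟩
    exact ⟨d, fun S hS => IsZero.of_mono (f.app S) (hd S hS)⟩
  prop_of_epi := by
    rintro X Y f _ ⟨d, hd⟩
    exact ⟨d, fun S hS => IsZero.of_epi (f.app S) (hd S hS)⟩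
  prop_X₂_of_shortExact := by
    rintro T hT ⟨d, hd⟩ ⟨e, he⟩
    refine ⟨max d e, fun S hS => ?_⟩
    have h := hT.map_of_exact ((evaluation FI (ModuleCat.{u} R)).obj S)
    exact h.exact.isZero_of_both_zeros
      ((hd S (lt_of_le_of_lt (le_max_left _ _) hS)).eq_of_src _ _)
      ((he S (lt_of_le_of_lt (le_max_right _ _) hS)).eq_of_tgt _ _)

/-- The morphisms between `FI`-modules presented in finite degree that become invertible in
`FI`-tails: those whose kernel and cokernel (computed degreewise, in the abelian category of all
`FI`-modules) are supported in finite degree. -/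
noncomputable def tailEquivalences :
    MorphismProperty (presentedInFiniteDegree R).FullSubcategory :=
  (supportedInFiniteDegree R).isoModSerre.inverseImage (presentedInFiniteDegree R).ι

end FIMod

/-- The category of `R`-valued `FI`-tails: the Serre quotient of `FI`-modules presented in finite
degree by `FI`-modules supported in finite degree, that is, the localization at the morphisms with
kernel and cokernel supported in finite degree. -/
abbrev FITails (R : Type u) [CommRing R] := (FIMod.tailEquivalences R).Localization

/-! ### The `FI`ᵒᵖ-modules `Ξ(ℓ)` -/

/-- The relations defining `H₀(X, A)`: points of `A`, and differences of two points of `X` that are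
the endpoints of a path (a singular `1`-simplex) in `X`. -/
noncomputable def relH0Relations (X : Type) [TopologicalSpace X] (A : Set X) : AddSubgroup (X →₀ ℤ) :=
  AddSubgroup.closure
    ({z | ∃ a ∈ A, z = Finsupp.single a 1} ∪
      {z | ∃ (x y : X) (_ : Path x y), z = Finsupp.single y 1 - Finsupp.single x 1})

/-- The relative singular homology group `H₀(X, A)` with integer coefficients: the cokernel of
`C₁(X)/C₁(A) → C₀(X)/C₀(A)`. -/
abbrev RelH0 (X : Type) [TopologicalSpace X] (A : Set X) : Type :=
  (X →₀ ℤ) ⧸ relH0Relations X A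

/-- The homology class in `H₀(X, A)` of a point of `X`. -/
noncomputable def RelH0.cls {X : Type} [TopologicalSpace X] (A : Set X) (x : X) : RelH0 X A :=
  QuotientAddGroup.mk (Finsupp.single x 1)

/-- The map on `H₀` induced by a continuous map of pairs. -/
noncomputable def RelH0.map {X Y : Type} [TopologicalSpace X] [TopologicalSpace Y] {A : Set X}
    {B : Set Y} (f : X → Y) (hf : Continuous f) (h : Set.MapsTo f A B) :
    RelH0 X A →+ RelH0 Y B :=
  QuotientAddGroup.map _ _ (Finsupp.mapDomain.addMonoidHom f) (by
    rw [relH0Relations, AddSubgroup.closure_le]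
    rintro z (⟨a, ha, rfl⟩ | ⟨x, y, γ, rfl⟩)
    · refine AddSubgroup.subset_closure (Or.inl ⟨f a, h ha, ?_⟩)
      simp [Finsupp.mapDomain_single]
    · refine AddSubgroup.subset_closure (Or.inr ⟨f x, f y, γ.map hf, ?_⟩)
      simp [Finsupp.mapDomain_single, sub_eq_add_neg, Finsupp.mapDomain_add,
        ← Finsupp.single_neg])

@[simp] lemma RelH0.map_cls {X Y : Type} [TopologicalSpace X] [TopologicalSpace Y] {A : Set X}
    {B : Set Y} (f : X → Y) (hf : Continuous f) (h : Set.MapsTo f A B) (x : X) :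
    RelH0.map f hf h (RelH0.cls A x) = RelH0.cls B (f x) := by
  change QuotientAddGroup.mk (Finsupp.mapDomain f (Finsupp.single x 1)) = _
  rw [Finsupp.mapDomain_single]
  rfl

lemma RelH0.hom_ext {X : Type} [TopologicalSpace X] {A : Set X} {G : Type*} [AddCommGroup G]
    {f g : RelH0 X A →+ G} (h : ∀ x, f (RelH0.cls A x) = g (RelH0.cls A x)) : f = g := by
  refine QuotientAddGroup.addMonoidHom_ext _ (Finsupp.addHom_ext' fun x => ?_)
  refine AddMonoidHom.ext_int ?_
  exact h x

namespace FI

/-- The space `Emb(S, [ℓ] ⊔ ℝ)` of embeddings of the finite discrete space `S`, topologized as a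
subspace of the space of all maps `S → [ℓ] ⊔ ℝ`. -/
abbrev Emb (ℓ : ℕ) (S : FI) : Type :=
  {φ : S.carrier → Fin ℓ ⊕ ℝ // Function.Injective φ}

/-- The subspace of embeddings whose image does not contain `[ℓ]`. -/
def embNotCover (ℓ : ℕ) (S : FI) : Set (Emb ℓ S) :=
  {φ | ¬ Set.range Sum.inl ⊆ Set.range φ.1}

/-- Precomposition of embeddings with an injection. -/
def Emb.precomp (ℓ : ℕ) {S T : FI} (f : S ⟶ T) (φ : Emb ℓ T) : Emb ℓ S :=
  ⟨fun s => φ.1 (toEmb f s), φ.2.comp (toEmb f).injective⟩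

lemma Emb.continuous_precomp (ℓ : ℕ) {S T : FI} (f : S ⟶ T) :
    Continuous (Emb.precomp ℓ f) := by
  refine Continuous.subtype_mk (continuous_pi fun s => ?_) _
  exact (continuous_apply (toEmb f s)).comp continuous_subtype_val

lemma Emb.mapsTo_precomp (ℓ : ℕ) {S T : FI} (f : S ⟶ T) :
    Set.MapsTo (Emb.precomp ℓ f) (embNotCover ℓ T) (embNotCover ℓ S) := by
  intro φ hφ h
  refine hφ (h.trans ?_)
  rintro _ ⟨s, rfl⟩
  exact ⟨toEmb f s, rfl⟩

end FI

/-- `FI`ᵒᵖ-modules: functors from `FI`ᵒᵖ to abelian groups. -/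
abbrev FIopMod := FIᵒᵖ ⥤ AddCommGrpCat.{0}

/-- The `FI`ᵒᵖ-module `Ξ(ℓ)_S = H₀(X_S, A_S)`, with `X_S = Emb(S, [ℓ] ⊔ ℝ)` and `A_S` the subspace of
embeddings whose image does not contain `[ℓ]`; injections act by precomposition. -/
noncomputable def Xi (ℓ : ℕ) : FIopMod where
  obj S := AddCommGrpCat.of (RelH0 (FI.Emb ℓ S.unop) (FI.embNotCover ℓ S.unop))
  map f := AddCommGrpCat.ofHom
    (RelH0.map (FI.Emb.precomp ℓ f.unop) (FI.Emb.continuous_precomp ℓ f.unop)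
      (FI.Emb.mapsTo_precomp ℓ f.unop))
  map_id S := by
    ext : 1
    refine RelH0.hom_ext fun x => ?_
    exact RelH0.map_cls _ (FI.Emb.continuous_precomp ℓ (𝟙 S.unop))
      (FI.Emb.mapsTo_precomp ℓ (𝟙 S.unop)) x
  map_comp f g := by
    ext : 1
    refine RelH0.hom_ext fun x => ?_
    simp only [AddCommGrpCat.hom_ofHom, AddCommGrpCat.hom_comp, AddMonoidHom.comp_apply,
      RelH0.map_cls]
    rfl

/-! ### The category `FJ` and its modules -/

/-- The preadditive category `FJ`: its objects are natural numbers, and a morphism from `ℓ` to `m`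
is a morphism of `FI`ᵒᵖ-modules from `Ξ(ℓ)` to `Ξ(m)`. -/
abbrev FJ := InducedCategory FIopMod Xi

/-- Functors from `FJ` to `R`-modules. -/
abbrev FJFunctor (R : Type u) [CommRing R] := FJ ⥤ ModuleCat.{u} R

/-- The `R`-valued `FJ`-modules (additive functors) supported in finite degree. -/
def FJFunctor.isModuleSupportedInFiniteDegree (R : Type u) [CommRing R] :
    ObjectProperty (FJFunctor R) :=
  fun N => N.Additive ∧ ∃ d : ℕ, ∀ ℓ : ℕ, d < ℓ → IsZero (N.obj (ℓ : FJ))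

/-- The category of `R`-valued `FJ`-modules supported in finite degree. -/
abbrev FJModFin (R : Type u) [CommRing R] :=
  (FJFunctor.isModuleSupportedInFiniteDegree R).FullSubcategory

/-! ### The functor tensor product over `FI` -/

section Tensor

variable {R : Type u} [CommRing R]

/-- The direct sum over `n` of the tensor products `M_n ⊗ N_n`, as an `R`-module. -/
abbrev TensorSum (M : FIMod R) (N : FIopMod) : Type u :=
  ⨁ n : ℕ, ((M.obj (FI.std n) : Type u) ⊗[ℤ] (N.obj (op (FI.std n)) : Type))

/-- The pure tensor `a ⊗ b` in degree `n`. -/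
noncomputable def TensorSum.tmul (M : FIMod R) (N : FIopMod) (n : ℕ) (a : M.obj (FI.std n))
    (b : N.obj (op (FI.std n))) : TensorSum M N :=
  DirectSum.lof R ℕ (fun n => (M.obj (FI.std n) : Type u) ⊗[ℤ] (N.obj (op (FI.std n)) : Type)) n
    (a ⊗ₜ[ℤ] b)

/-- The submodule generated by the differences `a f ⊗ b - a ⊗ f b`. -/
def tensorRelations (M : FIMod R) (N : FIopMod) : Submodule R (TensorSum M N) :=
  Submodule.span R {z | ∃ (m n : ℕ) (f : FI.std m ⟶ FI.std n) (a : M.obj (FI.std m))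
    (b : N.obj (op (FI.std n))),
    z = TensorSum.tmul M N n (M.map f a) b - TensorSum.tmul M N m a (N.map f.op b)}

/-- The functor tensor product `M ⊗_FI N`. -/
abbrev FITensor (M : FIMod R) (N : FIopMod) : Type u :=
  TensorSum M N ⧸ tensorRelations M N

/-- The map on direct sums of tensor products induced by morphisms in both variables. -/
noncomputable def TensorSum.map {M M' : FIMod R} {N N' : FIopMod} (g : M ⟶ M') (φ : N ⟶ N') :
    TensorSum M N →ₗ[R] TensorSum M' N' :=
  DirectSum.lmap fun n => TensorProduct.AlgebraTensorModule.map (g.app (FI.std n)).hom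
    (φ.app (op (FI.std n))).hom.toIntLinearMap

@[simp] lemma TensorSum.map_tmul {M M' : FIMod R} {N N' : FIopMod} (g : M ⟶ M') (φ : N ⟶ N')
    (n : ℕ) (a : M.obj (FI.std n)) (b : N.obj (op (FI.std n))) :
    TensorSum.map g φ (TensorSum.tmul M N n a b) =
      TensorSum.tmul M' N' n (g.app _ a) (φ.app _ b) := by
  simp only [TensorSum.map, TensorSum.tmul]
  exact DirectSum.lmap_lof _ _ _

/-- The map on functor tensor products induced by morphisms in both variables. -/
noncomputable def FITensor.map {M M' : FIMod R} {N N' : FIopMod} (g : M ⟶ M') (φ : N ⟶ N') :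
    FITensor M N →ₗ[R] FITensor M' N' :=
  Submodule.mapQ _ _ (TensorSum.map g φ) (by
    rw [tensorRelations, Submodule.span_le]
    rintro _ ⟨m, n, f, a, b, rfl⟩
    refine Submodule.subset_span ⟨m, n, f, g.app _ a, φ.app _ b, ?_⟩
    simp only [map_sub, TensorSum.map_tmul, NatTrans.naturality_apply])

/-- The class of `a ⊗ b`, for `a` and `b` in degree `n`, in the functor tensor product. -/
noncomputable def FITensor.tmul (M : FIMod R) (N : FIopMod) (n : ℕ) (a : M.obj (FI.std n))
    (b : N.obj (op (FI.std n))) : FITensor M N :=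
  Submodule.Quotient.mk (TensorSum.tmul M N n a b)

@[simp] lemma FITensor.map_tmul {M M' : FIMod R} {N N' : FIopMod} (g : M ⟶ M') (φ : N ⟶ N')
    (n : ℕ) (a : M.obj (FI.std n)) (b : N.obj (op (FI.std n))) :
    FITensor.map g φ (FITensor.tmul M N n a b) =
      FITensor.tmul M' N' n (g.app _ a) (φ.app _ b) := by
  change Submodule.Quotient.mk (TensorSum.map g φ (TensorSum.tmul M N n a b)) = _
  rw [TensorSum.map_tmul]
  rfl

lemma FITensor.hom_ext {M : FIMod R} {N : FIopMod} {P : Type*} [AddCommGroup P] [Module R P]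
    {f g : FITensor M N →ₗ[R] P}
    (h : ∀ n a b, f (FITensor.tmul M N n a b) = g (FITensor.tmul M N n a b)) : f = g := by
  refine Submodule.linearMap_qext _ (DirectSum.linearMap_ext R fun n => ?_)
  refine TensorProduct.AlgebraTensorModule.ext fun a b => ?_
  exact h n a b

lemma FITensor.map_id (M : FIMod R) (N : FIopMod) :
    FITensor.map (𝟙 M) (𝟙 N) = LinearMap.id :=
  FITensor.hom_ext fun _ _ _ => FITensor.map_tmul _ _ _ _ _

lemma FITensor.map_comp {M M' M'' : FIMod R} {N N' N'' : FIopMod} (g : M ⟶ M') (g' : M' ⟶ M'')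
    (φ : N ⟶ N') (φ' : N' ⟶ N'') :
    FITensor.map (g ≫ g') (φ ≫ φ') = FITensor.map g' φ' ∘ₗ FITensor.map g φ := by
  refine FITensor.hom_ext fun n a b => ?_
  rw [LinearMap.comp_apply, FITensor.map_tmul, FITensor.map_tmul, FITensor.map_tmul]
  rfl

/-- The functor `M ⊗_FI Ξ(-)` on `FJ`. -/
noncomputable def tensorXiObj (M : FIMod R) : FJFunctor R where
  obj ℓ := ModuleCat.of R (FITensor M (Xi ℓ))
  map φ := ModuleCat.ofHom (FITensor.map (𝟙 M) φ.hom)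
  map_id ℓ := by
    ext : 1
    exact FITensor.map_id M (Xi ℓ)
  map_comp φ ψ := by
    ext : 1
    exact (FITensor.map_comp (𝟙 M) (𝟙 M) φ.hom ψ.hom)

end Tensor

/-- The functor `M ↦ M ⊗_FI Ξ(-)`. -/
noncomputable def tensorXi (R : Type u) [CommRing R] : FIMod R ⥤ FJFunctor R where
  obj M := tensorXiObj M
  map {M M'} g :=
    { app := fun ℓ => ModuleCat.ofHom (FITensor.map g (𝟙 (Xi ℓ)))
      naturality := fun ℓ m φ => by
        ext : 1
        have h₁ := FITensor.map_comp (𝟙 M) g φ.hom (𝟙 (Xi m))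
        have h₂ := FITensor.map_comp g (𝟙 M') (𝟙 (Xi ℓ)) φ.hom
        rw [Category.id_comp, Category.comp_id] at h₁ h₂
        exact h₁.symm.trans h₂ }
  map_id M := by
    ext ℓ : 3
    exact FITensor.map_id M (Xi ℓ)
  map_comp g h := by
    ext ℓ : 3
    exact FITensor.map_comp g h (𝟙 (Xi ℓ)) (𝟙 (Xi ℓ))

/-! ### Words -/

namespace FI

/-! An embedding of `S` that covers [ℓ] is determined up to isotopy by the list u of the points over
1, ..., ℓ and the order v of the other points on the line. So Ξ(ℓ)_S is free on the pairs (u, v) in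
which every element of `S` occurs once and u has length ℓ (`xiEquiv`). Restriction along an
injection deletes the letters outside the image, and gives zero as soon as a letter of u is lost
(`res`, `xiEquiv_map`).

The functor M ↦ M ⊗ Ξ(-) has the right adjoint N ↦ (S ↦ Hom_FJ(Ξ(-)_S, N)), the natural families
(`tensorXiAdjunction`). If M is presented in finite degree, the unit at M is bijective on all large
sets (`unitLin_bijective`). If N is supported in finite degree, its natural families are presented
in finite degree and the counit at N is bijective (`presentedInFiniteDegree_toFIMod`). Hence the
restricted right adjoint is fully faithful, and the left adjoint is a localization at the morphisms
that it inverts. These are the tail equivalences: by appending letters, M ⊗ Ξ(ℓ) depends only on M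
on large sets (`tensMap_bijective`), and conversely the unit recovers M on large sets
(`isoModSerre_iff_isIso_tensorXi_map`).

The bijectivity of unit and counit rests on three facts.

Truncation. The morphisms `rotateHom` and `swapHom` go from ℓ+1 and ℓ+2 to ℓ. An element of Ξ(ℓ)_T
whose restrictions to all ℓ-element subsets vanish is a sum of elements of their images, with
preimages that vanish wherever the element does (`exists_rotate_add_swap`); morphisms behave
likewise (`exists_comp_rotate_add_comp_swap`). By iteration, an FJ-module that vanishes above d only
sees Ξ on sets of size at most d (`map_eq_zero`, `family_apply_eq_zero`). In turn, a map that is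
natural on such sets agrees there with a morphism of FJ (`exists_extension`).

Retracts. On sets of size at most d and for large S, the identity of the representable functor ℤ
FI(-, S) factors through the finite sum of the Ξ(|A|) over subsets A of S (`exists_resolution`), and
the identity of Ξ(k) in degree k factors through ℤ FI(-, S) (`exists_section`). Both need natural
maps from Ξ(k) to ℤ FI(-, S); `subst_natural` makes them from combinations of lists with prescribed
faces. The first retract shows that taking natural families on large S preserves exactness
(`exists_family_lift`), the second that an FJ-module is generated by the values of its natural
families (`exists_generation`).

Free modules. For these the unit is bijective on every S (`unitLin_injective`,
`unitLin_surjective`), because the coordinates of M ⊗ Ξ(ℓ) can be detected by morphisms of FJ.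
Diagram chases along presentations then give the general case. -/

noncomputable instance (S : FI) : DecidableEq S.carrier := Classical.decEq _

noncomputable instance (S : FI) : Fintype S.carrier := Fintype.ofFinite _

variable {S T U : FI}

open scoped Classical in
/-- The partial inverse of an injection. -/
noncomputable def pinv (f : S ⟶ T) (t : T.carrier) : Option S.carrier :=
  if h : ∃ s, toEmb f s = t then some h.choose else none

lemma pinv_eq_some {f : S ⟶ T} {t : T.carrier} {s : S.carrier} :
    pinv f t = some s ↔ toEmb f s = t := by
  unfold pinv
  split_ifs with h
  · rw [Option.some_inj]
    constructor
    · rintro rfl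
      exact h.choose_spec
    · rintro rfl
      exact (toEmb f).injective h.choose_spec
  · simp only [false_iff]
    exact fun h' => h ⟨s, h'⟩

@[simp] lemma pinv_apply (f : S ⟶ T) (s : S.carrier) : pinv f (toEmb f s) = some s :=
  pinv_eq_some.2 rfl

lemma pinv_eq_none {f : S ⟶ T} {t : T.carrier} : pinv f t = none ↔ ∀ s, toEmb f s ≠ t := by
  rw [Option.eq_none_iff_forall_ne_some]
  exact forall_congr' fun s => not_congr pinv_eq_some

/-- The word in `S` obtained from a word in `T` by deleting the letters outside the image of an
injection `f : S ⟶ T`. -/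
noncomputable def pull (f : S ⟶ T) (l : List T.carrier) : List S.carrier := l.filterMap (pinv f)

@[simp] lemma pull_nil (f : S ⟶ T) : pull f [] = [] := rfl

@[simp] lemma pull_append (f : S ⟶ T) (l m : List T.carrier) :
    pull f (l ++ m) = pull f l ++ pull f m := List.filterMap_append

@[simp] lemma pull_cons_apply (f : S ⟶ T) (s : S.carrier) (l : List T.carrier) :
    pull f (toEmb f s :: l) = s :: pull f l := by
  simp [pull]

lemma pull_cons_of_none {f : S ⟶ T} {t : T.carrier} (h : pinv f t = none) (l : List T.carrier) :
    pull f (t :: l) = pull f l := by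
  simp [pull, h]

lemma pull_cases (f : S ⟶ T) (t : T.carrier) : (∃ s, toEmb f s = t) ∨ pinv f t = none := by
  rw [pinv_eq_none]
  by_cases h : ∃ s, toEmb f s = t
  · exact Or.inl h
  · exact Or.inr (by simpa using h)

lemma length_pull_le (f : S ⟶ T) (l : List T.carrier) : (pull f l).length ≤ l.length :=
  List.length_filterMap_le _ _

@[simp] lemma pull_map (f : S ⟶ T) (l : List S.carrier) : pull f (l.map (toEmb f)) = l := by
  induction l with
  | nil => rfl
  | cons a l ih => rw [List.map_cons, pull_cons_apply, ih]

/-- Deletion never lengthens a list, so equal lengths mean that no letter was deleted. This is the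
test used throughout for whether a restriction keeps all distinguished letters. -/
lemma map_pull_of_length_eq (f : S ⟶ T) {l : List T.carrier} (h : (pull f l).length = l.length) :
    (pull f l).map (toEmb f) = l := by
  induction l with
  | nil => rfl
  | cons t l ih =>
    rcases pull_cases f t with ⟨s, rfl⟩ | ht
    · rw [pull_cons_apply] at h ⊢
      simp only [List.length_cons, Nat.add_right_cancel_iff] at h
      rw [List.map_cons, ih h]
    · rw [pull_cons_of_none ht] at h
      have := length_pull_le f l
      simp only [List.length_cons] at h
      omega

lemma length_pull_eq (f : S ⟶ T) {l : List T.carrier} (h : ∀ t ∈ l, ∃ s, toEmb f s = t) :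
    (pull f l).length = l.length := by
  induction l with
  | nil => rfl
  | cons t l ih =>
    obtain ⟨s, rfl⟩ := h t List.mem_cons_self
    rw [pull_cons_apply, List.length_cons, List.length_cons,
      ih fun t ht => h t (List.mem_cons_of_mem _ ht)]

@[simp] lemma count_pull (f : S ⟶ T) (l : List T.carrier) (s : S.carrier) :
    (pull f l).count s = l.count (toEmb f s) := by
  induction l with
  | nil => rfl
  | cons t l ih =>
    rcases pull_cases f t with ⟨s', rfl⟩ | ht
    · rw [pull_cons_apply, List.count_cons, List.count_cons, ih]
      simp
    · rw [pull_cons_of_none ht, List.count_cons, ih]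
      have := pinv_eq_none.1 ht s
      simp [this.symm]

@[simp] lemma mem_pull {f : S ⟶ T} {l : List T.carrier} {s : S.carrier} :
    s ∈ pull f l ↔ toEmb f s ∈ l := by
  rw [← List.count_pos_iff, ← List.count_pos_iff, count_pull]

@[simp] lemma pull_id (l : List S.carrier) : pull (𝟙 S) l = l := by
  conv_lhs => rw [← List.map_id l]
  exact pull_map (𝟙 S) l

lemma pull_comp (f : S ⟶ T) (g : T ⟶ U) (l : List U.carrier) :
    pull (f ≫ g) l = pull f (pull g l) := by
  induction l with
  | nil => rfl
  | cons t l ih =>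
    rcases pull_cases g t with ⟨s, rfl⟩ | ht
    · rw [pull_cons_apply]
      rcases pull_cases f s with ⟨s, rfl⟩ | hs
      · rw [pull_cons_apply, ← toEmb_comp, pull_cons_apply, ih]
      · rw [pull_cons_of_none hs, pull_cons_of_none, ih]
        rw [pinv_eq_none] at hs ⊢
        exact fun x hx => hs x ((toEmb g).injective hx)
    · rw [pull_cons_of_none ht, pull_cons_of_none, ih]
      rw [pinv_eq_none] at ht ⊢
      exact fun x hx => ht _ hx

/-- A pair of words in which every element of `S` occurs exactly once, the first of length `ℓ`. -/
def IsWord (ℓ : ℕ) (u v : List S.carrier) : Prop :=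
  u.length = ℓ ∧ ∀ x, u.count x + v.count x = 1

lemma IsWord.pull {ℓ : ℕ} {u v : List T.carrier} (h : IsWord ℓ u v) (f : S ⟶ T)
    (hf : (pull f u).length = ℓ) : IsWord ℓ (pull f u) (pull f v) :=
  ⟨hf, fun x => by rw [count_pull, count_pull, h.2]⟩

lemma IsWord.length {ℓ : ℕ} {u v : List S.carrier} (h : IsWord ℓ u v) :
    u.length + v.length = S.card := by
  have h1 : (u ++ v).Nodup := List.nodup_iff_count_le_one.2 fun x => by
    rw [List.count_append, h.2]
  have h2 : (u ++ v).toFinset = Finset.univ := by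
    ext x
    have := h.2 x
    simp only [List.mem_toFinset, Finset.mem_univ, iff_true]
    rw [← List.count_pos_iff, List.count_append]
    omega
  rw [← List.length_append, ← List.toFinset_card_of_nodup h1, h2, FI.card,
    Nat.card_eq_fintype_card, Finset.card_univ]

/-- The words indexing a basis of `Ξ(ℓ)_S`. -/
structure Word (ℓ : ℕ) (S : FI) : Type where
  /-- The distinguished letters. -/
  fst : List S.carrier
  /-- The remaining letters, in order. -/
  snd : List S.carrier
  isWord : IsWord ℓ fst snd

/-- The free abelian group on words. -/
abbrev WordGroup (ℓ : ℕ) (S : FI) : Type := Word ℓ S →₀ ℤ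

open scoped Classical in
/-- The basis element given by a pair of lists, or zero if it is not a word. -/
noncomputable def wd (ℓ : ℕ) (u v : List S.carrier) : WordGroup ℓ S :=
  if h : IsWord ℓ u v then Finsupp.single ⟨u, v, h⟩ 1 else 0

/-- The default value zero of `wd` encodes the quotient by `embNotCover`: a restriction that loses a
distinguished letter no longer covers [ℓ]. -/
lemma wd_of_length_ne {ℓ : ℕ} {u : List S.carrier} (h : u.length ≠ ℓ) (v : List S.carrier) :
    wd ℓ u v = 0 := dif_neg fun h' => h h'.1

lemma wd_of_isWord {ℓ : ℕ} {u v : List S.carrier} (h : IsWord ℓ u v) :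
    wd ℓ u v = Finsupp.single (⟨u, v, h⟩ : Word ℓ S) 1 := dif_pos h

/-- The homomorphism out of the group of words with given values. -/
noncomputable def desc {ℓ : ℕ} {A : Type*} [AddCommGroup A]
    (F : List S.carrier → List S.carrier → A) : WordGroup ℓ S →+ A :=
  Finsupp.liftAddHom fun p => zmultiplesHom A (F p.fst p.snd)

lemma desc_wd {ℓ : ℕ} {A : Type*} [AddCommGroup A] (F : List S.carrier → List S.carrier → A)
    {u v : List S.carrier} (h : IsWord ℓ u v) : desc F (wd ℓ u v) = F u v := by
  rw [wd_of_isWord h, desc, Finsupp.liftAddHom_apply_single]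
  exact one_zsmul _

lemma wordGroup_hom_ext {ℓ : ℕ} {A : Type*} [AddCommGroup A] {F G : WordGroup ℓ S →+ A}
    (h : ∀ u v, IsWord ℓ u v → F (wd ℓ u v) = G (wd ℓ u v)) : F = G := by
  refine Finsupp.addHom_ext' fun p => AddMonoidHom.ext_int ?_
  have := h p.fst p.snd p.isWord
  rwa [wd_of_isWord p.isWord] at this

lemma wordGroup_induction {ℓ : ℕ} {P : WordGroup ℓ S → Prop} (x : WordGroup ℓ S) (h0 : P 0)
    (hadd : ∀ x y, P x → P y → P (x + y)) (hneg : ∀ x, P x → P (-x))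
    (hwd : ∀ u v, IsWord ℓ u v → P (wd ℓ u v)) : P x := by
  let A : AddSubgroup (WordGroup ℓ S) :=
    { carrier := {x | P x}, zero_mem' := h0, add_mem' := hadd _ _, neg_mem' := hneg _ }
  change x ∈ A
  induction x using Finsupp.induction_linear with
  | zero => exact A.zero_mem
  | add x y hx hy => exact A.add_mem hx hy
  | single p n =>
    have h1 : Finsupp.single p (1 : ℤ) ∈ A := by
      have := hwd p.fst p.snd p.isWord
      rwa [wd_of_isWord p.isWord] at this
    have h2 := A.zsmul_mem h1 n
    rwa [Finsupp.smul_single_one] at h2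

/-- Restriction of words along an injection. -/
noncomputable def res (ℓ : ℕ) (f : S ⟶ T) : WordGroup ℓ T →+ WordGroup ℓ S :=
  desc fun u v => wd ℓ (pull f u) (pull f v)

lemma res_wd {ℓ : ℕ} (f : S ⟶ T) {u v : List T.carrier} (h : IsWord ℓ u v) :
    res ℓ f (wd ℓ u v) = wd ℓ (pull f u) (pull f v) := desc_wd _ h

lemma res_id (ℓ : ℕ) : res ℓ (𝟙 S) = AddMonoidHom.id _ :=
  wordGroup_hom_ext fun u v h => by simp [res_wd _ h]

lemma res_comp (ℓ : ℕ) (f : S ⟶ T) (g : T ⟶ U) : res ℓ (f ≫ g) = (res ℓ f).comp (res ℓ g) :=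
  wordGroup_hom_ext fun u v h => by
    rw [AddMonoidHom.comp_apply, res_wd _ h, res_wd _ h, pull_comp, pull_comp]
    by_cases hl : (pull g u).length = ℓ
    · rw [res_wd _ (h.pull g hl)]
    · rw [wd_of_length_ne hl, map_zero, wd_of_length_ne]
      have h1 := length_pull_le f (pull g u)
      have h2 := length_pull_le g u
      have h3 := h.1
      omega

/-- The form in which naturality is checked on basis words. When a distinguished letter is lost, the
restricted word is zero, so `r (F u v)` has to vanish as well. -/
lemma desc_res {ℓ : ℕ} {A B : Type*} [AddCommGroup A] [AddCommGroup B]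
    {F : List T.carrier → List T.carrier → A} {G : List S.carrier → List S.carrier → B} (f : S ⟶ T)
    (r : A →+ B) (h : ∀ u v, IsWord ℓ u v →
      r (F u v) = if (pull f u).length = ℓ then G (pull f u) (pull f v) else 0)
    (x : WordGroup ℓ T) : r (desc F x) = desc G (res ℓ f x) := by
  suffices r.comp (desc F) = (desc G).comp (res ℓ f) from DFunLike.congr_fun this x
  refine wordGroup_hom_ext fun u v hw => ?_
  rw [AddMonoidHom.comp_apply, AddMonoidHom.comp_apply, res_wd _ hw, desc_wd _ hw, h u v hw]
  split_ifs with hl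
  · rw [desc_wd _ (hw.pull _ hl)]
  · rw [wd_of_length_ne hl, map_zero]

end FI

open FI

/-! ### The comparison of `Ξ(ℓ)` with words -/

namespace FI

variable {ℓ : ℕ} {S T : FI}

/-- The order on the real points of an embedding. -/
def Emb.lt (φ : Emb ℓ S) (s t : S.carrier) : Prop :=
  ∃ a b : ℝ, φ.1 s = Sum.inr a ∧ φ.1 t = Sum.inr b ∧ a < b

/-- The embedding `φ` lists the points `[ℓ]` by `u`, and the real points in order by `v`. -/
def Emb.HasType (φ : Emb ℓ S) (u v : List S.carrier) : Prop :=
  IsWord ℓ u v ∧ u.map φ.1 = (List.finRange ℓ).map Sum.inl ∧ v.Pairwise φ.lt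

namespace Emb.HasType

variable {φ ψ : Emb ℓ S} {u v u' v' : List S.carrier}

lemma exists_real (h : φ.HasType u v) {s : S.carrier} (hs : s ∈ v) : ∃ a : ℝ, φ.1 s = Sum.inr a := by
  rcases hφ : φ.1 s with i | a
  · have h1 : Sum.inl i ∈ u.map φ.1 := by
      rw [h.2.1]
      exact List.mem_map_of_mem (List.mem_finRange i)
    obtain ⟨s', hs', h2⟩ := List.mem_map.1 h1
    rw [← hφ] at h2
    obtain rfl := φ.2 h2
    have := h.1.2 s'
    rw [← List.count_pos_iff] at hs hs'
    omega
  · exact ⟨a, rfl⟩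

lemma mem_or (h : φ.HasType u v) (s : S.carrier) : s ∈ u ∨ s ∈ v := by
  have := h.1.2 s
  rw [← List.count_pos_iff, ← List.count_pos_iff]
  omega

lemma exists_fin (h : φ.HasType u v) {s : S.carrier} (hs : s ∈ u) : ∃ i, φ.1 s = Sum.inl i := by
  have h1 : φ.1 s ∈ u.map φ.1 := List.mem_map_of_mem hs
  rw [h.2.1] at h1
  obtain ⟨i, _, h2⟩ := List.mem_map.1 h1
  exact ⟨i, h2.symm⟩

lemma covers (h : φ.HasType u v) : Set.range Sum.inl ⊆ Set.range φ.1 := by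
  rintro _ ⟨i, rfl⟩
  have h1 : Sum.inl i ∈ u.map φ.1 := by
    rw [h.2.1]
    exact List.mem_map_of_mem (List.mem_finRange i)
  obtain ⟨s, _, h2⟩ := List.mem_map.1 h1
  exact ⟨s, h2⟩

/-- Injectivity of φ makes it possible to read off u. The letters of v are then known, and a set has
only one strictly increasing enumeration. -/
lemma unique (h : φ.HasType u v) (h' : φ.HasType u' v') : u = u' ∧ v = v' := by
  have hu : u = u' := List.map_injective_iff.2 φ.2 (h.2.1.trans h'.2.1.symm)
  refine ⟨hu, ?_⟩
  subst hu
  refine List.Perm.eq_of_pairwise (le := φ.lt) ?_ h.2.2 h'.2.2 ?_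
  · rintro a b - - ⟨x, y, h1, h2, h3⟩ ⟨x', y', h1', h2', h3'⟩
    rw [h2] at h1'
    rw [h1] at h2'
    cases h1'
    cases h2'
    exact absurd h3 h3'.asymm
  · rw [List.perm_iff_count]
    intro a
    have h1 := h.1.2 a
    have h2 := h'.1.2 a
    omega

end Emb.HasType

lemma Emb.exists_hasType (φ : Emb ℓ S) (h : φ ∉ embNotCover ℓ S) : ∃ u v, φ.HasType u v := by
  have h : Set.range Sum.inl ⊆ Set.range φ.1 := not_not.1 h
  choose t ht using fun i => h ⟨i, rfl⟩
  let ρ : S.carrier → ℝ := fun s => Sum.elim (fun _ => 0) id (φ.1 s)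
  let r : S.carrier → S.carrier → Prop := fun s s' => ρ s ≤ ρ s'
  classical
  have : Std.Total r := ⟨fun a b => le_total (ρ a) (ρ b)⟩
  have : IsTrans S.carrier r := ⟨fun a b c => le_trans⟩
  let l := (Finset.univ.filter fun s => (φ.1 s).isRight = true).toList
  have ht' : Function.Injective t := fun i j hij => by
    have := congrArg φ.1 hij
    rw [ht, ht] at this
    exact Sum.inl_injective this
  have hl : ∀ s, s ∈ l.insertionSort r ↔ (φ.1 s).isRight = true := fun s => by
    rw [(List.perm_insertionSort r l).mem_iff]
    simp [l]
  have hnd : (l.insertionSort r).Nodup :=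
    (List.perm_insertionSort r l).nodup_iff.2 (Finset.nodup_toList _)
  refine ⟨(List.finRange ℓ).map t, l.insertionSort r, ⟨by simp, fun s => ?_⟩, ?_, ?_⟩
  · have hnd' : ((List.finRange ℓ).map t).Nodup := (List.nodup_finRange ℓ).map ht'
    rcases hφ : φ.1 s with i | a
    · have h1 : s ∉ l.insertionSort r := by simp [hl, hφ]
      have h2 : s ∈ (List.finRange ℓ).map t :=
        List.mem_map.2 ⟨i, List.mem_finRange i, φ.2 ((ht i).trans hφ.symm)⟩
      rw [List.count_eq_zero_of_not_mem h1, List.count_eq_one_of_mem hnd' h2]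
    · have h1 : s ∈ l.insertionSort r := by simp [hl, hφ]
      have h2 : s ∉ (List.finRange ℓ).map t := by
        rintro h2
        obtain ⟨i, _, rfl⟩ := List.mem_map.1 h2
        rw [ht] at hφ
        cases hφ
      rw [List.count_eq_zero_of_not_mem h2, List.count_eq_one_of_mem hnd h1]
  · rw [List.map_map]
    exact List.map_congr_left fun i _ => ht i
  · refine ((List.pairwise_insertionSort r l).and hnd).imp_of_mem ?_
    rintro a b ha hb ⟨h1, h2⟩
    rw [hl] at ha hb
    obtain ⟨x, hx⟩ := Sum.isRight_iff.1 ha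
    obtain ⟨y, hy⟩ := Sum.isRight_iff.1 hb
    refine ⟨x, y, hx, hy, lt_of_le_of_ne ?_ ?_⟩
    · simpa [r, ρ, hx, hy] using h1
    · rintro rfl
      exact h2 (φ.2 (hx.trans hy.symm))

lemma Emb.HasType.precomp {φ : Emb ℓ T} {u v : List T.carrier} (h : φ.HasType u v) (f : S ⟶ T)
    (hf : (pull f u).length = ℓ) : (Emb.precomp ℓ f φ).HasType (pull f u) (pull f v) := by
  refine ⟨h.1.pull f hf, ?_, ?_⟩
  · rw [← h.2.1]
    conv_rhs => rw [← map_pull_of_length_eq f (hf.trans h.1.1.symm)]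
    rw [List.map_map]
    rfl
  · refine List.Pairwise.filterMap (pinv f) ?_ h.2.2
    rintro a a' haa b hb b' hb'
    rw [pinv_eq_some] at hb hb'
    subst hb hb'
    exact haa

lemma Emb.HasType.precomp_mem {φ : Emb ℓ T} {u v : List T.carrier} (h : φ.HasType u v) (f : S ⟶ T)
    (hf : (pull f u).length ≠ ℓ) : Emb.precomp ℓ f φ ∈ embNotCover ℓ S := by
  intro hc
  apply hf
  have h1 : ∀ t ∈ u, ∃ s, toEmb f s = t := by
    intro t ht
    obtain ⟨i, hi⟩ := h.exists_fin ht
    obtain ⟨s, hs⟩ := hc ⟨i, rfl⟩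
    exact ⟨s, φ.2 (Eq.trans hs hi.symm)⟩
  rw [length_pull_eq f h1, h.1.1]

lemma isClopen_inl (γ : unitInterval → Emb ℓ S) (hγ : Continuous γ) (s : S.carrier) (i : Fin ℓ) :
    IsClopen {τ | (γ τ).1 s = Sum.inl i} := by
  have hc : Continuous fun τ => (γ τ).1 s :=
    (continuous_apply s).comp (continuous_subtype_val.comp hγ)
  refine IsClopen.preimage (s := {Sum.inl i}) ⟨isClosed_singleton, ?_⟩ hc
  rw [← Set.image_singleton]
  exact isOpenMap_inl _ (isOpen_discrete _)

/-- The complement is open too: distinct letters not in the order s < t either involve a point of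
the open subset [ℓ], or have real values in the opposite strict order. -/
lemma isClopen_lt (γ : unitInterval → Emb ℓ S) (hγ : Continuous γ) (s t : S.carrier) :
    IsClopen {τ | (γ τ).lt s t} := by
  have hc : Continuous fun τ => ((γ τ).1 s, (γ τ).1 t) :=
    ((continuous_apply s).comp (continuous_subtype_val.comp hγ)).prodMk
      ((continuous_apply t).comp (continuous_subtype_val.comp hγ))
  have hopen : ∀ P : Set (ℝ × ℝ), IsOpen P → IsOpen {τ | ∃ a b : ℝ, (γ τ).1 s = Sum.inr a ∧
      (γ τ).1 t = Sum.inr b ∧ (a, b) ∈ P} := fun P hP => by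
    have : IsOpen (Prod.map Sum.inr Sum.inr '' P : Set ((Fin ℓ ⊕ ℝ) × (Fin ℓ ⊕ ℝ))) :=
      (isOpenMap_inr.prodMap isOpenMap_inr) _ hP
    convert this.preimage hc using 1
    ext τ
    constructor
    · rintro ⟨a, b, h1, h2, h3⟩
      exact ⟨(a, b), h3, by simp [h1, h2]⟩
    · rintro ⟨⟨a, b⟩, h3, h4⟩
      simp only [Prod.map_apply, Prod.mk.injEq] at h4
      exact ⟨a, b, h4.1.symm, h4.2.symm, h3⟩
  have hlt := isOpen_lt (continuous_fst (X := ℝ) (Y := ℝ)) (continuous_snd (X := ℝ) (Y := ℝ))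
  have hgt := isOpen_lt (continuous_snd (X := ℝ) (Y := ℝ)) (continuous_fst (X := ℝ) (Y := ℝ))
  by_cases hst : s = t
  · subst hst
    convert isClopen_empty
    ext τ
    simp only [Set.mem_ofPred_eq, Set.mem_empty_iff_false, iff_false]
    rintro ⟨a, b, h1, h2, h3⟩
    rw [h1] at h2
    cases h2
    exact lt_irrefl _ h3
  refine ⟨⟨?_⟩, hopen _ hlt⟩
  have h1 := isOpen_iUnion fun i : Fin ℓ =>
    ((isClopen_inl γ hγ s i).2.union (isClopen_inl γ hγ t i).2)
  convert h1.union (hopen _ hgt) using 1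
  ext τ
  simp only [Set.mem_compl_iff, Set.mem_ofPred_eq, Set.mem_union, Set.mem_iUnion]
  constructor
  · intro h
    rcases h1 : (γ τ).1 s with i | a
    · exact Or.inl ⟨i, Or.inl rfl⟩
    rcases h2 : (γ τ).1 t with i | b
    · exact Or.inl ⟨i, Or.inr rfl⟩
    refine Or.inr ⟨a, b, rfl, rfl, lt_of_le_of_ne (not_lt.1 fun hab => h ⟨a, b, h1, h2, hab⟩) ?_⟩
    rintro rfl
    exact hst ((γ τ).2 (h1.trans h2.symm))
  · rintro (⟨i, h | h⟩ | ⟨a, b, h1, h2, h3⟩) ⟨a', b', h1', h2', h3'⟩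
    · rw [h] at h1'
      cases h1'
    · rw [h] at h2'
      cases h2'
    · rw [h1] at h1'
      rw [h2] at h2'
      cases h1'
      cases h2'
      exact absurd h3' (not_lt.2 h3.le)

lemma eq_of_isClopen {P : unitInterval → Prop} (h : IsClopen {τ | P τ}) {τ : unitInterval}
    (hτ : P τ) (τ' : unitInterval) : P τ' := by
  have := h.eq_univ ⟨τ, hτ⟩
  exact (Set.eq_univ_iff_forall.1 this) τ'

/-- The conditions that define the type are clopen along the path, and the interval is connected. -/
lemma Emb.HasType.path {φ ψ : Emb ℓ S} (γ : Path φ ψ) {u v : List S.carrier}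
    (h : φ.HasType u v) : ψ.HasType u v := by
  have h0 := γ.source
  have h1 := γ.target
  refine ⟨h.1, ?_, h.2.2.imp fun {s t} hst => ?_⟩
  · rw [← h.2.1]
    refine List.map_congr_left fun s hs => ?_
    obtain ⟨i, hi⟩ := h.exists_fin hs
    rw [hi]
    have := eq_of_isClopen (isClopen_inl γ γ.continuous s i) (τ := 0) (by rw [h0, hi]) 1
    rwa [h1] at this
  · have := eq_of_isClopen (isClopen_lt γ γ.continuous s t) (τ := 0) (by rwa [h0]) 1
    rwa [h1] at this

/-- Two embeddings of the same type are connected by a path. -/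
lemma Emb.HasType.joined {φ ψ : Emb ℓ S} {u v : List S.carrier} (h : φ.HasType u v)
    (h' : ψ.HasType u v) : Nonempty (Path φ ψ) := by
  have hu : ∀ s ∈ u, φ.1 s = ψ.1 s :=
    List.map_inj_left.1 (h.2.1.trans h'.2.1.symm)
  let ρ : Emb ℓ S → S.carrier → ℝ := fun φ s => Sum.elim (fun _ => 0) id (φ.1 s)
  have hρ : ∀ {φ : Emb ℓ S}, φ.HasType u v → ∀ s ∈ v, φ.1 s = Sum.inr (ρ φ s) := by
    intro φ h s hs
    obtain ⟨a, ha⟩ := h.exists_real hs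
    simp [ρ, ha]
  have huv : ∀ s ∈ u, s ∉ v := fun s hs hs' => by
    have := h.1.2 s
    rw [← List.count_pos_iff] at hs hs'
    omega
  have hlt : ∀ {φ : Emb ℓ S}, φ.HasType u v → ∀ {s t}, s ∈ v → t ∈ v → φ.lt s t → ρ φ s < ρ φ t := by
    rintro φ h s t hs ht ⟨a, b, h1, h2, h3⟩
    simpa [ρ, h1, h2] using h3
  have htot : ∀ s ∈ v, ∀ t ∈ v, s ≠ t → (φ.lt s t ∧ ψ.lt s t) ∨ (φ.lt t s ∧ ψ.lt t s) := by
    intro s hs t ht hst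
    have key := (h.2.2.and h'.2.2).imp (fun {a b} hab => (Or.inl hab :
      (φ.lt a b ∧ ψ.lt a b) ∨ (φ.lt b a ∧ ψ.lt b a)))
    have : Std.Symm fun a b => (φ.lt a b ∧ ψ.lt a b) ∨ (φ.lt b a ∧ ψ.lt b a) := ⟨fun _ _ => Or.symm⟩
    exact key.forall hs ht hst
  -- Linear interpolation of the real coordinates. Both embeddings order v in the same way, so the
  -- strict order, and with it injectivity, persists for every τ.
  let F : unitInterval → S.carrier → Fin ℓ ⊕ ℝ := fun τ s =>
    if s ∈ v then Sum.inr ((1 - (τ : ℝ)) * ρ φ s + τ * ρ ψ s) else φ.1 s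
  have hmono : ∀ (τ : unitInterval) {s t}, s ∈ v → t ∈ v → (φ.lt s t ∧ ψ.lt s t) →
      (1 - (τ : ℝ)) * ρ φ s + τ * ρ ψ s < (1 - (τ : ℝ)) * ρ φ t + τ * ρ ψ t := by
    rintro τ s t hs ht ⟨h1, h2⟩
    have h1 := hlt h hs ht h1
    have h2 := hlt h' hs ht h2
    have h3 := τ.2.1
    have h4 := τ.2.2
    rcases h3.eq_or_lt with h5 | h5
    · rw [← h5]
      simpa using h1
    · nlinarith [mul_lt_mul_of_pos_left h2 h5, mul_le_mul_of_nonneg_left h1.le (sub_nonneg.2 h4)]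
  have hF : ∀ τ, Function.Injective (F τ) := by
    intro τ s t hst
    by_contra hne
    simp only [F] at hst
    by_cases hs : s ∈ v <;> by_cases ht : t ∈ v
    · rw [if_pos hs, if_pos ht] at hst
      have hst := Sum.inr_injective hst
      rcases htot s hs t ht hne with h1 | h1
      · exact (hmono τ hs ht h1).ne hst
      · exact (hmono τ ht hs h1).ne hst.symm
    · rw [if_pos hs, if_neg ht] at hst
      obtain ⟨i, hi⟩ := h.exists_fin ((h.mem_or t).resolve_right ht)
      rw [hi] at hst
      cases hst
    · rw [if_neg hs, if_pos ht] at hst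
      obtain ⟨i, hi⟩ := h.exists_fin ((h.mem_or s).resolve_right hs)
      rw [hi] at hst
      cases hst
    · rw [if_neg hs, if_neg ht] at hst
      exact hne (φ.2 hst)
  refine ⟨{ toFun := fun τ => ⟨F τ, hF τ⟩, continuous_toFun := ?_, source' := ?_, target' := ?_ }⟩
  · refine Continuous.subtype_mk (continuous_pi fun s => ?_) _
    by_cases hs : s ∈ v
    · simp only [F, if_pos hs]
      fun_prop
    · simp only [F, if_neg hs]
      fun_prop
  · ext s : 2
    by_cases hs : s ∈ v
    · simp [F, if_pos hs, hρ h s hs]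
    · simp [F, if_neg hs]
  · ext s : 2
    by_cases hs : s ∈ v
    · simp [F, if_pos hs, hρ h' s hs]
    · simp [F, if_neg hs, hu s ((h.mem_or s).resolve_right hs)]

lemma IsWord.exists_emb {u v : List S.carrier} (h : IsWord ℓ u v) :
    ∃ φ : Emb ℓ S, φ.HasType u v := by
  have hu : u.Nodup := List.nodup_iff_count_le_one.2 fun x => by have := h.2 x; omega
  have hv : v.Nodup := List.nodup_iff_count_le_one.2 fun x => by have := h.2 x; omega
  have huv : ∀ s, s ∉ u → s ∈ v := fun s hs => by
    have := h.2 s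
    rw [← List.count_pos_iff] at hs ⊢
    omega
  have hvu : ∀ s ∈ v, s ∉ u := fun s hs hs' => by
    have := h.2 s
    rw [← List.count_pos_iff] at hs hs'
    omega
  let F : S.carrier → Fin ℓ ⊕ ℝ := fun s =>
    if hs : s ∈ u then Sum.inl ⟨u.idxOf s, h.1 ▸ List.idxOf_lt_length_iff.2 hs⟩
    else Sum.inr (v.idxOf s)
  have hF : Function.Injective F := by
    intro s t hst
    simp only [F] at hst
    split_ifs at hst with h1 h2 h2
    · simp only [Sum.inl.injEq, Fin.mk.injEq] at hst
      exact (List.idxOf_inj h1).1 hst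
    · simp only [Sum.inr.injEq, Nat.cast_inj] at hst
      exact (List.idxOf_inj (huv s h1)).1 hst
  refine ⟨⟨F, hF⟩, h, ?_, ?_⟩
  · refine List.ext_getElem (by simp [h.1]) fun i h1 h2 => ?_
    have h3 : i < u.length := by simpa using h1
    simp [F, List.getElem_mem, hu.idxOf_getElem]
  · rw [List.pairwise_iff_getElem]
    intro i j hi hj hij
    refine ⟨i, j, ?_, ?_, by exact_mod_cast hij⟩
    · simp [F, hvu _ (List.getElem_mem hi), hv.idxOf_getElem]
    · simp [F, hvu _ (List.getElem_mem hj), hv.idxOf_getElem]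

open scoped Classical in
/-- The word of an embedding, or zero if the embedding does not cover `[ℓ]`. -/
noncomputable def Emb.word (φ : Emb ℓ S) : WordGroup ℓ S :=
  if h : ∃ p : List S.carrier × List S.carrier, φ.HasType p.1 p.2 then
    wd ℓ h.choose.1 h.choose.2 else 0

lemma Emb.HasType.word_eq {φ : Emb ℓ S} {u v : List S.carrier} (h : φ.HasType u v) :
    φ.word = wd ℓ u v := by
  have h' : ∃ p : List S.carrier × List S.carrier, φ.HasType p.1 p.2 := ⟨(u, v), h⟩
  rw [Emb.word, dif_pos h']
  obtain ⟨h1, h2⟩ := h'.choose_spec.unique h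
  rw [h1, h2]

lemma Emb.word_of_mem {φ : Emb ℓ S} (h : φ ∈ embNotCover ℓ S) : φ.word = 0 :=
  dif_neg fun ⟨_, hp⟩ => h hp.covers

/-- The map from `Ξ(ℓ)` to words. -/
noncomputable def toWord (ℓ : ℕ) (S : FI) : RelH0 (Emb ℓ S) (embNotCover ℓ S) →+ WordGroup ℓ S :=
  QuotientAddGroup.lift _ (Finsupp.liftAddHom fun φ => zmultiplesHom _ φ.word) (by
    rw [relH0Relations, AddSubgroup.closure_le]
    rintro z (⟨φ, hφ, rfl⟩ | ⟨φ, ψ, γ, rfl⟩)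
    · simp [Emb.word_of_mem hφ]
    · suffices ψ.word = φ.word by
        change (Finsupp.liftAddHom fun φ : Emb ℓ S => zmultiplesHom _ φ.word)
          (Finsupp.single ψ 1 - Finsupp.single φ 1) = 0
        rw [map_sub, Finsupp.liftAddHom_apply_single, Finsupp.liftAddHom_apply_single, this,
          sub_self]
      -- A path cannot leave `embNotCover`, since the reversed path would carry a type back to φ.
      by_cases hφ : φ ∈ embNotCover ℓ S
      · rw [Emb.word_of_mem hφ]
        by_contra hψ
        have hψ : ψ ∉ embNotCover ℓ S := fun h => hψ (Emb.word_of_mem h)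
        obtain ⟨u, v, h⟩ := ψ.exists_hasType hψ
        exact hφ (h.path γ.symm).covers
      · obtain ⟨u, v, h⟩ := φ.exists_hasType hφ
        rw [h.word_eq, (h.path γ).word_eq])

@[simp] lemma toWord_cls (φ : Emb ℓ S) : toWord ℓ S (RelH0.cls _ φ) = φ.word := by
  change (Finsupp.liftAddHom fun φ : Emb ℓ S => zmultiplesHom _ φ.word) (Finsupp.single φ 1) = _
  simp

/-- The map from words to `Ξ(ℓ)`. -/
noncomputable def ofWord (ℓ : ℕ) (S : FI) : WordGroup ℓ S →+ RelH0 (Emb ℓ S) (embNotCover ℓ S) :=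
  Finsupp.liftAddHom fun p => zmultiplesHom _ (RelH0.cls _ p.isWord.exists_emb.choose)

/-- Embeddings of the same type are joined by a path, so the chosen embedding may be replaced by any
other one of its type. -/
lemma ofWord_wd {φ : Emb ℓ S} {u v : List S.carrier} (h : φ.HasType u v) :
    ofWord ℓ S (wd ℓ u v) = RelH0.cls _ φ := by
  rw [wd_of_isWord h.1, ofWord, Finsupp.liftAddHom_apply_single]
  refine (one_zsmul _).trans ?_
  obtain ⟨γ⟩ := h.joined h.1.exists_emb.choose_spec
  rw [RelH0.cls, RelH0.cls, QuotientAddGroup.eq_iff_sub_mem]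
  exact AddSubgroup.subset_closure (Or.inr ⟨_, _, γ, rfl⟩)

lemma ofWord_toWord (x : RelH0 (Emb ℓ S) (embNotCover ℓ S)) : ofWord ℓ S (toWord ℓ S x) = x := by
  suffices (ofWord ℓ S).comp (toWord ℓ S) = AddMonoidHom.id _ from DFunLike.congr_fun this x
  refine RelH0.hom_ext fun φ => ?_
  rw [AddMonoidHom.comp_apply, toWord_cls, AddMonoidHom.id_apply]
  by_cases hφ : φ ∈ embNotCover ℓ S
  · rw [Emb.word_of_mem hφ, map_zero]
    refine Eq.symm ?_
    rw [RelH0.cls, QuotientAddGroup.eq_zero_iff]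
    exact AddSubgroup.subset_closure (Or.inl ⟨φ, hφ, rfl⟩)
  · obtain ⟨u, v, h⟩ := φ.exists_hasType hφ
    rw [h.word_eq, ofWord_wd h]

lemma toWord_ofWord (x : WordGroup ℓ S) : toWord ℓ S (ofWord ℓ S x) = x := by
  suffices (toWord ℓ S).comp (ofWord ℓ S) = AddMonoidHom.id _ from DFunLike.congr_fun this x
  refine wordGroup_hom_ext fun u v h => ?_
  obtain ⟨φ, hφ⟩ := h.exists_emb
  rw [AddMonoidHom.comp_apply, ofWord_wd hφ, toWord_cls, hφ.word_eq, AddMonoidHom.id_apply]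

/-- The group `Ξ(ℓ)_S` is isomorphic to the group of words. -/
noncomputable def xiEquiv (ℓ : ℕ) (S : FI) : (Xi ℓ).obj (op S) ≃+ WordGroup ℓ S :=
  { toWord ℓ S with
    invFun := ofWord ℓ S
    left_inv := ofWord_toWord
    right_inv := toWord_ofWord }

lemma xiEquiv_map (f : S ⟶ T) (x : (Xi ℓ).obj (op T)) :
    xiEquiv ℓ S ((Xi ℓ).map f.op x) = res ℓ f (xiEquiv ℓ T x) := by
  suffices (toWord ℓ S).comp (RelH0.map _ (Emb.continuous_precomp ℓ f)
      (Emb.mapsTo_precomp ℓ f)) = (res ℓ f).comp (toWord ℓ T) from DFunLike.congr_fun this x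
  refine RelH0.hom_ext fun φ => ?_
  rw [AddMonoidHom.comp_apply, AddMonoidHom.comp_apply,
    RelH0.map_cls _ (Emb.continuous_precomp ℓ f) (Emb.mapsTo_precomp ℓ f),
    toWord_cls, toWord_cls]
  by_cases hφ : φ ∈ embNotCover ℓ T
  · rw [Emb.word_of_mem hφ, Emb.word_of_mem (Emb.mapsTo_precomp ℓ f hφ), map_zero]
  · obtain ⟨u, v, h⟩ := φ.exists_hasType hφ
    rw [h.word_eq, res_wd _ h.1]
    by_cases hl : (pull f u).length = ℓ
    · rw [(h.precomp f hl).word_eq]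
    · rw [Emb.word_of_mem (h.precomp_mem f hl), wd_of_length_ne hl]

/-- A natural number, as an object of `FJ`. -/
abbrev _root_.FJ.of (n : ℕ) : FJ := n

/-- The map on words induced by a morphism of `FJ`. -/
noncomputable def wordMap {k ℓ : FJ} (ψ : k ⟶ ℓ) (S : FI) :
    WordGroup (k : ℕ) S →+ WordGroup (ℓ : ℕ) S :=
  ((xiEquiv ℓ S).toAddMonoidHom.comp (ψ.hom.app (op S)).hom).comp (xiEquiv k S).symm.toAddMonoidHom

lemma xiEquiv_app {k ℓ : FJ} (ψ : k ⟶ ℓ) (S : FI) (x : (Xi k).obj (op S)) :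
    xiEquiv ℓ S (ψ.hom.app (op S) x) = wordMap ψ S (xiEquiv k S x) := by
  simp [wordMap]

lemma res_wordMap {k ℓ : FJ} (ψ : k ⟶ ℓ) (f : S ⟶ T) (x : WordGroup (k : ℕ) T) :
    res _ f (wordMap ψ T x) = wordMap ψ S (res _ f x) := by
  obtain ⟨x, rfl⟩ := (xiEquiv k T).surjective x
  rw [← xiEquiv_app, ← xiEquiv_map, ← xiEquiv_map, ← xiEquiv_app, NatTrans.naturality_apply]

lemma wordMap_injective {k ℓ : FJ} {ψ ψ' : k ⟶ ℓ} (h : ∀ S, wordMap ψ S = wordMap ψ' S) :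
    ψ = ψ' := by
  refine InducedCategory.hom_ext (NatTrans.ext (funext fun S => AddCommGrpCat.hom_ext ?_))
  refine AddMonoidHom.ext fun x => (xiEquiv ℓ S.unop).injective ?_
  refine (xiEquiv_app ψ S.unop x).trans (Eq.trans ?_ (xiEquiv_app ψ' S.unop x).symm)
  rw [h]

lemma wordMap_comp {k ℓ m : FJ} (ψ : k ⟶ ℓ) (φ : ℓ ⟶ m) (S : FI) :
    wordMap (ψ ≫ φ) S = (wordMap φ S).comp (wordMap ψ S) := by
  ext x
  simp [wordMap]

@[simp] lemma wordMap_id (k : FJ) (S : FI) : wordMap (𝟙 k) S = AddMonoidHom.id _ := by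
  ext x
  simp [wordMap]

lemma wordMap_add {k ℓ : FJ} (ψ φ : k ⟶ ℓ) (S : FI) :
    wordMap (ψ + φ) S = wordMap ψ S + wordMap φ S := by
  refine AddMonoidHom.ext fun x => ?_
  exact map_add (xiEquiv ℓ S) _ _

lemma wordMap_sub {k ℓ : FJ} (ψ φ : k ⟶ ℓ) (S : FI) :
    wordMap (ψ - φ) S = wordMap ψ S - wordMap φ S := by
  rw [eq_sub_iff_add_eq, ← wordMap_add, sub_add_cancel]

/-- The morphism of `FJ` given by a natural map on words. -/
noncomputable def ofWordMap {k ℓ : ℕ} (φ : ∀ S : FI, WordGroup k S →+ WordGroup ℓ S)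
    (hφ : ∀ {S T : FI} (f : S ⟶ T) x, res ℓ f (φ T x) = φ S (res k f x)) :
    FJ.of k ⟶ FJ.of ℓ :=
  InducedCategory.homMk
    { app := fun S => AddCommGrpCat.ofHom
        (((xiEquiv ℓ S.unop).symm.toAddMonoidHom.comp (φ S.unop)).comp
          (xiEquiv k S.unop).toAddMonoidHom)
      naturality := fun S T f => by
        refine AddCommGrpCat.hom_ext (AddMonoidHom.ext fun x => ?_)
        refine (xiEquiv ℓ T.unop).injective ?_
        refine Eq.trans ?_ (xiEquiv_map f.unop _).symm
        refine ((xiEquiv ℓ T.unop).apply_symm_apply _).trans ?_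
        refine (congrArg _ (xiEquiv_map f.unop x)).trans ?_
        refine (hφ f.unop _).symm.trans (congrArg _ ?_)
        exact ((xiEquiv ℓ S.unop).apply_symm_apply _).symm }

@[simp] lemma wordMap_ofWordMap {k ℓ : ℕ} (φ : ∀ S : FI, WordGroup k S →+ WordGroup ℓ S)
    (hφ : ∀ {S T : FI} (f : S ⟶ T) x, res ℓ f (φ T x) = φ S (res k f x)) (S : FI) :
    wordMap (ofWordMap φ hφ) S = φ S := by
  refine AddMonoidHom.ext fun x => ?_
  refine ((xiEquiv ℓ S).apply_symm_apply _).trans (congrArg _ ?_)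
  exact (xiEquiv k S).apply_symm_apply _

end FI

/-! ### Commutator relations between words -/

namespace FI

variable {ℓ : ℕ} {S T : FI}

lemma IsWord.of_count {m : ℕ} {u v u' v' : List S.carrier} (h : IsWord ℓ u v)
    (hl : u'.length = m) (hc : ∀ x, u'.count x + v'.count x = u.count x + v.count x) :
    IsWord m u' v' := ⟨hl, fun x => by rw [hc, h.2]⟩

/-- Move the first distinguished letter to the front, minus to the back, of the second word. -/
noncomputable def rotate (ℓ : ℕ) : List S.carrier → List S.carrier → WordGroup ℓ S
  | [], _ => 0
  | s :: u, v => wd ℓ u (s :: v) - wd ℓ u (v ++ [s])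

/-- Move the first two distinguished letters to the front of the second word, in both orders. -/
noncomputable def swap (ℓ : ℕ) : List S.carrier → List S.carrier → WordGroup ℓ S
  | s :: a :: u, v => wd ℓ u (s :: a :: v) - wd ℓ u (a :: s :: v)
  | _, _ => 0

/-- After the deletion of s each of the two words may survive, whereas a map out of Ξ(ℓ+1) has to
give zero there. The two survivors are equal, so their difference is zero as required. -/
lemma res_rotate (f : S ⟶ T) {u v : List T.carrier} (h : IsWord (ℓ + 1) u v) :
    res ℓ f (rotate ℓ u v) =
      if (pull f u).length = ℓ + 1 then rotate ℓ (pull f u) (pull f v) else 0 := by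
  rcases u with - | ⟨s, u⟩
  · simp [rotate]
  · have hu : u.length = ℓ := by simpa using h.1
    have h1 : IsWord ℓ u (s :: v) := h.of_count hu fun x => by
      simp only [List.count_cons]
      ring
    have h2 : IsWord ℓ u (v ++ [s]) := h.of_count hu fun x => by
      simp only [List.count_cons, List.count_append, List.count_nil]
      ring
    rw [rotate, map_sub, res_wd f h1, res_wd f h2]
    rcases pull_cases f s with ⟨s, rfl⟩ | hs
    · simp only [pull_cons_apply, pull_append, pull_nil, List.length_cons, Nat.add_right_cancel_iff]
      split_ifs with hl
      · rfl
      · rw [wd_of_length_ne hl, wd_of_length_ne hl, sub_zero]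
    · have := length_pull_le f u
      simp only [pull_append, pull_cons_of_none hs, pull_nil, List.append_nil, sub_self]
      rw [if_neg (by omega)]

/-- Deleting s or a makes the two words equal, and the difference cancels. -/
lemma res_swap (f : S ⟶ T) {u v : List T.carrier} (h : IsWord (ℓ + 2) u v) :
    res ℓ f (swap ℓ u v) =
      if (pull f u).length = ℓ + 2 then swap ℓ (pull f u) (pull f v) else 0 := by
  rcases u with - | ⟨s, - | ⟨a, u⟩⟩
  · simp [swap]
  · have := h.1
    simp at this
  · have hu : u.length = ℓ := by simpa using h.1
    have h1 : IsWord ℓ u (s :: a :: v) := h.of_count hu fun x => by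
      simp only [List.count_cons]
      ring
    have h2 : IsWord ℓ u (a :: s :: v) := h.of_count hu fun x => by
      simp only [List.count_cons]
      ring
    have := length_pull_le f u
    rw [swap, map_sub, res_wd f h1, res_wd f h2]
    rcases pull_cases f s with ⟨s, rfl⟩ | hs <;> rcases pull_cases f a with ⟨a, rfl⟩ | ha
    · simp only [pull_cons_apply, List.length_cons, Nat.add_right_cancel_iff]
      split_ifs with hl
      · rfl
      · rw [wd_of_length_ne (by omega), wd_of_length_ne (by omega), sub_zero]
    · simp only [pull_cons_apply, pull_cons_of_none ha, sub_self, List.length_cons]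
      rw [if_neg (by omega)]
    · simp only [pull_cons_apply, pull_cons_of_none hs, sub_self, List.length_cons]
      rw [if_neg (by omega)]
    · simp only [pull_cons_of_none ha, pull_cons_of_none hs, sub_self]
      rw [if_neg (by omega)]

lemma res_desc_rotate (ℓ : ℕ) {S T : FI} (f : S ⟶ T) (x : WordGroup (ℓ + 1) T) :
    res ℓ f (desc (rotate ℓ) x) = desc (rotate ℓ) (res (ℓ + 1) f x) :=
  desc_res f _ (fun _ _ => res_rotate f) x

/-- The morphism of `FJ` given by `rotate`. -/
noncomputable def rotateHom (ℓ : ℕ) : FJ.of (ℓ + 1) ⟶ FJ.of ℓ :=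
  ofWordMap (fun _ => desc (rotate ℓ)) (res_desc_rotate ℓ)

lemma res_desc_swap (ℓ : ℕ) {S T : FI} (f : S ⟶ T) (x : WordGroup (ℓ + 2) T) :
    res ℓ f (desc (swap ℓ) x) = desc (swap ℓ) (res (ℓ + 2) f x) :=
  desc_res f _ (fun _ _ => res_swap f) x

/-- The morphism of `FJ` given by `swap`. -/
noncomputable def swapHom (ℓ : ℕ) : FJ.of (ℓ + 2) ⟶ FJ.of ℓ :=
  ofWordMap (fun _ => desc (swap ℓ)) (res_desc_swap ℓ)

lemma wordMap_rotateHom (S : FI) : wordMap (rotateHom ℓ) S = desc (rotate ℓ) :=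
  wordMap_ofWordMap _ (res_desc_rotate ℓ) S

lemma wordMap_swapHom (S : FI) : wordMap (swapHom ℓ) S = desc (swap ℓ) :=
  wordMap_ofWordMap _ (res_desc_swap ℓ) S

/-- The sum of the maps `rotate` and `swap`. -/
noncomputable def bracket (ℓ : ℕ) (S : FI) :
    WordGroup (ℓ + 1) S × WordGroup (ℓ + 2) S →+ WordGroup ℓ S :=
  (desc (rotate ℓ)).coprod (desc (swap ℓ))

/-- Restriction on the source of `bracket`. -/
noncomputable def resPair (ℓ : ℕ) (f : S ⟶ T) :
    WordGroup (ℓ + 1) T × WordGroup (ℓ + 2) T →+ WordGroup (ℓ + 1) S × WordGroup (ℓ + 2) S :=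
  (res (ℓ + 1) f).prodMap (res (ℓ + 2) f)

/-- A preimage under `bracket` of the difference of `P s a C` and `P a s C`. -/
noncomputable def swapPath (ℓ : ℕ) (u : List S.carrier) :
    List S.carrier → S.carrier → S.carrier → List S.carrier →
      WordGroup (ℓ + 1) S × WordGroup (ℓ + 2) S
  | [], s, a, C => (0, wd (ℓ + 2) (s :: a :: u) C)
  | p :: P, s, a, C => (wd (ℓ + 1) (p :: u) (P ++ s :: a :: C) -
      wd (ℓ + 1) (p :: u) (P ++ a :: s :: C), 0) + swapPath ℓ u P s a (C ++ [p])

/-- A preimage under `bracket` of the difference of `P s A B` and `P A s B`. -/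
noncomputable def movePath (ℓ : ℕ) (u : List S.carrier) :
    List S.carrier → S.carrier → List S.carrier → List S.carrier →
      WordGroup (ℓ + 1) S × WordGroup (ℓ + 2) S
  | _, _, [], _ => 0
  | P, s, a :: A, B => swapPath ℓ u P s a (A ++ B) + movePath ℓ u (P ++ [a]) s A B

/-- The part of a word before a letter. -/
noncomputable def before (s : S.carrier) (w : List S.carrier) : List S.carrier :=
  w.takeWhile (· ≠ s)

/-- The part of a word after a letter. -/
noncomputable def after (s : S.carrier) (w : List S.carrier) : List S.carrier :=
  (w.dropWhile (· ≠ s)).tail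

/-- A preimage under `bracket` of the difference of `P v` and `P w`, for a permutation `w`
of `v`. -/
noncomputable def sortPath (ℓ : ℕ) (u : List S.carrier) :
    List S.carrier → List S.carrier → List S.carrier →
      WordGroup (ℓ + 1) S × WordGroup (ℓ + 2) S
  | _, [], _ => 0
  | P, s :: v, w => sortPath ℓ u (P ++ [s]) v (before s w ++ after s w) +
      movePath ℓ u P s (before s w) (after s w)

lemma before_append_after {s : S.carrier} {w : List S.carrier} (h : s ∈ w) :
    before s w ++ s :: after s w = w := by
  induction w with
  | nil => cases h
  | cons a w ih =>
    by_cases ha : a = s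
    · subst ha
      simp [before, after]
    · have h' : s ∈ w := by
        rcases List.mem_cons.1 h with h | h
        · exact absurd h.symm ha
        · exact h
      simpa [before, after, List.takeWhile_cons, List.dropWhile_cons, ha] using ih h'

lemma before_of_cons {s : S.carrier} {A B : List S.carrier} (h : s ∉ A) :
    before s (A ++ s :: B) = A ∧ after s (A ++ s :: B) = B := by
  induction A with
  | nil => simp [before, after]
  | cons a A ih =>
    have ha : a ≠ s := fun h' => h (by simp [h'])
    have := ih fun h' => h (by simp [h'])
    simpa [before, after, List.takeWhile_cons, List.dropWhile_cons, ha] using this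

/-- Rotating the letters of P to the back one by one brings the adjacent pair to the front, where
`swap` exchanges it. Doing this for both orders of the pair turns the relation at the front into one
at any place. -/
lemma bracket_swapPath {u P : List S.carrier} {s a : S.carrier} {C : List S.carrier}
    (h : IsWord ℓ u (P ++ s :: a :: C)) :
    bracket ℓ S (swapPath ℓ u P s a C) = wd ℓ u (P ++ s :: a :: C) - wd ℓ u (P ++ a :: s :: C) := by
  induction P generalizing C with
  | nil =>
    have h1 : IsWord (ℓ + 2) (s :: a :: u) C := h.of_count (by simp [h.1]) fun x => by
      simp only [List.count_cons, List.nil_append]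
      ring
    simp [swapPath, bracket, desc_wd _ h1, swap]
  | cons p P ih =>
    have h1 : IsWord (ℓ + 1) (p :: u) (P ++ s :: a :: C) := h.of_count (by simp [h.1]) fun x => by
      simp only [List.count_cons, List.count_append]
      ring
    have h2 : IsWord (ℓ + 1) (p :: u) (P ++ a :: s :: C) := h.of_count (by simp [h.1]) fun x => by
      simp only [List.count_cons, List.count_append]
      ring
    have h3 : IsWord ℓ u (P ++ s :: a :: (C ++ [p])) := h.of_count h.1 fun x => by
      simp only [List.count_cons, List.count_append, List.count_nil]
      ring
    rw [swapPath, map_add, ih h3]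
    simp only [bracket, AddMonoidHom.coprod_apply, map_zero, add_zero, map_sub, desc_wd _ h1,
      desc_wd _ h2, rotate, List.cons_append, List.append_assoc]
    abel

/-- A telescoping sum of exchanges of neighbours, moving s past A. -/
lemma bracket_movePath {u P : List S.carrier} {s : S.carrier} {A B : List S.carrier}
    (h : IsWord ℓ u (P ++ s :: (A ++ B))) :
    bracket ℓ S (movePath ℓ u P s A B) =
      wd ℓ u (P ++ s :: (A ++ B)) - wd ℓ u (P ++ (A ++ s :: B)) := by
  induction A generalizing P with
  | nil => simp [movePath]
  | cons a A ih =>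
    have h1 : IsWord ℓ u (P ++ [a] ++ s :: (A ++ B)) := h.of_count h.1 fun x => by
      simp only [List.count_cons, List.count_append, List.count_nil]
      ring
    rw [List.cons_append] at h
    rw [movePath, map_add, ih h1, bracket_swapPath h]
    simp only [List.append_assoc, List.cons_append, List.nil_append]
    abel

/-- The first letter s of v is moved to the front of w and joins the prefix, and the recursion
treats the rest; the sum telescopes. -/
lemma bracket_sortPath {u P v w : List S.carrier} (h : IsWord ℓ u (P ++ v))
    (hw : ∀ x, w.count x = v.count x) :
    bracket ℓ S (sortPath ℓ u P v w) = wd ℓ u (P ++ v) - wd ℓ u (P ++ w) := by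
  induction v generalizing P w with
  | nil =>
    obtain rfl : w = [] := by
      rw [List.eq_nil_iff_forall_not_mem]
      intro x hx
      rw [← List.count_pos_iff, hw] at hx
      simp at hx
    simp [sortPath]
  | cons s v ih =>
    have hs : s ∈ w := by
      rw [← List.count_pos_iff, hw]
      simp
    have hw' := before_append_after hs
    have hc : ∀ x, (before s w ++ after s w).count x = v.count x := fun x => by
      have := hw x
      rw [← hw'] at this
      simp only [List.count_append, List.count_cons] at this ⊢
      omega
    have h1 : IsWord ℓ u (P ++ [s] ++ v) := by simpa using h
    have h2 : IsWord ℓ u (P ++ s :: (before s w ++ after s w)) := h.of_count h.1 fun x => by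
      rw [List.count_append, List.count_append, List.count_cons, List.count_cons, hc]
    rw [sortPath, map_add, ih h1 hc, bracket_movePath h2, hw']
    simp only [List.append_assoc, List.cons_append, List.nil_append]
    abel

lemma resPair_mk (f : S ⟶ T) (x y) : resPair ℓ f (x, y) = (res _ f x, res _ f y) := rfl

/-- If a prefix letter is deleted, its rotation terms have a first word that is too short and
vanish. If s or a is deleted, the two words in each rotation difference become equal and the final
swap term becomes too short. -/
lemma resPair_swapPath (f : S ⟶ T) {u P : List T.carrier} {s a : T.carrier} {C : List T.carrier}
    (h : IsWord ℓ u (P ++ s :: a :: C)) :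
    (∀ s' a', toEmb f s' = s → toEmb f a' = a → resPair ℓ f (swapPath ℓ u P s a C) =
      swapPath ℓ (pull f u) (pull f P) s' a' (pull f C)) ∧
    (pinv f s = none ∨ pinv f a = none → resPair ℓ f (swapPath ℓ u P s a C) = 0) := by
  induction P generalizing C with
  | nil =>
    have h1 : IsWord (ℓ + 2) (s :: a :: u) C := h.of_count (by simp [h.1]) fun x => by
      simp only [List.count_cons, List.nil_append]
      ring
    have hu := h.1
    have hlu := length_pull_le f u
    rw [swapPath, resPair_mk, map_zero, res_wd f h1]
    constructor
    · rintro s a rfl rfl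
      simp [swapPath]
    · rintro hsa
      rw [wd_of_length_ne, Prod.mk_zero_zero]
      rcases hsa with hs | ha
      · have := length_pull_le f (a :: u)
        rw [pull_cons_of_none hs]
        simp only [List.length_cons] at this
        omega
      · rcases pull_cases f s with ⟨s, rfl⟩ | hs
        · rw [pull_cons_apply, pull_cons_of_none ha, List.length_cons]
          omega
        · rw [pull_cons_of_none hs, pull_cons_of_none ha]
          omega
  | cons p P ih =>
    have h1 : IsWord (ℓ + 1) (p :: u) (P ++ s :: a :: C) := h.of_count (by simp [h.1]) fun x => by
      simp only [List.count_cons, List.count_append]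
      ring
    have h2 : IsWord (ℓ + 1) (p :: u) (P ++ a :: s :: C) := h.of_count (by simp [h.1]) fun x => by
      simp only [List.count_cons, List.count_append]
      ring
    have h3 : IsWord ℓ u (P ++ s :: a :: (C ++ [p])) := h.of_count h.1 fun x => by
      simp only [List.count_cons, List.count_append, List.count_nil]
      ring
    have hu := h.1
    have hlu := length_pull_le f u
    rw [swapPath, map_add, resPair_mk, map_zero, map_sub, res_wd f h1, res_wd f h2]
    constructor
    · rintro s a rfl rfl
      rw [(ih h3).1 s a rfl rfl]
      rcases pull_cases f p with ⟨p, rfl⟩ | hp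
      · simp [swapPath]
      · rw [pull_cons_of_none hp, pull_cons_of_none hp, wd_of_length_ne (by omega),
          wd_of_length_ne (by omega)]
        simp [pull_cons_of_none hp]
    · rintro hsa
      rw [(ih h3).2 hsa, add_zero]
      rcases hsa with hs | ha
      · rcases pull_cases f a with ⟨a, rfl⟩ | ha
        · simp [pull_cons_of_none hs]
        · simp [pull_cons_of_none hs, pull_cons_of_none ha]
      · rcases pull_cases f s with ⟨s, rfl⟩ | hs
        · simp [pull_cons_of_none ha]
        · simp [pull_cons_of_none hs, pull_cons_of_none ha]

lemma resPair_movePath (f : S ⟶ T) {u P : List T.carrier} {s : T.carrier} {A B : List T.carrier}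
    (h : IsWord ℓ u (P ++ s :: (A ++ B))) :
    (∀ s', toEmb f s' = s → resPair ℓ f (movePath ℓ u P s A B) =
      movePath ℓ (pull f u) (pull f P) s' (pull f A) (pull f B)) ∧
    (pinv f s = none → resPair ℓ f (movePath ℓ u P s A B) = 0) := by
  induction A generalizing P with
  | nil => simp [movePath]
  | cons a A ih =>
    have h1 : IsWord ℓ u (P ++ [a] ++ s :: (A ++ B)) := h.of_count h.1 fun x => by
      simp only [List.count_cons, List.count_append, List.count_nil]
      ring
    rw [List.cons_append] at h
    rw [movePath, map_add]
    constructor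
    · rintro s rfl
      rw [(ih h1).1 s rfl]
      rcases pull_cases f a with ⟨a, rfl⟩ | ha
      · rw [(resPair_swapPath f h).1 s a rfl rfl]
        simp [movePath]
      · rw [(resPair_swapPath f h).2 (Or.inr ha), zero_add]
        simp [pull_cons_of_none ha]
    · intro hs
      rw [(ih h1).2 hs, (resPair_swapPath f h).2 (Or.inl hs), add_zero]

/-- The sorting moves letters past one another by exchanges of neighbours, so the deletion of
letters only erases the exchanges in which they take part. -/
lemma resPair_sortPath (f : S ⟶ T) {u P v w : List T.carrier} (h : IsWord ℓ u (P ++ v))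
    (hw : ∀ x, w.count x = v.count x) :
    resPair ℓ f (sortPath ℓ u P v w) =
      sortPath ℓ (pull f u) (pull f P) (pull f v) (pull f w) := by
  induction v generalizing P w with
  | nil => simp [sortPath]
  | cons s v ih =>
    have hs : s ∈ w := by
      rw [← List.count_pos_iff, hw]
      simp
    have hw' := before_append_after hs
    have hc : ∀ x, (before s w ++ after s w).count x = v.count x := fun x => by
      have := hw x
      rw [← hw'] at this
      simp only [List.count_append, List.count_cons] at this ⊢
      omega
    have h1 : IsWord ℓ u (P ++ [s] ++ v) := by simpa using h
    have h2 : IsWord ℓ u (P ++ s :: (before s w ++ after s w)) := h.of_count h.1 fun x => by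
      rw [List.count_append, List.count_append, List.count_cons, List.count_cons, hc]
    rw [sortPath, map_add, ih h1 hc]
    rcases pull_cases f s with ⟨s, rfl⟩ | hs'
    · rw [(resPair_movePath f h2).1 s rfl]
      have hs2 : s ∉ pull f (before (toEmb f s) w) := by
        have h3 := hw (toEmb f s)
        have h4 := h.2 (toEmb f s)
        rw [mem_pull, ← List.count_pos_iff]
        rw [← hw'] at h3
        simp only [List.count_append, List.count_cons, beq_self_eq_true, if_true] at h3 h4
        omega
      obtain ⟨h5, h6⟩ := before_of_cons (B := pull f (after (toEmb f s) w)) hs2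
      rw [← pull_cons_apply, ← pull_append, hw'] at h5 h6
      simp [sortPath, h5, h6]
    · rw [(resPair_movePath f h2).2 hs', add_zero, pull_cons_of_none hs']
      conv_rhs => rw [← hw']
      simp [pull_cons_of_none hs']

/-- A preimage under `bracket` of the difference of `(u, v)` and `(u, w)`, where `w` lists the
letters of `v` in the order given by `q`. -/
noncomputable def sorter (ℓ : ℕ) (q : List S.carrier) :
    WordGroup ℓ S →+ WordGroup (ℓ + 1) S × WordGroup (ℓ + 2) S :=
  desc fun u v => sortPath ℓ u [] v (q.filter (· ∉ u))

lemma IsWord.count_filter {u v q : List S.carrier} (h : IsWord ℓ u v) (hq : ∀ x, q.count x = 1)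
    (x : S.carrier) : (q.filter (· ∉ u)).count x = v.count x := by
  have h1 := h.2 x
  by_cases hx : x ∈ u
  · have h2 := List.count_pos_iff.2 hx
    rw [List.count_eq_zero_of_not_mem (by simp [hx])]
    omega
  · rw [List.count_filter (by simp [hx]), hq]
    rw [List.count_eq_zero_of_not_mem hx] at h1
    omega

lemma swapPath_of_length_ne {u : List S.carrier} (hu : u.length ≠ ℓ) (P : List S.carrier)
    (s a : S.carrier) (C : List S.carrier) : swapPath ℓ u P s a C = 0 := by
  induction P generalizing C with
  | nil => simp [swapPath, wd_of_length_ne, hu]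
  | cons p P ih => simp [swapPath, wd_of_length_ne, hu, ih]

lemma movePath_of_length_ne {u : List S.carrier} (hu : u.length ≠ ℓ) (P : List S.carrier)
    (s : S.carrier) (A B : List S.carrier) : movePath ℓ u P s A B = 0 := by
  induction A generalizing P with
  | nil => simp [movePath]
  | cons p P ih => simp [movePath, swapPath_of_length_ne, hu, ih]

lemma sortPath_of_length_ne {u : List S.carrier} (hu : u.length ≠ ℓ) (P v w : List S.carrier) :
    sortPath ℓ u P v w = 0 := by
  induction v generalizing P w with
  | nil => simp [sortPath]
  | cons p P ih => simp [sortPath, movePath_of_length_ne, hu, ih]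

/-- The reference order q has to be restricted together with the word. A fixed q on `T` controls all
restrictions of one element; a q that varies naturally with a word yields a natural transformation.
-/
lemma resPair_sorter (f : S ⟶ T) {q : List T.carrier} (hq : ∀ x, q.count x = 1)
    (z : WordGroup ℓ T) : resPair ℓ f (sorter ℓ q z) = sorter ℓ (pull f q) (res ℓ f z) := by
  suffices (resPair ℓ f).comp (sorter ℓ q) = (sorter ℓ (pull f q)).comp (res ℓ f) from
    DFunLike.congr_fun this z
  refine wordGroup_hom_ext fun u v h => ?_
  rw [AddMonoidHom.comp_apply, AddMonoidHom.comp_apply, res_wd f h, sorter, desc_wd _ h,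
    resPair_sortPath f (by simpa using h) (h.count_filter hq)]
  by_cases hl : (pull f u).length = ℓ
  · rw [sorter, desc_wd _ (h.pull f hl)]
    congr 1
    have hu := map_pull_of_length_eq f (hl.trans h.1.symm)
    unfold pull
    rw [List.filterMap_filter, List.filter_filterMap]
    refine List.filterMap_congr fun t _ => ?_
    rcases pull_cases f t with ⟨s, rfl⟩ | ht
    · simp [Option.filter, show (s ∈ List.filterMap (pinv f) u) = (toEmb f s ∈ u) from
        propext mem_pull]
    · simp [ht]
  · rw [wd_of_length_ne hl, map_zero, sortPath_of_length_ne hl]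

/-- All second words are replaced by the one in the order given by `q`. -/
noncomputable def normalize (ℓ : ℕ) (q : List S.carrier) : WordGroup ℓ S →+ WordGroup ℓ S :=
  desc fun u _ => wd ℓ u (q.filter (· ∉ u))

lemma bracket_sorter {q : List S.carrier} (hq : ∀ x, q.count x = 1) (z : WordGroup ℓ S) :
    bracket ℓ S (sorter ℓ q z) = z - normalize ℓ q z := by
  suffices (bracket ℓ S).comp (sorter ℓ q) = AddMonoidHom.id _ - normalize ℓ q from
    DFunLike.congr_fun this z
  refine wordGroup_hom_ext fun u v h => ?_
  rw [AddMonoidHom.comp_apply, sorter, desc_wd _ h,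
    bracket_sortPath (by simpa using h) (h.count_filter hq)]
  simp [normalize, desc_wd _ h]

/-- The finite set of elements of a word, as a subset. -/
def sub {S : FI} (B : Finset S.carrier) : FI := ⟨{s // s ∈ B}⟩

/-- The inclusion of a subset. -/
def subι {S : FI} (B : Finset S.carrier) : sub B ⟶ S := Function.Embedding.subtype _

@[simp] lemma toEmb_subι {S : FI} (B : Finset S.carrier) (s : (sub B).carrier) :
    toEmb (subι B) s = s.1 := rfl

@[simp] lemma card_sub {S : FI} (B : Finset S.carrier) : (sub B).card = B.card := by
  change Nat.card {s // s ∈ B} = _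
  simp

lemma exists_of_mem_sub {S : FI} {B : Finset S.carrier} {s : S.carrier} (h : s ∈ B) :
    ∃ b, toEmb (subι B) b = s := ⟨⟨s, h⟩, rfl⟩

/-- `normalize` forgets the second word. For u with underlying set B, that information is exactly
what restriction to B keeps, since the second word becomes empty there. So `normalize` is a sum of
maps that factor through the restrictions to the ℓ-element subsets. -/
lemma normalize_eq_zero (q : List S.carrier) (z : WordGroup ℓ S)
    (hz : ∀ B : Finset S.carrier, B.card = ℓ → res ℓ (subι B) z = 0) : normalize ℓ q z = 0 := by
  classical
  have hB : ∀ u : List S.carrier, u.Nodup → u.length = ℓ →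
      ∃ F : WordGroup ℓ (sub u.toFinset) →+ WordGroup ℓ S, ∀ u' v, IsWord ℓ u' v →
        F (res ℓ (subι u.toFinset) (wd ℓ u' v)) =
          if u'.toFinset = u.toFinset then wd ℓ u' (q.filter (· ∉ u')) else 0 := by
    intro u hu hl
    refine ⟨desc fun u' _ => wd ℓ (u'.map (toEmb (subι u.toFinset)))
      (q.filter (· ∉ u'.map (toEmb (subι u.toFinset)))), fun u' v h => ?_⟩
    have hu' : u'.Nodup := List.nodup_iff_count_le_one.2 fun x => by have := h.2 x; omega
    have hiff : (pull (subι u.toFinset) u').length = ℓ ↔ u'.toFinset = u.toFinset := by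
      constructor
      · intro h1
        have h2 := map_pull_of_length_eq _ (h1.trans h.1.symm)
        refine Finset.eq_of_subset_of_card_le (fun x hx => ?_) ?_
        · rw [List.mem_toFinset, ← h2, List.mem_map] at hx
          obtain ⟨b, _, rfl⟩ := hx
          exact b.2
        · rw [List.toFinset_card_of_nodup hu, List.toFinset_card_of_nodup hu', hl, h.1]
      · intro h1
        rw [length_pull_eq, h.1]
        intro t ht
        exact exists_of_mem_sub (by rw [← h1]; simpa using ht)
    rw [res_wd _ h]
    split_ifs with h1
    · have h2 := hiff.2 h1
      rw [desc_wd _ (h.pull _ h2), map_pull_of_length_eq _ (h2.trans h.1.symm)]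
    · rw [wd_of_length_ne fun h2 => h1 (hiff.1 h2), map_zero]
  choose! F hF using hB
  let I : Finset (Finset S.carrier) := Finset.univ.filter fun B => B.card = ℓ
  have hI : ∀ B ∈ I, ∃ u : List S.carrier, u.Nodup ∧ u.length = ℓ ∧ u.toFinset = B := by
    intro B hB
    refine ⟨B.toList, B.nodup_toList, ?_, by simp⟩
    rw [Finset.length_toList]
    exact (Finset.mem_filter.1 hB).2
  choose! w hw1 hw2 hw3 using hI
  have key : normalize ℓ q = ∑ B ∈ I, (F (w B)).comp (res ℓ (subι (w B).toFinset)) := by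
    refine wordGroup_hom_ext fun u v h => ?_
    have hu : u.Nodup := List.nodup_iff_count_le_one.2 fun x => by have := h.2 x; omega
    rw [normalize, desc_wd _ h, AddMonoidHom.finsetSum_apply]
    rw [Finset.sum_eq_single u.toFinset]
    · have h1 : u.toFinset ∈ I := by
        simp [I, List.toFinset_card_of_nodup hu, h.1]
      rw [AddMonoidHom.comp_apply, hF _ (hw1 _ h1) (hw2 _ h1) _ _ h, hw3 _ h1, if_pos rfl]
    · intro B hB hne
      rw [AddMonoidHom.comp_apply, hF _ (hw1 _ hB) (hw2 _ hB) _ _ h, hw3 _ hB, if_neg hne.symm]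
    · intro h1
      exact absurd (by simp [I, List.toFinset_card_of_nodup hu, h.1]) h1
  rw [key, AddMonoidHom.finsetSum_apply]
  refine Finset.sum_eq_zero fun B hB => ?_
  rw [AddMonoidHom.comp_apply, hz, map_zero]
  rw [hw3 _ hB]
  exact (Finset.mem_filter.1 hB).2

end FI

/-! ### Elements and morphisms that vanish in degree ℓ -/

namespace FI

variable {ℓ : ℕ} {S T : FI}

lemma IsWord.count_append {u v : List S.carrier} (h : IsWord ℓ u v) (x : S.carrier) :
    (u ++ v).count x = 1 := by
  rw [List.count_append, h.2]

lemma exists_enumeration (S : FI) : ∃ q : List S.carrier, ∀ x, q.count x = 1 :=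
  ⟨Finset.univ.toList, fun x => List.count_eq_one_of_mem (Finset.nodup_toList _) (by simp)⟩

/-- An element of a module of words that vanishes in degree `ℓ` is in the image of `rotate`
and `swap`. -/
lemma exists_rotate_add_swap (z : WordGroup ℓ T)
    (hz : ∀ B : Finset T.carrier, B.card = ℓ → res ℓ (subι B) z = 0) :
    ∃ (z₁ : WordGroup (ℓ + 1) T) (z₂ : WordGroup (ℓ + 2) T),
      z = wordMap (rotateHom ℓ) T z₁ + wordMap (swapHom ℓ) T z₂ ∧
      ∀ {S : FI} (f : S ⟶ T), res ℓ f z = 0 → res (ℓ + 1) f z₁ = 0 ∧ res (ℓ + 2) f z₂ = 0 := by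
  obtain ⟨q, hq⟩ := exists_enumeration T
  refine ⟨(sorter ℓ q z).1, (sorter ℓ q z).2, ?_, fun f hf => ?_⟩
  · have := bracket_sorter hq z
    rw [normalize_eq_zero q z hz, sub_zero] at this
    rw [wordMap_rotateHom, wordMap_swapHom]
    exact this.symm
  -- The restriction of the preimage is the sorter of the restriction of z, hence zero together with
  -- it.
  · have := resPair_sorter f hq z
    rw [hf, map_zero] at this
    exact ⟨congrArg Prod.fst this, congrArg Prod.snd this⟩

/-- A morphism of modules of words that vanishes in degree `ℓ` factors through `rotate`
and `swap`. -/
lemma exists_comp_rotate_add_comp_swap {k ℓ : ℕ} (ψ : FJ.of k ⟶ FJ.of ℓ)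
    (hψ : ∀ S : FI, S.card = ℓ → wordMap ψ S = 0) :
    ∃ (a₁ : FJ.of k ⟶ FJ.of (ℓ + 1))
      (a₂ : FJ.of k ⟶ FJ.of (ℓ + 2)),
      ψ = a₁ ≫ rotateHom ℓ + a₂ ≫ swapHom ℓ ∧
      ∀ S : FI, wordMap ψ S = 0 → wordMap a₁ S = 0 ∧ wordMap a₂ S = 0 := by
  -- The word u ++ v itself serves as the reference order: this choice commutes with deletion, which
  -- makes the factors natural.
  let B : ∀ S : FI, List S.carrier → List S.carrier →
      WordGroup (ℓ + 1) S × WordGroup (ℓ + 2) S :=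
    fun S u v => sorter ℓ (u ++ v) (wordMap ψ S (wd k u v))
  have hB : ∀ {S T : FI} (f : S ⟶ T) (u v : List T.carrier), IsWord k u v →
      resPair ℓ f (B T u v) =
        if (pull f u).length = k then B S (pull f u) (pull f v) else 0 := fun f u v h => by
    simp only [B]
    rw [resPair_sorter f h.count_append, res_wordMap, res_wd f h]
    split_ifs with hl
    · rw [pull_append]
    · rw [wd_of_length_ne hl, map_zero, map_zero]
  have key : ∀ {S T : FI} (f : S ⟶ T) (x : WordGroup k T),
      resPair ℓ f (desc (B T) x) = desc (B S) (res k f x) := fun f => desc_res f _ (hB f)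
  have hB0 : ∀ S : FI, wordMap ψ S = 0 → ∀ x, desc (B S) x = 0 := fun S hS x => by
    have : desc (B S) = (0 : WordGroup k S →+ _) := wordGroup_hom_ext fun u v h => by
      simp [desc_wd _ h, B, hS]
    rw [this, AddMonoidHom.zero_apply]
  let B₁ : ∀ S : FI, WordGroup k S →+ WordGroup (ℓ + 1) S := fun S =>
    (AddMonoidHom.fst _ _).comp (desc (B S))
  let B₂ : ∀ S : FI, WordGroup k S →+ WordGroup (ℓ + 2) S := fun S =>
    (AddMonoidHom.snd _ _).comp (desc (B S))
  have hB₁ : ∀ {S T : FI} (f : S ⟶ T) (x : WordGroup k T), res _ f (B₁ T x) = B₁ S (res k f x) :=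
    fun f x => congrArg Prod.fst (key f x)
  have hB₂ : ∀ {S T : FI} (f : S ⟶ T) (x : WordGroup k T), res _ f (B₂ T x) = B₂ S (res k f x) :=
    fun f x => congrArg Prod.snd (key f x)
  refine ⟨ofWordMap B₁ hB₁, ofWordMap B₂ hB₂, ?_, fun S hS => ⟨?_, ?_⟩⟩
  · refine wordMap_injective fun S => wordGroup_hom_ext fun u v h => ?_
    have hb := bracket_sorter h.count_append (wordMap ψ S (wd k u v))
    rw [normalize_eq_zero, sub_zero] at hb
    · refine hb.symm.trans ?_
      rw [wordMap_add, wordMap_comp, wordMap_comp, wordMap_rotateHom, wordMap_swapHom,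
        wordMap_ofWordMap, wordMap_ofWordMap]
      simp only [AddMonoidHom.add_apply, AddMonoidHom.comp_apply, B₁, B₂, desc_wd _ h]
      rfl
    · intro C hC
      rw [res_wordMap, hψ _ (by rw [card_sub, hC])]
      rfl
  · rw [wordMap_ofWordMap]
    exact AddMonoidHom.ext fun x => congrArg Prod.fst (hB0 S hS x)
  · rw [wordMap_ofWordMap]
    exact AddMonoidHom.ext fun x => congrArg Prod.snd (hB0 S hS x)

end FI

/-! ### Appending letters, and extension of truncated maps -/

namespace FI

variable {ℓ : ℕ} {S T U V : FI}

/-- The list `q` enumerates the complement of the image of `i`. -/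
def IsCompl (i : S ⟶ T) (q : List T.carrier) : Prop :=
  (∀ s, q.count (toEmb i s) = 0) ∧ ∀ t, (∀ s, toEmb i s ≠ t) → q.count t = 1

lemma IsWord.map_append {u v : List S.carrier} (h : IsWord ℓ u v) {i : S ⟶ T}
    {q : List T.carrier} (hq : IsCompl i q) :
    IsWord ℓ (u.map (toEmb i)) (v.map (toEmb i) ++ q) := by
  refine ⟨by simp [h.1], fun t => ?_⟩
  rcases pull_cases i t with ⟨s, rfl⟩ | ht
  · rw [List.count_append, List.count_map_of_injective _ _ (toEmb i).injective,
      List.count_map_of_injective _ _ (toEmb i).injective, hq.1, add_zero, h.2]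
  · rw [pinv_eq_none] at ht
    rw [List.count_append, hq.2 t ht, List.count_eq_zero_of_not_mem, List.count_eq_zero_of_not_mem]
    · simpa using fun s _ => ht s
    · simpa using fun s _ => ht s

/-- Append the letters `q` to the second word. -/
noncomputable def append (ℓ : ℕ) (i : S ⟶ T) (q : List T.carrier) :
    WordGroup ℓ S →+ WordGroup ℓ T :=
  desc fun u v => wd ℓ (u.map (toEmb i)) (v.map (toEmb i) ++ q)

lemma pull_map_of_isPullback {f : S ⟶ T} {i : U ⟶ T} {g : V ⟶ U} {j : V ⟶ S}
    (comm : g ≫ i = j ≫ f) (pb : ∀ b s, toEmb i b = toEmb f s → ∃ x, toEmb g x = b)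
    (l : List U.carrier) : pull f (l.map (toEmb i)) = (pull g l).map (toEmb j) := by
  induction l with
  | nil => rfl
  | cons b l ih =>
    rw [List.map_cons]
    rcases pull_cases g b with ⟨x, rfl⟩ | hb
    · rw [← toEmb_comp, comm, toEmb_comp, pull_cons_apply, pull_cons_apply, ih, List.map_cons]
    · rw [pull_cons_of_none hb, pull_cons_of_none, ih]
      rw [pinv_eq_none] at hb ⊢
      intro s hs
      obtain ⟨x, hx⟩ := pb b s hs.symm
      exact hb x hx

lemma res_append {f : S ⟶ T} {i : U ⟶ T} {g : V ⟶ U} {j : V ⟶ S}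
    (comm : g ≫ i = j ≫ f) (pb : ∀ b s, toEmb i b = toEmb f s → ∃ x, toEmb g x = b)
    {q : List T.carrier} (hq : IsCompl i q) (x : WordGroup ℓ U) :
    res ℓ f (append ℓ i q x) = append ℓ j (pull f q) (res ℓ g x) := by
  refine desc_res g (res ℓ f) (fun u v h => ?_) x
  rw [res_wd _ (h.map_append hq), pull_append, pull_map_of_isPullback comm pb,
    pull_map_of_isPullback comm pb]
  split_ifs with hl
  · rfl
  · rw [wd_of_length_ne]
    simpa using hl

/-- The appended letters are the ones that i misses, so restriction deletes exactly these. Thus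
`append` is a section of restriction. -/
lemma res_append_self {i : S ⟶ T} {q : List T.carrier} (hq : IsCompl i q) (x : WordGroup ℓ S) :
    res ℓ i (append ℓ i q x) = x := by
  rw [res_append (g := 𝟙 S) (j := 𝟙 S) rfl (fun b _ _ => ⟨b, rfl⟩) hq, res_id]
  have : pull i q = [] := by
    rw [List.eq_nil_iff_forall_not_mem]
    intro s hs
    rw [← List.count_pos_iff, count_pull, hq.1] at hs
    exact lt_irrefl _ hs
  rw [this]
  suffices append ℓ (𝟙 S) [] = AddMonoidHom.id (WordGroup ℓ S) from DFunLike.congr_fun this x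
  refine wordGroup_hom_ext fun u v h => ?_
  rw [append, desc_wd _ h, List.append_nil, AddMonoidHom.id_apply]
  congr 1 <;> exact List.map_id _

/-- The restriction of an injection to the preimage of a subset. -/
def subMap (f : S ⟶ T) (B : Finset T.carrier) :
    sub (Finset.univ.filter fun s => toEmb f s ∈ B) ⟶ sub B where
  toFun s := ⟨toEmb f s.1, (Finset.mem_filter.1 s.2).2⟩
  inj' _ _ h := Subtype.ext ((toEmb f).injective (congrArg Subtype.val h))

lemma subMap_comp (f : S ⟶ T) (B : Finset T.carrier) :
    subMap f B ≫ subι B = subι _ ≫ f := rfl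

lemma res_wd_sub_eq_zero {k : ℕ} {u v : List S.carrier} (h : IsWord k u v) {B : Finset S.carrier}
    {s : S.carrier} (hs : s ∈ u) (hB : s ∉ B) : res k (subι B) (wd k u v) = 0 := by
  rw [res_wd _ h, wd_of_length_ne]
  intro hl
  have := map_pull_of_length_eq _ (hl.trans h.1.symm)
  rw [← this, List.mem_map] at hs
  obtain ⟨b, _, rfl⟩ := hs
  exact hB b.2

lemma isCompl_filter {k : ℕ} {u v : List S.carrier} (h : IsWord k u v) {B : Finset S.carrier}
    (hB : ∀ s ∈ u, s ∈ B) : IsCompl (subι B) (v.filter (· ∉ B)) := by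
  refine ⟨fun s => ?_, fun s hs => ?_⟩
  · rw [List.count_eq_zero_of_not_mem]
    intro h'
    simp only [decide_not, List.mem_filter, Bool.not_eq_eq_eq_not, Bool.not_true,
      decide_eq_false_iff_not] at h'
    exact h'.2 s.2
  · have hs' : s ∉ B := fun h' => hs ⟨s, h'⟩ rfl
    rw [List.count_filter (by simp [hs'])]
    have := h.2 s
    rwa [List.count_eq_zero_of_not_mem fun hu => hs' (hB s hu), zero_add] at this

/-- Apply `φ` to the letters in `B`, and append the remaining letters. -/
noncomputable def extendTerm {k : ℕ} (φ : ∀ S : FI, WordGroup k S →+ WordGroup ℓ S)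
    (u v : List S.carrier) (B : Finset S.carrier) : WordGroup ℓ S :=
  append ℓ (subι B) (v.filter (· ∉ B)) (φ (sub B) (res k (subι B) (wd k u v)))

/-- The map `φ` is natural in degrees at most `d`. -/
def NaturalLE {k : ℕ} (d : ℕ) (φ : ∀ S : FI, WordGroup k S →+ WordGroup ℓ S) : Prop :=
  ∀ {S T : FI} (f : S ⟶ T) (x : WordGroup k T), T.card ≤ d → res ℓ f (φ T x) = φ S (res k f x)

/-- The bound on B is what permits the use of the truncated naturality of φ, namely along the
restriction of f to the preimage of B. -/
lemma res_extendTerm {k d : ℕ} {φ : ∀ S : FI, WordGroup k S →+ WordGroup ℓ S}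
    (hφ : NaturalLE d φ) (f : S ⟶ T) {u v : List T.carrier} (h : IsWord k u v)
    {B : Finset T.carrier} (hB : B.card ≤ d) :
    res ℓ f (extendTerm φ u v B) =
      extendTerm φ (pull f u) (pull f v) (Finset.univ.filter fun s => toEmb f s ∈ B) := by
  have h1 : res k (subι (Finset.univ.filter fun s => toEmb f s ∈ B))
      (wd k (pull f u) (pull f v)) = res k (subMap f B) (res k (subι B) (wd k u v)) := by
    rw [← res_wd f h, ← AddMonoidHom.comp_apply, ← AddMonoidHom.comp_apply, ← res_comp, ← res_comp,
      subMap_comp]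
  rw [extendTerm, extendTerm, h1, ← hφ (subMap f B) _ (by rwa [card_sub])]
  by_cases hu : ∀ s ∈ u, s ∈ B
  · rw [res_append (subMap_comp f B) _ (isCompl_filter h hu)]
    · congr 2
      unfold pull
      rw [List.filterMap_filter, List.filter_filterMap]
      refine List.filterMap_congr fun t _ => ?_
      rcases pull_cases f t with ⟨s, rfl⟩ | ht
      · simp [Option.filter]
      · simp [ht]
    · intro b s hbs
      exact ⟨⟨s, by simpa [← hbs] using b.2⟩, Subtype.ext hbs.symm⟩
  -- If B misses a distinguished letter, the word already restricts to zero on B, and both sides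
  -- vanish.
  · push Not at hu
    obtain ⟨s, hs, hsB⟩ := hu
    rw [res_wd_sub_eq_zero h hs hsB]
    simp

/-! ### Möbius inversion over the subsets of a finite set -/

/-- The alternating sum over the subsets of `C` of the values of `t`. -/
def altSum {α A : Type*} [AddCommGroup A] (t : Finset α → A) (C : Finset α) : A :=
  ∑ B ∈ C.powerset, (-1 : ℤ) ^ (C.card - B.card) • t B

lemma altSum_insert {α A : Type*} [DecidableEq α] [AddCommGroup A] (t : Finset α → A)
    {C : Finset α} {a : α} (ha : a ∉ C) :
    altSum t (insert a C) = altSum (fun B => t (insert a B)) C - altSum t C := by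
  rw [altSum, Finset.sum_powerset_insert ha, altSum, altSum, add_comm, ← Finset.sum_sub_distrib,
    ← Finset.sum_add_distrib]
  refine Finset.sum_congr rfl fun B hB => ?_
  have hB := Finset.mem_powerset.1 hB
  have h1 := Finset.card_le_card hB
  rw [Finset.card_insert_of_notMem ha, Finset.card_insert_of_notMem fun h => ha (hB h),
    Nat.succ_sub_succ, Nat.succ_sub h1, pow_succ, mul_neg_one, neg_smul]
  abel

/-- Möbius inversion in the Boolean lattice, by induction on `C` through `altSum_insert`. -/
lemma sum_altSum {α A : Type*} [DecidableEq α] [AddCommGroup A] (t : Finset α → A)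
    (C : Finset α) : ∑ B ∈ C.powerset, altSum t B = t C := by
  induction C using Finset.induction_on generalizing t with
  | empty => simp [altSum]
  | insert a C ha ih =>
    rw [Finset.sum_powerset_insert ha, ← Finset.sum_add_distrib, ← ih fun B => t (insert a B)]
    refine Finset.sum_congr rfl fun B hB => ?_
    rw [altSum_insert t fun h => ha (Finset.mem_powerset.1 hB h)]
    abel

lemma map_altSum {α A A' : Type*} [AddCommGroup A] [AddCommGroup A'] (r : A →+ A')
    (t : Finset α → A) (C : Finset α) : r (altSum t C) = altSum (fun B => r (t B)) C := by
  simp only [altSum, map_sum, map_zsmul]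

lemma filter_mem_map (f : S ⟶ T) (B : Finset S.carrier) :
    (Finset.univ.filter fun s => toEmb f s ∈ B.map (toEmb f)) = B := by
  ext s
  simp

lemma altSum_preimage_map {A : Type*} [AddCommGroup A] (f : S ⟶ T) (t : Finset S.carrier → A)
    (C : Finset S.carrier) :
    altSum (fun B => t (Finset.univ.filter fun s => toEmb f s ∈ B)) (C.map (toEmb f)) =
      altSum t C := by
  refine Finset.sum_nbij' (fun B => Finset.univ.filter fun s => toEmb f s ∈ B)
    (fun B => B.map (toEmb f)) ?_ ?_ ?_ ?_ ?_
  · intro B hB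
    rw [Finset.mem_powerset] at hB ⊢
    intro s hs
    have := hB (Finset.mem_filter.1 hs).2
    simpa using this
  · intro B hB
    rw [Finset.mem_powerset] at hB ⊢
    exact Finset.map_subset_map.2 hB
  · intro B hB
    rw [Finset.mem_powerset] at hB
    ext t
    simp only [Finset.mem_map, Finset.mem_filter, Finset.mem_univ, true_and]
    constructor
    · rintro ⟨s, hs, rfl⟩
      exact hs
    · intro ht
      obtain ⟨s, _, rfl⟩ := Finset.mem_map.1 (hB ht)
      exact ⟨s, ht, rfl⟩
  · intro B hB
    exact filter_mem_map f B
  · intro B hB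
    rw [Finset.mem_powerset] at hB
    congr 2
    rw [Finset.card_map]
    congr 1
    refine Eq.symm (Finset.card_nbij (toEmb f) ?_ (toEmb f).injective.injOn ?_)
    · intro s hs
      exact (Finset.mem_filter.1 hs).2
    · intro t ht
      obtain ⟨s, _, rfl⟩ := Finset.mem_map.1 (hB ht)
      exact ⟨s, by simpa using ht, rfl⟩

/-- Subsets that differ only by z have the same preimage and occur with opposite signs. -/
lemma altSum_preimage_eq_zero {A : Type*} [AddCommGroup A] (f : S ⟶ T)
    (t : Finset S.carrier → A) {C : Finset T.carrier} {z : T.carrier} (hz : z ∈ C)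
    (hz' : ∀ s, toEmb f s ≠ z) :
    altSum (fun B => t (Finset.univ.filter fun s => toEmb f s ∈ B)) C = 0 := by
  rw [← Finset.insert_erase hz, altSum_insert _ (Finset.notMem_erase z C), sub_eq_zero]
  congr 1
  funext B
  congr 1
  ext s
  simp [hz']

/-- The extension to all degrees of a map that is natural in degrees at most `d`. -/
noncomputable def extend {k : ℕ} (d : ℕ) (φ : ∀ S : FI, WordGroup k S →+ WordGroup ℓ S) (S : FI) :
    WordGroup k S →+ WordGroup ℓ S :=
  -- The sum over all C would give back the term of the full subset, by Möbius inversion. Discarding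
  -- the C with more than d elements leaves only values of φ on sets where it is natural.
  desc fun u v => ∑ C ∈ (Finset.univ : Finset (Finset S.carrier)) with C.card ≤ d,
    altSum (extendTerm φ u v) C

lemma extendTerm_of_length_ne {k : ℕ} (φ : ∀ S : FI, WordGroup k S →+ WordGroup ℓ S)
    {u : List S.carrier} (hu : u.length ≠ k) (v : List S.carrier) (B : Finset S.carrier) :
    extendTerm φ u v B = 0 := by
  rw [extendTerm, wd_of_length_ne hu, map_zero, map_zero, map_zero]

/-- Summands for subsets C of `T` outside the image of f cancel. The others correspond to the
subsets of `S`, with the same number of elements, so the cut-off at d is respected. -/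
lemma res_extend {k d : ℕ} {φ : ∀ S : FI, WordGroup k S →+ WordGroup ℓ S}
    (hφ : NaturalLE d φ) {S T : FI} (f : S ⟶ T) (x : WordGroup k T) :
    res ℓ f (extend d φ T x) = extend d φ S (res k f x) := by
  refine desc_res f _ (fun u v h => ?_) x
  have key : res ℓ f (∑ C ∈ (Finset.univ : Finset (Finset T.carrier)) with C.card ≤ d,
      altSum (extendTerm φ u v) C) = ∑ C ∈ (Finset.univ : Finset (Finset S.carrier)) with
        C.card ≤ d, altSum (extendTerm φ (pull f u) (pull f v)) C := by
    rw [map_sum]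
    have h1 : ∀ C ∈ (Finset.univ : Finset (Finset T.carrier)).filter (fun C => C.card ≤ d),
        res ℓ f (altSum (extendTerm φ u v) C) = altSum (fun B =>
          extendTerm φ (pull f u) (pull f v) (Finset.univ.filter fun s => toEmb f s ∈ B)) C := by
      intro C hC
      rw [map_altSum]
      refine Finset.sum_congr rfl fun B hB => ?_
      exact congrArg (_ • ·) (res_extendTerm hφ f h
        ((Finset.card_le_card (Finset.mem_powerset.1 hB)).trans (Finset.mem_filter.1 hC).2))
    rw [Finset.sum_congr rfl h1]
    symm
    refine Finset.sum_of_injOn (fun C => C.map (toEmb f)) (Finset.map_injective _).injOn ?_ ?_ ?_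
    · intro C hC
      simpa using hC
    · intro C _ hC'
      by_contra hne
      apply hC'
      have hsub : ∀ t ∈ C, ∃ s, toEmb f s = t := by
        intro t ht
        by_contra hs
        push Not at hs
        exact hne (altSum_preimage_eq_zero f _ ht hs)
      refine ⟨Finset.univ.filter fun s => toEmb f s ∈ C, ?_, ?_⟩
      · rename_i hC
        have hC := (Finset.mem_filter.1 hC).2
        simp only [Finset.coe_filter, Finset.mem_univ, true_and, Set.mem_ofPred_eq]
        refine le_trans (Finset.card_le_card_of_injOn (toEmb f) (fun s hs => ?_)
          (toEmb f).injective.injOn) hC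
        exact (Finset.mem_filter.1 hs).2
      · ext t
        simp only [Finset.mem_map, Finset.mem_filter, Finset.mem_univ, true_and]
        constructor
        · rintro ⟨s, hs, rfl⟩
          exact hs
        · intro ht
          obtain ⟨s, rfl⟩ := hsub t ht
          exact ⟨s, ht, rfl⟩
    · intro C _
      exact (altSum_preimage_map f _ C).symm
  rw [key]
  split_ifs with hl
  · rfl
  · refine Finset.sum_eq_zero fun C _ => Finset.sum_eq_zero fun B _ => ?_
    rw [extendTerm_of_length_ne φ hl, smul_zero]

/-- The inverse of the inclusion of the full subset. -/
def toSubUniv (S : FI) : S ⟶ sub (Finset.univ : Finset S.carrier) where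
  toFun s := ⟨s, Finset.mem_univ s⟩
  inj' _ _ h := congrArg Subtype.val h

lemma res_subι_univ_injective : Function.Injective (res ℓ (subι (Finset.univ : Finset S.carrier))) := by
  refine Function.LeftInverse.injective (g := res ℓ (toSubUniv S)) fun x => ?_
  rw [← AddMonoidHom.comp_apply, ← res_comp]
  exact DFunLike.congr_fun (res_id ℓ) x

/-- For |S| ≤ d nothing is cut off, so inversion leaves the term of the full subset. No letters are
appended there, and naturality along the bijection with `S` identifies it with φ. -/
lemma extend_eq {k d : ℕ} {φ : ∀ S : FI, WordGroup k S →+ WordGroup ℓ S}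
    (hφ : NaturalLE d φ) (hS : S.card ≤ d) : extend d φ S = φ S := by
  refine wordGroup_hom_ext fun u v h => ?_
  rw [extend, desc_wd _ h, Finset.filter_true_of_mem, ← Finset.powerset_univ, sum_altSum]
  · apply res_subι_univ_injective
    rw [extendTerm, res_append_self (isCompl_filter h fun s _ => Finset.mem_univ s), hφ _ _ hS]
  · intro C _
    refine (Finset.card_le_univ C).trans ?_
    rwa [FI.card, Nat.card_eq_fintype_card] at hS

/-- A map of words that is natural in degrees at most `d` agrees in these degrees with a morphism
of `FJ`. -/
lemma exists_extension {k ℓ d : ℕ} {φ : ∀ S : FI, WordGroup k S →+ WordGroup ℓ S}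
    (hφ : NaturalLE d φ) :
    ∃ ψ : FJ.of k ⟶ FJ.of ℓ, ∀ S : FI, S.card ≤ d → wordMap ψ S = φ S :=
  ⟨ofWordMap (extend d φ) (res_extend hφ), fun S hS =>
    (wordMap_ofWordMap _ (res_extend hφ) S).trans (extend_eq hφ hS)⟩

/-! ### Disjoint unions with a standard set -/

/-- The disjoint union with a standard finite set. -/
def addStd (S : FI) (k : ℕ) : FI := ⟨S.carrier ⊕ Fin k⟩

/-- The inclusion into the disjoint union with a standard finite set. -/
def addStdι (S : FI) (k : ℕ) : S ⟶ addStd S k := Function.Embedding.inl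

/-- The disjoint union with a standard finite set is functorial. -/
def addStdMap (f : S ⟶ T) (k : ℕ) : addStd S k ⟶ addStd T k :=
  Function.Embedding.sumMap (toEmb f) (Function.Embedding.refl (Fin k))

lemma addStdι_naturality (f : S ⟶ T) (k : ℕ) :
    addStdι S k ≫ addStdMap f k = f ≫ addStdι T k := rfl

lemma card_addStd (S : FI) (k : ℕ) : (addStd S k).card = S.card + k := by
  change Nat.card (S.carrier ⊕ Fin k) = Nat.card S.carrier + k
  simp

/-- The list of the elements of the standard finite set. -/
def stdList (S : FI) (k : ℕ) : List (addStd S k).carrier := (List.finRange k).map Sum.inr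

lemma isCompl_stdList (S : FI) (k : ℕ) : IsCompl (addStdι S k) (stdList S k) := by
  have hnd : (stdList S k).Nodup := (List.nodup_finRange k).map Sum.inr_injective
  refine ⟨fun s => List.count_eq_zero_of_not_mem ?_, fun t ht => List.count_eq_one_of_mem hnd ?_⟩
  · intro h
    obtain ⟨i, _, hi⟩ := List.mem_map.1 h
    cases hi
  · rcases t with s | i
    · exact absurd rfl (ht s)
    · exact List.mem_map_of_mem (List.mem_finRange i)

lemma pull_addStdMap_stdList (f : S ⟶ T) (k : ℕ) :
    pull (addStdMap f k) (stdList T k) = stdList S k := by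
  have : stdList T k = (stdList S k).map (toEmb (addStdMap f k)) := by
    exact (List.map_map (f := Sum.inr) (g := toEmb (addStdMap f k)) (l := List.finRange k)).symm
  rw [this, pull_map]

/-- Fresh letters appended in a fixed order do not interfere with deletions in `S`. So elements of
Ξ(ℓ)_S can be lifted to arbitrarily large sets in a way that is natural in `S`. -/
lemma res_addStdMap_append (f : S ⟶ T) (k : ℕ) (x : WordGroup ℓ T) :
    res ℓ (addStdMap f k) (append ℓ (addStdι T k) (stdList T k) x) =
      append ℓ (addStdι S k) (stdList S k) (res ℓ f x) := by
  rw [res_append (addStdι_naturality f k).symm _ (isCompl_stdList T k), pull_addStdMap_stdList]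
  rintro b (s | i) h
  · exact ⟨s, (Sum.inl_injective h).symm⟩
  · cases h

end FI

/-! ### Combinations of lists and their faces -/

section Lists

variable {α β A : Type*} [AddCommGroup A]

/-- Evaluation of a formal integral combination. -/
noncomputable def evalSum (F : α → A) : (α →₀ ℤ) →+ A :=
  (Finsupp.linearCombination ℤ F).toAddMonoidHom

@[simp] lemma evalSum_single (F : α → A) (a : α) : evalSum F (Finsupp.single a 1) = F a := by
  simp [evalSum]

lemma evalSum_mapDomain (F : β → A) (f : α → β) (x : α →₀ ℤ) :
    evalSum F (Finsupp.mapDomain f x) = evalSum (fun a => F (f a)) x :=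
  Finsupp.linearCombination_mapDomain ℤ f x

lemma evalSum_congr {F G : α → A} {x : α →₀ ℤ} (h : ∀ a ∈ x.support, F a = G a) :
    evalSum F x = evalSum G x :=
  Finsupp.sum_congr fun a ha => congrArg _ (h a ha)

lemma evalSum_zero {x : α →₀ ℤ} : evalSum (fun _ => (0 : A)) x = 0 := by
  change Finsupp.sum x (fun _ n => n • (0 : A)) = 0
  simp only [smul_zero, Finsupp.sum, Finset.sum_const_zero]

lemma map_evalSum {B : Type*} [AddCommGroup B] (r : A →+ B) (F : α → A) (x : α →₀ ℤ) :
    r (evalSum F x) = evalSum (fun a => r (F a)) x := by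
  change r (Finsupp.sum x _) = Finsupp.sum x _
  rw [map_finsuppSum]
  exact Finsupp.sum_congr fun a _ => map_zsmul _ _ _

/-- Deletion of the `i`-th entry. -/
noncomputable def face (i : ℕ) : (List α →₀ ℤ) →+ (List α →₀ ℤ) :=
  Finsupp.mapDomain.addMonoidHom fun l => l.eraseIdx i

/-- Insertion of `a` at the `i`-th place. -/
noncomputable def insertAt (i : ℕ) (a : α) : (List α →₀ ℤ) →+ (List α →₀ ℤ) :=
  Finsupp.mapDomain.addMonoidHom fun l => l.insertIdx i a

lemma eraseIdx_eraseIdx_of_lt (l : List α) {i j : ℕ} (h : j ≤ i) :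
    (l.eraseIdx (i + 1)).eraseIdx j = (l.eraseIdx j).eraseIdx i := by
  induction l generalizing i j with
  | nil => rfl
  | cons a l ih =>
    cases j with
    | zero => rfl
    | succ j =>
      obtain ⟨i, rfl⟩ := Nat.exists_eq_add_of_le' (Nat.one_le_iff_ne_zero.2 (by omega : i ≠ 0))
      simp [ih (by omega : j ≤ i)]

lemma eraseIdx_insertIdx_of_lt (l : List α) (a : α) {i j : ℕ} (h : j ≤ i) (hi : i < l.length) :
    (l.insertIdx (i + 1) a).eraseIdx j = (l.eraseIdx j).insertIdx i a := by
  induction l generalizing i j with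
  | nil => simp at hi
  | cons b l ih =>
    cases j with
    | zero => simp
    | succ j =>
      obtain ⟨i, rfl⟩ := Nat.exists_eq_add_of_le' (Nat.one_le_iff_ne_zero.2 (by omega : i ≠ 0))
      simp only [List.length_cons] at hi
      simp [ih (by omega : j ≤ i) (by omega)]

lemma face_face (x : List α →₀ ℤ) {i j : ℕ} (h : j ≤ i) :
    face j (face (i + 1) x) = face i (face j x) := by
  simp only [face, Finsupp.mapDomain.addMonoidHom_apply, ← Finsupp.mapDomain_comp]
  congr 1
  funext l
  exact eraseIdx_eraseIdx_of_lt l h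

lemma face_insertAt_self (i : ℕ) (a : α) (x : List α →₀ ℤ) : face i (insertAt i a x) = x := by
  simp only [face, insertAt, Finsupp.mapDomain.addMonoidHom_apply, ← Finsupp.mapDomain_comp]
  convert Finsupp.mapDomain_id
  funext l
  exact List.eraseIdx_insertIdx_self a

/-- A combination of lists of distinct entries, of length `e`. -/
def IsInj (e : ℕ) (x : List α →₀ ℤ) : Prop := ∀ l ∈ x.support, l.Nodup ∧ l.length = e

lemma IsInj.zero (e : ℕ) : IsInj e (0 : List α →₀ ℤ) := by
  simp [IsInj]

lemma IsInj.add {e : ℕ} {x y : List α →₀ ℤ} (hx : IsInj e x) (hy : IsInj e y) :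
    IsInj e (x + y) := by
  classical
  intro l hl
  rcases Finset.mem_union.1 (Finsupp.support_add hl) with h | h
  exacts [hx l h, hy l h]

lemma IsInj.sub {e : ℕ} {x y : List α →₀ ℤ} (hx : IsInj e x) (hy : IsInj e y) :
    IsInj e (x - y) := by
  classical
  intro l hl
  rcases Finset.mem_union.1 (Finsupp.support_sub hl) with h | h
  exacts [hx l h, hy l h]

lemma IsInj.mapDomain {e e' : ℕ} {x : List α →₀ ℤ} (hx : IsInj e x) (f : List α → List β)
    (hf : ∀ l ∈ x.support, l.Nodup → l.length = e → (f l).Nodup ∧ (f l).length = e') :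
    IsInj e' (Finsupp.mapDomain f x) := by
  classical
  intro l hl
  obtain ⟨m, hm, rfl⟩ := Finset.mem_image.1 (Finsupp.mapDomain_support hl)
  exact hf m hm (hx m hm).1 (hx m hm).2

lemma IsInj.face {e i : ℕ} (hi : i ≤ e) {x : List α →₀ ℤ} (hx : IsInj (e + 1) x) :
    IsInj e (face i x) :=
  hx.mapDomain _ fun l _ h1 h2 => ⟨h1.sublist (List.eraseIdx_sublist _ _), by
    rw [List.length_eraseIdx_of_lt (by omega)]; omega⟩

lemma IsInj.insertAt {e i : ℕ} (hi : i ≤ e) {x : List α →₀ ℤ} (hx : IsInj e x) {a : α}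
    (ha : ∀ l ∈ x.support, a ∉ l) : IsInj (e + 1) (insertAt i a x) :=
  hx.mapDomain _ fun l hl h1 h2 => by
    have hp := List.perm_insertIdx a l (by omega : i ≤ l.length)
    exact ⟨hp.nodup_iff.2 (List.nodup_cons.2 ⟨ha l hl, h1⟩), by rw [hp.length_eq]; simp [h2]⟩

lemma face_insertAt_of_lt {e i j : ℕ} (h : j ≤ i) (hi : i < e) (a : α) {x : List α →₀ ℤ}
    (hx : IsInj e x) : face j (insertAt (i + 1) a x) = insertAt i a (face j x) := by
  simp only [face, insertAt, Finsupp.mapDomain.addMonoidHom_apply, ← Finsupp.mapDomain_comp]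
  exact Finsupp.mapDomain_congr fun l hl =>
    eraseIdx_insertIdx_of_lt l a h (by rwa [(hx l hl).2])

lemma exists_forall_notMem (x : List ℕ →₀ ℤ) : ∃ a : ℕ, ∀ l ∈ x.support, ∀ b ∈ l, b < a := by
  refine ⟨x.support.sup (fun l => l.toFinset.sup id) + 1, fun l hl b hb => Nat.lt_succ_of_le ?_⟩
  exact le_trans (Finset.le_sup (f := id) (List.mem_toFinset.2 hb))
    (Finset.le_sup (f := fun l : List ℕ => l.toFinset.sup id) hl)

/-- The faces are corrected one at a time. The error at the i-th face is repaired by inserting into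
it a letter larger than all others at place i. The earlier faces of this correction are insertions
into faces of the error, which vanish because the faces of c all agree. -/
lemma exists_filler {e : ℕ} {c c' : List ℕ →₀ ℤ} (hc : IsInj e c) (hc' : ∀ i < e, face i c = c') :
    ∃ z : List ℕ →₀ ℤ, IsInj (e + 1) z ∧ ∀ i < e + 1, face i z = c := by
  suffices ∀ i ≤ e + 1, ∃ z : List ℕ →₀ ℤ, IsInj (e + 1) z ∧ ∀ j < i, face j z = c from
    this (e + 1) le_rfl
  intro i hi
  induction i with
  | zero => exact ⟨0, IsInj.zero _, by simp⟩
  | succ i ih =>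
    obtain ⟨z, hz, hz'⟩ := ih (by omega)
    have hd : IsInj e (c - face i z) := hc.sub (hz.face (by omega))
    obtain ⟨a, ha⟩ := exists_forall_notMem (c - face i z)
    refine ⟨z + insertAt i a (c - face i z), hz.add (hd.insertAt (by omega)
      fun l hl h => lt_irrefl a (ha l hl a h)), fun j hj => ?_⟩
    rw [map_add]
    rcases Nat.lt_succ_iff_lt_or_eq.1 hj with hj | rfl
    · obtain ⟨i, rfl⟩ := Nat.exists_eq_add_of_le' (Nat.one_le_iff_ne_zero.2 (by omega : i ≠ 0))
      rw [face_insertAt_of_lt (by omega) (by omega) a hd, hz' j hj, map_sub,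
        face_face z (by omega), hz' j hj, hc' j (by omega), hc' i (by omega), sub_self, map_zero,
        add_zero]
    · rw [face_insertAt_self]
      abel

/-- The pairs consisting of a combination of injective lists of length `e` all of whose faces
agree. -/
def EqualFaces (e : ℕ) : Type :=
  {c : List ℕ →₀ ℤ // IsInj e c ∧ ∃ c', ∀ i < e, face i c = c'}

/-- A sequence of combinations of lists of natural numbers with prescribed faces. -/
noncomputable def chainSeq : (e : ℕ) → EqualFaces e
  | 0 => ⟨Finsupp.single [] 1, by
      intro l hl
      rw [Finset.mem_singleton.1 (Finsupp.support_single_subset hl)]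
      -- There are no faces to compare in length zero, so the common face is arbitrary.
      simp, 0, by simp⟩
  | e + 1 =>
    have h := exists_filler (chainSeq e).2.1 (chainSeq e).2.2.choose_spec
    ⟨h.choose, h.choose_spec.1, _, h.choose_spec.2⟩

/-- The faces of each member of the sequence are the preceding member. -/
def IsChainSeq (c : ℕ → List α →₀ ℤ) : Prop := ∀ e, ∀ i ≤ e, face i (c (e + 1)) = c e

lemma exists_isChainSeq : ∃ c : ℕ → List ℕ →₀ ℤ, c 0 = Finsupp.single [] 1 ∧ (∀ e, IsInj e (c e)) ∧
    IsChainSeq c :=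
  ⟨fun e => (chainSeq e).1, rfl, fun e => (chainSeq e).2.1, fun e i hi => by
    have h := exists_filler (chainSeq e).2.1 (chainSeq e).2.2.choose_spec
    exact h.choose_spec.2 i (Nat.lt_succ_of_le hi)⟩

lemma face_mapDomain_map (f : α → β) (i : ℕ) (x : List α →₀ ℤ) :
    face i (Finsupp.mapDomain (List.map f) x) = Finsupp.mapDomain (List.map f) (face i x) := by
  simp only [face, Finsupp.mapDomain.addMonoidHom_apply, ← Finsupp.mapDomain_comp]
  congr 1
  funext l
  exact (List.eraseIdx_map f l i)

/-- In any finite set with enough elements outside of a given subset, there is a sequence of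
combinations of lists with prescribed faces. -/
lemma exists_isChainSeq_avoiding (d : ℕ) : ∃ N : ℕ, ∀ {α : Type} [Fintype α] [DecidableEq α]
    (E : Finset α), E.card + N ≤ Fintype.card α → ∃ (E' : Finset α) (c : ℕ → List α →₀ ℤ),
      Disjoint E E' ∧ E'.card ≤ N ∧ c 0 = Finsupp.single [] 1 ∧ IsChainSeq c ∧
      ∀ e ≤ d, IsInj e (c e) ∧ ∀ l ∈ (c e).support, ∀ x ∈ l, x ∈ E' := by
  obtain ⟨c, h0, h1, h2⟩ := exists_isChainSeq
  choose b hb using fun e => exists_forall_notMem (c e)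
  -- The supremum bounds all entries that occur in lengths up to d. The additional 1 makes E'
  -- nonempty, which provides the default value of `star`.
  refine ⟨(Finset.range (d + 1)).sup b + 1, fun {α} _ _ E hE => ?_⟩
  set N := (Finset.range (d + 1)).sup b + 1
  obtain ⟨E', hE', hcard⟩ := Finset.exists_subset_card_eq (s := Eᶜ) (n := N) (by
    rw [Finset.card_compl]; omega)
  have hN : 0 < E'.card := by omega
  -- The face identities survive any relabelling, so `star` may be arbitrary beyond N; injectivity
  -- matters only for lists of length at most d.
  let star : ℕ → α := fun i => if h : i < E'.card then (E'.equivFin.symm ⟨i, h⟩ : α) else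
    (E'.equivFin.symm ⟨0, hN⟩ : α)
  have hmem : ∀ i, star i ∈ E' := by
    intro i
    simp only [star]
    split_ifs <;> exact Subtype.property _
  have hinj : ∀ i < N, ∀ j < N, star i = star j → i = j := by
    intro i hi j hj h
    simp only [star] at h
    rw [dif_pos (by omega), dif_pos (by omega)] at h
    simpa using E'.equivFin.symm.injective (Subtype.ext h)
  have hlt : ∀ e ≤ d, ∀ l ∈ (c e).support, ∀ x ∈ l, x < N := fun e he l hl x hx =>
    lt_of_lt_of_le (hb e l hl x hx) ((Finset.le_sup (f := b)
      (Finset.mem_range.2 (Nat.lt_succ_of_le he))).trans (Nat.le_succ _))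
  refine ⟨E', fun e => Finsupp.mapDomain (List.map star) (c e), ?_, hcard.le, ?_, ?_, ?_⟩
  · exact disjoint_compl_right.mono_right hE'
  · simp [h0, Finsupp.mapDomain_single]
  · intro e i hi
    rw [face_mapDomain_map, h2 e i hi]
  · intro e he
    refine ⟨(h1 e).mapDomain _ fun l hl hnd hlen => ⟨?_, by simpa using hlen⟩, ?_⟩
    · refine List.Nodup.map_on (fun x hx y hy hxy => ?_) hnd
      exact hinj x (hlt e he l hl x hx) y (hlt e he l hl y hy) hxy
    · classical
      intro l hl x hx
      obtain ⟨m, _, rfl⟩ := Finset.mem_image.1 (Finsupp.mapDomain_support hl)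
      obtain ⟨i, _, rfl⟩ := List.mem_map.1 hx
      exact hmem i

end Lists

/-! ### Combinations of injections, and their construction from lists -/

namespace FI

variable {ℓ k d : ℕ} {S T U : FI}

/-- The integral combinations of injections. -/
abbrev InjGroup (S T : FI) : Type := (T ⟶ S) →₀ ℤ

/-- Precomposition of injections. -/
noncomputable def pre (S : FI) (f : T ⟶ U) : InjGroup S U →+ InjGroup S T :=
  Finsupp.mapDomain.addMonoidHom fun g => f ≫ g

@[simp] lemma pre_single (f : T ⟶ U) (g : U ⟶ S) (n : ℤ) :
    pre S f (Finsupp.single g n) = Finsupp.single (f ≫ g) n :=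
  Finsupp.mapDomain_single

/-- The list `L` consists of the pairs `(t, g t)`. -/
def IsGraph (g : T ⟶ S) (L : List (T.carrier × S.carrier)) : Prop :=
  ∀ t s, (t, s) ∈ L ↔ toEmb g t = s

lemma IsGraph.unique {g g' : T ⟶ S} {L : List (T.carrier × S.carrier)} (h : IsGraph g L)
    (h' : IsGraph g' L) : g = g' :=
  DFunLike.ext (F := T.carrier ↪ S.carrier) g g' fun t =>
    ((h' t _).1 ((h t (toEmb g t)).2 rfl)).symm

open scoped Classical in
/-- The injection given by a list of pairs. -/
noncomputable def glue (L : List (T.carrier × S.carrier)) : InjGroup S T :=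
  if h : ∃ g : T ⟶ S, IsGraph g L then Finsupp.single h.choose 1 else 0

lemma IsGraph.glue_eq {g : T ⟶ S} {L : List (T.carrier × S.carrier)} (h : IsGraph g L) :
    glue L = Finsupp.single g 1 := by
  have h' : ∃ g : T ⟶ S, IsGraph g L := ⟨g, h⟩
  rw [glue, dif_pos h', h'.choose_spec.unique h]

lemma glue_support (L : List (T.carrier × S.carrier)) {g : T ⟶ S}
    (hg : g ∈ (glue L : InjGroup S T).support) : IsGraph g L := by
  unfold glue at hg
  split_ifs at hg with h
  · rw [Finset.mem_singleton.1 (Finsupp.support_single_subset hg)]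
    exact h.choose_spec
  · simp at hg

/-- Delete the pairs whose first entry is not in the image of `f`. -/
noncomputable def pullPair (f : T ⟶ U) (L : List (U.carrier × S.carrier)) :
    List (T.carrier × S.carrier) :=
  L.filterMap fun p => (pinv f p.1).map (·, p.2)

@[simp] lemma pullPair_append (f : T ⟶ U) (L L' : List (U.carrier × S.carrier)) :
    pullPair f (L ++ L') = pullPair f L ++ pullPair f L' := List.filterMap_append

lemma pullPair_cons_apply (f : T ⟶ U) (t : T.carrier) (s : S.carrier)
    (L : List (U.carrier × S.carrier)) :
    pullPair f ((toEmb f t, s) :: L) = (t, s) :: pullPair f L := by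
  simp [pullPair]

lemma pullPair_cons_of_none {f : T ⟶ U} {t : U.carrier} (h : pinv f t = none) (s : S.carrier)
    (L : List (U.carrier × S.carrier)) :
    pullPair f ((t, s) :: L) = pullPair f L := by
  simp [pullPair, h]

lemma IsGraph.pullPair {g : U ⟶ S} {L : List (U.carrier × S.carrier)} (h : IsGraph g L)
    (f : T ⟶ U) : IsGraph (f ≫ g) (pullPair f L) := by
  intro t s
  simp only [FI.pullPair, List.mem_filterMap, Option.map_eq_some_iff, Prod.exists, Prod.mk.injEq,
    pinv_eq_some]
  constructor
  · rintro ⟨a, b, hab, t, rfl, rfl, rfl⟩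
    exact (h _ _).1 hab
  · intro hts
    exact ⟨toEmb f t, s, (h _ _).2 hts, t, rfl, rfl, rfl⟩

lemma pre_glue {g : U ⟶ S} {L : List (U.carrier × S.carrier)} (h : IsGraph g L) (f : T ⟶ U) :
    pre S f (glue L) = glue (pullPair f L) := by
  rw [h.glue_eq, (h.pullPair f).glue_eq, pre_single]

lemma exists_isGraph_zip {z : List T.carrier} (hz : z.Nodup) (hz' : ∀ t, t ∈ z)
    {l : List S.carrier} (hl : l.Nodup) (hzl : z.length = l.length) :
    ∃ g : T ⟶ S, IsGraph g (z.zip l) := by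
  have hlt : ∀ t, z.idxOf t < l.length := fun t => hzl ▸ List.idxOf_lt_length_of_mem (hz' t)
  refine ⟨(⟨fun t => l[z.idxOf t]'(hlt t), fun t t' h => ?_⟩ : T.carrier ↪ S.carrier), ?_⟩
  · exact (List.idxOf_inj (hz' t)).1 ((hl.getElem_inj_iff).1 h)
  · intro t s
    change _ ↔ l[z.idxOf t]'(hlt t) = s
    rw [List.mem_iff_getElem]
    constructor
    · rintro ⟨i, hi, h⟩
      rw [List.getElem_zip, Prod.mk.injEq] at h
      obtain ⟨rfl, rfl⟩ := h
      congr 1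
      exact hz.idxOf_getElem _ _
    · rintro rfl
      refine ⟨z.idxOf t, by rw [List.length_zip, ← hzl, min_self]; exact hzl ▸ hlt t, ?_⟩
      rw [List.getElem_zip, List.getElem_idxOf]

lemma pullPair_zip_of_forall {f : T ⟶ U} {u : List U.carrier} (h : ∀ t ∈ u, pinv f t ≠ none)
    (l : List S.carrier) : pullPair f (u.zip l) = (pull f u).zip l := by
  induction u generalizing l with
  | nil => rfl
  | cons t u ih =>
    cases l with
    | nil => simp [pullPair]
    | cons s l =>
      rcases pull_cases f t with ⟨t, rfl⟩ | ht
      · rw [List.zip_cons_cons, pullPair_cons_apply, pull_cons_apply, List.zip_cons_cons,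
          ih fun t ht => h t (List.mem_cons_of_mem _ ht)]
      · exact absurd ht (h t List.mem_cons_self)

lemma pullPair_zip_of_none {f : T ⟶ U} (u : List U.carrier) {t : U.carrier} (ht : pinv f t = none)
    (v : List U.carrier) (l : List S.carrier) :
    pullPair f ((u ++ t :: v).zip l) = pullPair f ((u ++ v).zip (l.eraseIdx u.length)) := by
  induction u generalizing l with
  | nil =>
    cases l with
    | nil => simp
    | cons s l => exact pullPair_cons_of_none ht s _
  | cons a u ih =>
    cases l with
    | nil => simp
    | cons s l =>
      rcases pull_cases f a with ⟨a, rfl⟩ | ha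
      · simp only [List.cons_append, List.zip_cons_cons, List.length_cons, List.eraseIdx_cons_succ,
          pullPair_cons_apply, ih]
      · simp only [List.cons_append, List.zip_cons_cons, List.length_cons, List.eraseIdx_cons_succ,
          pullPair_cons_of_none ha, ih]

lemma pull_of_none {f : T ⟶ U} (u : List U.carrier) {t : U.carrier} (ht : pinv f t = none)
    (v : List U.carrier) : pull f (u ++ t :: v) = pull f (u ++ v) := by
  rw [pull_append, pull_append, pull_cons_of_none ht]

lemma exists_split_of_none {f : T ⟶ U} {v : List U.carrier} (h : ¬ ∀ t ∈ v, pinv f t ≠ none) :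
    ∃ v₁ t v₂, v = v₁ ++ t :: v₂ ∧ pinv f t = none := by
  push Not at h
  obtain ⟨t, ht, h⟩ := h
  obtain ⟨v₁, v₂, rfl⟩ := List.append_of_mem ht
  exact ⟨v₁, t, v₂, rfl, h⟩

lemma length_pull_of_forall {f : T ⟶ U} {u : List U.carrier} (h : ∀ t ∈ u, pinv f t ≠ none) :
    (pull f u).length = u.length := by
  refine length_pull_eq f fun t ht => ?_
  rcases pull_cases f t with h' | h'
  exacts [h', absurd h' (h t ht)]

variable {A : Type*} [AddCommGroup A]

/-- Deleting a letter of v amounts to a face of the combination substituted for v. All faces are the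
preceding member of the sequence, so the result does not remember which letters were deleted. -/
lemma evalSum_pullPair_of_isChainSeq {c : ℕ → List S.carrier →₀ ℤ} (hc : IsChainSeq c) (f : T ⟶ U)
    (H : List (T.carrier × S.carrier) → A) (v : List U.carrier) :
    evalSum (fun l => H (pullPair f (v.zip l))) (c v.length) =
      evalSum (fun l => H ((pull f v).zip l)) (c (pull f v).length) := by
  by_cases h : ∀ t ∈ v, pinv f t ≠ none
  · rw [length_pull_of_forall h]
    exact evalSum_congr fun l _ => by rw [pullPair_zip_of_forall h]
  · obtain ⟨v₁, t, v₂, rfl, ht⟩ := exists_split_of_none h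
    rw [pull_of_none v₁ ht, ← evalSum_pullPair_of_isChainSeq hc f H (v₁ ++ v₂)]
    have hlen : (v₁ ++ t :: v₂).length = (v₁ ++ v₂).length + 1 := by
      simp only [List.length_append, List.length_cons]
      omega
    rw [hlen, ← hc (v₁ ++ v₂).length v₁.length (by simp)]
    rw [face, Finsupp.mapDomain.addMonoidHom_apply, evalSum_mapDomain]
    exact evalSum_congr fun l _ => by rw [pullPair_zip_of_none v₁ ht]
termination_by v.length

/-- A single deleted letter already produces a face of p. -/
lemma evalSum_pullPair_eq_zero {p : List S.carrier →₀ ℤ} (f : T ⟶ U)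
    (H : List (T.carrier × S.carrier) → A) {u : List U.carrier}
    (hp : ∀ i < u.length, face i p = 0) (h : ¬ ∀ t ∈ u, pinv f t ≠ none) :
    evalSum (fun l => H (pullPair f (u.zip l))) p = 0 := by
  obtain ⟨v₁, t, v₂, rfl, ht⟩ := exists_split_of_none h
  have := congrArg (evalSum fun l => H (pullPair f ((v₁ ++ v₂).zip l))) (hp v₁.length (by simp))
  rw [face, Finsupp.mapDomain.addMonoidHom_apply, evalSum_mapDomain, map_zero] at this
  rw [← this]
  exact evalSum_congr fun l _ => by rw [pullPair_zip_of_none v₁ ht]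

/-- The map which replaces the letters of the first word according to `p`, and those of the second
word according to `c`. -/
noncomputable def subst (k : ℕ) (p : List S.carrier →₀ ℤ) (c : ℕ → List S.carrier →₀ ℤ) (T : FI) :
    WordGroup k T →+ InjGroup S T :=
  desc fun u v => evalSum (fun a => evalSum (fun l => glue (u.zip a ++ v.zip l)) (c v.length)) p

/-- The map `β` is natural in degrees at most `d`. -/
def InjNaturalLE (d : ℕ) (β : ∀ T : FI, WordGroup k T →+ InjGroup S T) : Prop :=
  ∀ {T U : FI} (f : T ⟶ U) (x : WordGroup k U), U.card ≤ d → pre S f (β U x) = β T (res k f x)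

/-- Vanishing faces of p match the rule that losing a distinguished letter gives zero; the constant
faces of c match the deletion of other letters. Disjointness of E and E' makes the glued lists
injective, and the bound d enters because c consists of injective lists in E' only up to length d.
-/
lemma subst_natural {E E' : Finset S.carrier} (hE : Disjoint E E') {p : List S.carrier →₀ ℤ}
    (hp : IsInj k p) (hpE : ∀ l ∈ p.support, ∀ x ∈ l, x ∈ E) (hp0 : ∀ i < k, face i p = 0)
    {c : ℕ → List S.carrier →₀ ℤ} (hc : IsChainSeq c)
    (hcE : ∀ e ≤ d, IsInj e (c e) ∧ ∀ l ∈ (c e).support, ∀ x ∈ l, x ∈ E') :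
    InjNaturalLE d (subst k p c) := by
  intro T U f x hU
  refine desc_res f _ (fun u v h => ?_) x
  have hv : v.length ≤ d := by have := h.length; omega
  have hg : ∀ a ∈ p.support, ∀ l ∈ (c v.length).support,
      ∃ g : U ⟶ S, IsGraph g (u.zip a ++ v.zip l) := by
    intro a ha l hl
    have h1 := hp a ha
    have h2 := (hcE _ hv).1 l hl
    rw [← List.zip_append (h.1.trans h1.2.symm)]
    refine exists_isGraph_zip (List.nodup_iff_count_le_one.2 fun t => ?_) (fun t => ?_) ?_ ?_
    · rw [List.count_append, h.2]
    · rw [← List.count_pos_iff, List.count_append, h.2]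
      exact one_pos
    · refine List.nodup_append'.2 ⟨h1.1, h2.1, fun x hx hx' => ?_⟩
      exact Finset.disjoint_left.1 hE (hpE a ha x hx) ((hcE _ hv).2 l hl x hx')
    · rw [List.length_append, List.length_append, h.1, h1.2, h2.2]
  have h1 : pre S f (evalSum (fun a => evalSum (fun l => glue (u.zip a ++ v.zip l))
      (c v.length)) p) = evalSum (fun a => evalSum (fun l =>
        glue (pullPair f (u.zip a) ++ (pull f v).zip l)) (c (pull f v).length)) p := by
    rw [map_evalSum]
    refine evalSum_congr fun a ha => ?_
    rw [map_evalSum, ← evalSum_pullPair_of_isChainSeq hc f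
      (fun L => glue (pullPair f (u.zip a) ++ L))]
    refine evalSum_congr fun l hl => ?_
    obtain ⟨g, hg⟩ := hg a ha l hl
    rw [pre_glue hg, pullPair_append]
  rw [h1]
  split_ifs with hl
  · refine evalSum_congr fun a ha => ?_
    rw [pullPair_zip_of_forall]
    intro t ht hn
    have := map_pull_of_length_eq _ (hl.trans h.1.symm)
    rw [← this, List.mem_map] at ht
    obtain ⟨s, _, rfl⟩ := ht
    simp at hn
  · refine evalSum_pullPair_eq_zero f (fun L => evalSum (fun l => glue (L ++ (pull f v).zip l)) _)
      (by rwa [h.1]) fun h' => hl ?_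
    rw [length_pull_of_forall h', h.1]

lemma evalSum_mem_closure {α : Type*} {F : α → A} {x : α →₀ ℤ} {K : AddSubgroup A}
    (h : ∀ a ∈ x.support, F a ∈ K) : evalSum F x ∈ K :=
  K.sum_mem fun a ha => K.zsmul_mem (h a ha) _

/-- The combinations of injections with image in `E`. -/
noncomputable def imageIn (E : Finset S.carrier) (T : FI) : AddSubgroup (InjGroup S T) :=
  (Finsupp.supported ℤ ℤ {g : T ⟶ S | ∀ t, toEmb g t ∈ E}).toAddSubgroup

lemma mem_imageIn {E : Finset S.carrier} {x : InjGroup S T} :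
    x ∈ imageIn E T ↔ ∀ g ∈ x.support, ∀ t, toEmb g t ∈ E := by
  change x ∈ Finsupp.supported ℤ ℤ _ ↔ _
  rw [Finsupp.mem_supported]
  rfl

lemma imageIn_mono {E E' : Finset S.carrier} (h : E ⊆ E') {x : InjGroup S T}
    (hx : x ∈ imageIn E T) : x ∈ imageIn E' T :=
  mem_imageIn.2 fun g hg t => h (mem_imageIn.1 hx g hg t)

lemma subst_mem_imageIn {E E' : Finset S.carrier} {p : List S.carrier →₀ ℤ}
    (hpE : ∀ l ∈ p.support, ∀ x ∈ l, x ∈ E) {c : ℕ → List S.carrier →₀ ℤ}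
    (hcE : ∀ e ≤ d, IsInj e (c e) ∧ ∀ l ∈ (c e).support, ∀ x ∈ l, x ∈ E') (hT : T.card ≤ d)
    (x : WordGroup k T) : subst k p c T x ∈ imageIn (E ∪ E') T := by
  refine wordGroup_induction (P := fun x => subst k p c T x ∈ imageIn (E ∪ E') T) x
    (by rw [map_zero]; exact zero_mem _) (fun x y hx hy => ?_)
    (fun x hx => ?_) fun u v h => ?_
  · rw [map_add]
    exact add_mem hx hy
  · rw [map_neg]
    exact neg_mem hx
  · rw [subst, desc_wd _ h]
    refine evalSum_mem_closure fun a ha => evalSum_mem_closure fun l hl => mem_imageIn.2 ?_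
    intro g hg t
    have hv : v.length ≤ d := by have := h.length; omega
    rcases List.mem_append.1 ((glue_support _ hg t (toEmb g t)).2 rfl) with h' | h'
    · exact Finset.mem_union_left _ (hpE a ha _ (List.of_mem_zip h').2)
    · exact Finset.mem_union_right _ ((hcE _ hv).2 l hl _ (List.of_mem_zip h').2)

lemma isGraph_zip_map {τ : List T.carrier} (hτ : ∀ t, t ∈ τ) (g : T ⟶ S) :
    IsGraph g (τ.zip (τ.map (toEmb g))) := by
  intro t s
  have : ∀ l : List T.carrier, l.zip (l.map (toEmb g)) = l.map fun t => (t, toEmb g t) := by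
    intro l
    induction l with
    | nil => rfl
    | cons a l ih => rw [List.map_cons, List.zip_cons_cons, ih, List.map_cons]
  rw [this, List.mem_map]
  constructor
  · rintro ⟨a, _, h⟩
    rw [Prod.mk.injEq] at h
    obtain ⟨rfl, rfl⟩ := h
    rfl
  · rintro rfl
    exact ⟨t, hτ t, rfl⟩

lemma isWord_of_enum {τ : List T.carrier} (hnd : τ.Nodup) (hτ : ∀ t, t ∈ τ) :
    IsWord τ.length τ [] :=
  ⟨rfl, fun t => by simpa using List.count_eq_one_of_mem hnd (hτ t)⟩

/-- The lists of values of a combination of injections. -/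
noncomputable def values (τ : List T.carrier) : InjGroup S T →+ (List S.carrier →₀ ℤ) :=
  Finsupp.mapDomain.addMonoidHom fun g => τ.map (toEmb g)

lemma exists_of_mem_support_values {τ : List T.carrier} {ε : InjGroup S T} {l : List S.carrier}
    (hl : l ∈ (values τ ε).support) : ∃ g ∈ ε.support, τ.map (toEmb g) = l := by
  classical
  exact Finset.mem_image.1 (Finsupp.mapDomain_support hl)

/-- With an empty second word only `c 0`, the empty list, is substituted, and ε is read back from
its lists of values. -/
lemma subst_values {τ : List T.carrier} (hnd : τ.Nodup) (hτ : ∀ t, t ∈ τ) (ε : InjGroup S T)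
    {c : ℕ → List S.carrier →₀ ℤ} (hc : c 0 = Finsupp.single [] 1) :
    subst τ.length (values τ ε) c T (wd τ.length τ []) = ε := by
  rw [subst, desc_wd _ (isWord_of_enum hnd hτ), values, Finsupp.mapDomain.addMonoidHom_apply,
    evalSum_mapDomain, List.length_nil, hc]
  have : ∀ g ∈ ε.support, evalSum (fun l => (glue (τ.zip (τ.map (toEmb g)) ++ [].zip l) :
      InjGroup S T)) (Finsupp.single [] 1) = Finsupp.single g 1 := by
    intro g _
    rw [evalSum_single, List.zip_nil_left, List.append_nil, (isGraph_zip_map hτ g).glue_eq]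
  rw [evalSum_congr this]
  change Finsupp.sum ε (fun g n => n • Finsupp.single g (1 : ℤ)) = ε
  simp

/-- The i-th face records the restriction of ε to the complement of `τ[i]`, a set of smaller size.
-/
lemma face_values {τ : List T.carrier} (hnd : τ.Nodup) {ε : InjGroup S T}
    (hε : ∀ {U : FI} (f : U ⟶ T), U.card < T.card → pre S f ε = 0) {i : ℕ} (hi : i < τ.length) :
    face i (values τ ε) = 0 := by
  set B : Finset T.carrier := Finset.univ.erase τ[i]
  have hB : (sub B).card < T.card := by
    rw [card_sub, FI.card, Nat.card_eq_fintype_card]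
    exact Finset.card_erase_lt_of_mem (Finset.mem_univ _)
  have hmem : ∀ t ∈ τ.eraseIdx i, ∃ s, toEmb (subι B) s = t := by
    intro t ht
    refine ⟨⟨t, Finset.mem_erase.2 ⟨?_, Finset.mem_univ t⟩⟩, rfl⟩
    rintro rfl
    rw [List.mem_eraseIdx_iff_getElem] at ht
    obtain ⟨j, hj, hji, h⟩ := ht
    exact hji ((hnd.getElem_inj_iff).1 h)
  have h1 := map_pull_of_length_eq _ (length_pull_eq (subι B) hmem)
  have h2 := congrArg (values (pull (subι B) (τ.eraseIdx i))) (hε (subι B) hB)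
  rw [map_zero, pre, values, Finsupp.mapDomain.addMonoidHom_apply,
    Finsupp.mapDomain.addMonoidHom_apply, ← Finsupp.mapDomain_comp] at h2
  rw [← h2, face, values, Finsupp.mapDomain.addMonoidHom_apply,
    Finsupp.mapDomain.addMonoidHom_apply, ← Finsupp.mapDomain_comp]
  refine Finsupp.mapDomain_congr fun g _ => ?_
  simp only [Function.comp_apply]
  rw [List.eraseIdx_map, ← h1, List.map_map, h1]
  rfl

/-- A combination of injections that vanishes in lower degrees is the value of a natural map at the
word `(τ, [])`. -/
lemma exists_subst (d : ℕ) : ∃ N : ℕ, ∀ {S : FI} (E : Finset S.carrier), E.card + N ≤ S.card →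
    ∀ {K : FI} {τ : List K.carrier} (_ : τ.Nodup) (_ : ∀ t, t ∈ τ) {k : ℕ} (_ : τ.length = k)
      (ε : InjGroup S K) (_ : ε ∈ imageIn E K)
      (_ : ∀ {T : FI} (f : T ⟶ K), T.card < K.card → pre S f ε = 0),
    ∃ β : ∀ T : FI, WordGroup k T →+ InjGroup S T, InjNaturalLE d β ∧ β K (wd k τ []) = ε ∧
      ∃ E' : Finset S.carrier, E'.card ≤ E.card + N ∧
        ∀ (T : FI) (x : WordGroup k T), T.card ≤ d → β T x ∈ imageIn E' T := by
  obtain ⟨N, hN⟩ := exists_isChainSeq_avoiding d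
  refine ⟨N, ?_⟩
  rintro S E hE K τ hnd hτ k rfl ε hεE hε
  rw [FI.card, Nat.card_eq_fintype_card] at hE
  obtain ⟨E', c, hdisj, hE', hc0, hc, hcE⟩ := hN E hE
  have hpE : ∀ l ∈ (values τ ε).support, ∀ x ∈ l, x ∈ E := by
    intro l hl x hx
    obtain ⟨g, hg, rfl⟩ := exists_of_mem_support_values hl
    obtain ⟨t, _, rfl⟩ := List.mem_map.1 hx
    exact mem_imageIn.1 hεE g hg t
  have hp : IsInj τ.length (values τ ε) := by
    intro l hl
    obtain ⟨g, hg, rfl⟩ := exists_of_mem_support_values hl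
    exact ⟨hnd.map (toEmb g).injective, List.length_map _⟩
  refine ⟨subst τ.length (values τ ε) c, subst_natural hdisj hp hpE
    (fun i hi => face_values hnd hε hi) hc hcE, subst_values hnd hτ ε hc0, E ∪ E', ?_,
    fun T x hT => subst_mem_imageIn hpE hcE hT x⟩
  exact (Finset.card_union_le _ _).trans (by omega)

/-! ### Resolution of a representable functor -/

/-- The word whose first part enumerates `A`, and whose second part enumerates the complement. -/
noncomputable def setWord (A : Finset S.carrier) : WordGroup A.card S := wd A.card A.toList Aᶜ.toList

lemma count_toList (A : Finset S.carrier) (x : S.carrier) :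
    A.toList.count x = if x ∈ A then 1 else 0 := by
  split_ifs with h
  · exact List.count_eq_one_of_mem A.nodup_toList (Finset.mem_toList.2 h)
  · exact List.count_eq_zero_of_not_mem fun h' => h (Finset.mem_toList.1 h')

lemma isWord_setWord (A : Finset S.carrier) : IsWord A.card A.toList Aᶜ.toList := by
  refine ⟨A.length_toList, fun x => ?_⟩
  rw [count_toList, count_toList]
  by_cases h : x ∈ A <;> simp [h]

lemma res_setWord_eq_zero {g : T ⟶ S} {A : Finset S.carrier} {a : S.carrier} (ha : a ∈ A)
    (h : ∀ t, toEmb g t ≠ a) : res A.card g (setWord A) = 0 := by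
  rw [setWord, res_wd _ (isWord_setWord A), wd_of_length_ne]
  intro hl
  have := map_pull_of_length_eq _ (hl.trans A.length_toList.symm)
  rw [← Finset.mem_toList, ← this, List.mem_map] at ha
  obtain ⟨t, _, ht⟩ := ha
  exact h t ht

lemma res_setWord_self (A : Finset S.carrier) :
    res A.card (subι A) (setWord A) = wd A.card (pull (subι A) A.toList) [] := by
  rw [setWord, res_wd _ (isWord_setWord A)]
  congr 1
  rw [List.eq_nil_iff_forall_not_mem]
  intro s hs
  rw [mem_pull, Finset.mem_toList, Finset.mem_compl] at hs
  exact hs s.2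

/-- Induction on j. If the maps resolve all injections from sets with fewer than j elements, then
the error ε at the inclusion of a j-element set A restricts to zero on smaller sets. By
`exists_subst` it is the value of a natural map at the restriction of `setWord A` to A, and this map
becomes the new β at A. The bound b on the images leaves room in `S` for the letters needed in the
next step. -/
lemma exists_partial_resolution (d j : ℕ) (hj : j ≤ d + 1) :
    ∃ b : ℕ, ∀ S : FI, b ≤ S.card →
      ∃ β : ∀ (A : Finset S.carrier) (T : FI), WordGroup A.card T →+ InjGroup S T,
        (∀ A, InjNaturalLE d (β A)) ∧ (∀ A, j ≤ A.card → ∀ T, β A T = 0) ∧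
        (∀ A, ∃ E : Finset S.carrier, E.card ≤ b ∧
          ∀ (T : FI) (x : WordGroup A.card T), T.card ≤ d → β A T x ∈ imageIn E T) ∧
        ∀ {T : FI} (g : T ⟶ S), T.card < j →
          ∑ A, β A T (res A.card g (setWord A)) = Finsupp.single g 1 := by
  induction j with
  | zero =>
    refine ⟨0, fun S _ => ⟨fun A T => 0, fun A T U f x _ => ?_, fun _ _ _ => rfl,
      fun A => ⟨∅, by simp, fun T x _ => zero_mem _⟩, fun {T} g h => absurd h (Nat.not_lt_zero _)⟩⟩
    simp
  | succ j ih =>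
    obtain ⟨b, ih⟩ := ih (by omega)
    obtain ⟨N, hN⟩ := exists_subst d
    -- The summands account for A itself, for the images of the maps at the 2 ^ j subsets of A, and
    -- for the room required by `exists_subst`.
    refine ⟨j + 2 ^ j * b + N, fun S hS => ?_⟩
    have hb : b ≤ j + 2 ^ j * b + N := by
      have := Nat.le_mul_of_pos_left b (Nat.two_pow_pos j)
      omega
    obtain ⟨β, hβn, hβ0, hβE, hβ⟩ := ih S (hb.trans hS)
    choose E hEb hE using hβE
    let ε : ∀ A : Finset S.carrier, InjGroup S (sub A) := fun A =>
      Finsupp.single (subι A) 1 - ∑ A', β A' (sub A) (res A'.card (subι A) (setWord A'))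
    have key : ∀ A : Finset S.carrier, A.card = j →
        ∃ γ : ∀ T : FI, WordGroup A.card T →+ InjGroup S T, InjNaturalLE d γ ∧
          γ (sub A) (wd A.card (pull (subι A) A.toList) []) = ε A ∧
          ∃ E' : Finset S.carrier, E'.card ≤ j + 2 ^ j * b + N ∧
            ∀ (T : FI) (x : WordGroup A.card T), T.card ≤ d → γ T x ∈ imageIn E' T := by
      intro A hA
      have hcard : (sub A).card ≤ d := by
        rw [card_sub]
        omega
      have hcardE : (A ∪ A.powerset.biUnion E).card ≤ j + 2 ^ j * b := by
        refine (Finset.card_union_le _ _).trans (Nat.add_le_add hA.le ?_)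
        rw [← hA, ← Finset.card_powerset]
        exact Finset.card_biUnion_le_card_mul _ _ _ fun A' _ => hEb A'
      have hnd : (pull (subι A) A.toList).Nodup := List.nodup_iff_count_le_one.2 fun s => by
        rw [count_pull, count_toList]
        split_ifs
        exacts [le_rfl, Nat.zero_le 1]
      have hlen : (pull (subι A) A.toList).length = A.card := by
        rw [length_pull_eq _ fun t ht => exists_of_mem_sub (Finset.mem_toList.1 ht),
          Finset.length_toList]
      have himage : ε A ∈ imageIn (A ∪ A.powerset.biUnion E) (sub A) := by
        refine sub_mem (mem_imageIn.2 fun g hg t => ?_) (sum_mem fun A' _ => ?_)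
        · rw [Finset.mem_singleton.1 (Finsupp.support_single_subset hg)]
          exact Finset.mem_union_left _ t.2
        -- Only subsets of A contribute, since restriction to A kills `setWord A'` for all others.
        · by_cases hA' : A' ⊆ A
          · refine imageIn_mono (Finset.Subset.trans ?_ Finset.subset_union_right)
              (hE A' _ _ hcard)
            exact Finset.subset_biUnion_of_mem E (Finset.mem_powerset.2 hA')
          · obtain ⟨a, ha, ha'⟩ := Finset.not_subset.1 hA'
            rw [res_setWord_eq_zero ha, map_zero]
            · exact zero_mem _
            · rintro t rfl
              exact ha' t.2
      have hprim : ∀ {T : FI} (f : T ⟶ sub A), T.card < (sub A).card → pre S f (ε A) = 0 := by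
        intro T f hT
        rw [card_sub, hA] at hT
        rw [map_sub, pre_single, map_sum, sub_eq_zero, ← hβ (f ≫ subι A) hT]
        refine Finset.sum_congr rfl fun A' _ => ?_
        rw [hβn A' f _ hcard, res_comp, AddMonoidHom.comp_apply]
      obtain ⟨γ, h1, h2, E', h3, h4⟩ := hN (A ∪ A.powerset.biUnion E) (by omega) hnd
        (fun s => mem_pull.2 (Finset.mem_toList.2 s.2)) hlen (ε A) himage hprim
      exact ⟨γ, h1, h2, E', by omega, h4⟩
    choose γ hγn hγ hγE using key
    let β' : ∀ (A : Finset S.carrier) (T : FI), WordGroup A.card T →+ InjGroup S T := fun A =>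
      if h : A.card = j then γ A h else β A
    have hpos : ∀ (A : Finset S.carrier) (h : A.card = j), β' A = γ A h := fun A h => dif_pos h
    have hneg : ∀ (A : Finset S.carrier), A.card ≠ j → β' A = β A := fun A h => dif_neg h
    have hn : ∀ A, InjNaturalLE d (β' A) := by
      intro A
      by_cases h : A.card = j
      · rw [hpos A h]
        exact hγn A h
      · rw [hneg A h]
        exact hβn A
    refine ⟨β', hn, fun A hA T => ?_, fun A => ?_, fun {T} g hT => ?_⟩
    · rw [hneg A (by omega)]
      exact hβ0 A (by omega) T
    · by_cases h : A.card = j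
      · rw [hpos A h]
        exact hγE A h
      · rw [hneg A h]
        exact ⟨E A, (hEb A).trans hb, hE A⟩
    · rcases Nat.lt_succ_iff_lt_or_eq.1 hT with hT | hT
      · rw [← hβ g hT]
        refine Finset.sum_congr rfl fun A _ => ?_
        by_cases h : A.card = j
        · have : ∃ a ∈ A, ∀ t, toEmb g t ≠ a := by
            by_contra! hc
            have := Finset.card_le_card (s := A) (t := Finset.univ.map (toEmb g)) fun a ha => by
              obtain ⟨t, ht⟩ := hc a ha
              exact Finset.mem_map.2 ⟨t, Finset.mem_univ _, ht⟩
            rw [Finset.card_map, Finset.card_univ, ← Nat.card_eq_fintype_card] at this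
            change A.card ≤ T.card at this
            omega
          obtain ⟨a, ha, ha'⟩ := this
          rw [res_setWord_eq_zero ha ha', map_zero, map_zero]
        · rw [hneg A h]
      -- For a source with j elements, g is the inclusion of its image A₀ up to a bijection. Among
      -- the new maps only the one at A₀ contributes there, and it adds exactly the error.
      · set A₀ : Finset S.carrier := Finset.univ.map (toEmb g) with hA₀
        have hA₀c : A₀.card = j := by
          rw [hA₀, Finset.card_map, Finset.card_univ, ← Nat.card_eq_fintype_card]
          exact hT
        have hcard : (sub A₀).card ≤ d := by
          rw [card_sub]
          omega
        let φ : T ⟶ sub A₀ :=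
          (⟨fun t => ⟨toEmb g t, Finset.mem_map_of_mem _ (Finset.mem_univ t)⟩,
            fun t t' h => (toEmb g).injective (congrArg Subtype.val h)⟩ :
            T.carrier ↪ (sub A₀).carrier)
        have hφ : g = φ ≫ subι A₀ := rfl
        have h1 : ∑ A, β' A (sub A₀) (res A.card (subι A₀) (setWord A)) =
            Finsupp.single (subι A₀) 1 := by
          have h2 : ∀ A, A ≠ A₀ → β' A (sub A₀) (res A.card (subι A₀) (setWord A)) =
              β A (sub A₀) (res A.card (subι A₀) (setWord A)) := by
            intro A hne
            by_cases h : A.card = j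
            · have : ¬ A ⊆ A₀ := fun hs => hne (Finset.eq_of_subset_of_card_le hs (by omega))
              obtain ⟨a, ha, ha'⟩ := Finset.not_subset.1 this
              rw [res_setWord_eq_zero ha, map_zero, map_zero]
              rintro t rfl
              exact ha' t.2
            · rw [hneg A h]
          have h3 : β' A₀ (sub A₀) (res A₀.card (subι A₀) (setWord A₀)) =
              β A₀ (sub A₀) (res A₀.card (subι A₀) (setWord A₀)) + ε A₀ := by
            rw [hβ0 A₀ hA₀c.ge, hpos A₀ hA₀c, res_setWord_self, hγ, AddMonoidHom.zero_apply,
              zero_add]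
          rw [← Finset.add_sum_erase _ _ (Finset.mem_univ A₀), h3,
            Finset.sum_congr rfl fun A hA => h2 A (Finset.ne_of_mem_erase hA), add_right_comm,
            Finset.add_sum_erase _ (fun A => β A (sub A₀) (res A.card (subι A₀) (setWord A)))
              (Finset.mem_univ A₀)]
          simp only [ε]
          abel
        rw [hφ, ← pre_single, ← h1, map_sum]
        refine Finset.sum_congr rfl fun A _ => ?_
        rw [hn A φ _ hcard, res_comp, AddMonoidHom.comp_apply]

/-- On sufficiently large sets `S`, the injections into `S` with source of size at most `d` are
resolved by the classes `setWord A`. -/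
lemma exists_resolution (d : ℕ) : ∃ n : ℕ, ∀ S : FI, n ≤ S.card →
    ∃ β : ∀ (A : Finset S.carrier) (T : FI), WordGroup A.card T →+ InjGroup S T,
      (∀ A, InjNaturalLE d (β A)) ∧ ∀ {T : FI} (g : T ⟶ S), T.card ≤ d →
        ∑ A, β A T (res A.card g (setWord A)) = Finsupp.single g 1 := by
  obtain ⟨n, hn⟩ := exists_partial_resolution d (d + 1) le_rfl
  refine ⟨n, fun S hS => ?_⟩
  obtain ⟨β, h1, -, -, h2⟩ := hn S hS
  exact ⟨β, h1, fun g hg => h2 g (Nat.lt_succ_of_le hg)⟩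

end FI

/-! ### Products of differences -/

section Lists

variable {α : Type*}

/-- Prepend an entry. -/
noncomputable def consAt (a : α) : (List α →₀ ℤ) →+ (List α →₀ ℤ) :=
  Finsupp.mapDomain.addMonoidHom (List.cons a)

lemma exists_of_mem_support_consAt {a : α} {x : List α →₀ ℤ} {l : List α}
    (h : l ∈ (consAt a x).support) : ∃ m ∈ x.support, a :: m = l := by
  classical
  exact Finset.mem_image.1 (Finsupp.mapDomain_support h)

lemma face_zero_consAt (a : α) (x : List α →₀ ℤ) : face 0 (consAt a x) = x := by
  simp only [face, consAt, Finsupp.mapDomain.addMonoidHom_apply, ← Finsupp.mapDomain_comp]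
  exact Finsupp.mapDomain_id

lemma face_succ_consAt (i : ℕ) (a : α) (x : List α →₀ ℤ) :
    face (i + 1) (consAt a x) = consAt a (face i x) := by
  simp only [face, consAt, Finsupp.mapDomain.addMonoidHom_apply, ← Finsupp.mapDomain_comp]
  rfl

/-- The product of the differences `a - b`, for the entries `(a, b)` of a list. -/
noncomputable def diffs : List (α × α) → (List α →₀ ℤ)
  | [] => Finsupp.single [] 1
  | p :: L => consAt p.1 (diffs L) - consAt p.2 (diffs L)

/-- Deleting the i-th entry identifies the two terms of the i-th factor, which have opposite signs.
-/
lemma face_diffs (L : List (α × α)) : ∀ i < L.length, face i (diffs L) = 0 := by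
  induction L with
  | nil => simp
  | cons p L ih =>
    intro i hi
    rw [diffs, map_sub]
    cases i with
    | zero => rw [face_zero_consAt, face_zero_consAt, sub_self]
    | succ i => rw [face_succ_consAt, face_succ_consAt, ih i (by simpa using hi), map_zero,
        map_zero, sub_zero]

/-- The list of all the entries of a list of pairs. -/
def entries : List (α × α) → List α
  | [] => []
  | p :: L => p.1 :: p.2 :: entries L

lemma map_fst_subset_entries (L : List (α × α)) : ∀ x ∈ L.map Prod.fst, x ∈ entries L := by
  induction L with
  | nil => simp
  | cons p L ih =>
    intro x hx
    rcases List.mem_cons.1 hx with rfl | hx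
    · simp [entries]
    · simp [entries, ih x hx]

lemma nodup_map_fst (L : List (α × α)) (hL : (entries L).Nodup) : (L.map Prod.fst).Nodup := by
  induction L with
  | nil => simp
  | cons p L ih =>
    simp only [entries, List.nodup_cons, List.mem_cons, not_or] at hL
    exact List.nodup_cons.2 ⟨fun h => hL.1.2 (map_fst_subset_entries L _ h), ih hL.2.2⟩

lemma mem_support_diffs (L : List (α × α)) (hL : (entries L).Nodup) :
    ∀ l ∈ (diffs L).support, (l.Nodup ∧ l.length = L.length) ∧ ∀ x ∈ l, x ∈ entries L := by
  classical
  induction L with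
  | nil =>
    intro l hl
    rw [Finset.mem_singleton.1 (Finsupp.support_single_subset hl)]
    simp
  | cons p L ih =>
    intro l hl
    simp only [entries, List.nodup_cons, List.mem_cons, not_or] at hL
    have : ∃ x, (x = p.1 ∨ x = p.2) ∧ ∃ m ∈ (diffs L).support, x :: m = l := by
      rcases Finset.mem_union.1 (Finsupp.support_sub hl) with h | h
      · exact ⟨p.1, Or.inl rfl, exists_of_mem_support_consAt h⟩
      · exact ⟨p.2, Or.inr rfl, exists_of_mem_support_consAt h⟩
    obtain ⟨x, hx, m, hm, rfl⟩ := this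
    obtain ⟨⟨h1, h2⟩, h3⟩ := ih hL.2.2 m hm
    refine ⟨⟨List.nodup_cons.2 ⟨fun h => ?_, h1⟩, by simp [h2]⟩, fun y hy => ?_⟩
    · rcases hx with rfl | rfl
      exacts [hL.1.2 (h3 _ h), hL.2.1 (h3 _ h)]
    · rcases List.mem_cons.1 hy with rfl | hy
      · rcases hx with rfl | rfl <;> simp [entries]
      · simp [entries, h3 y hy]

/-- Every term other than the leading one chooses the second entry of some pair. As all entries are
distinct, it misses the first entry of that pair. -/
lemma diffs_eq (L : List (α × α)) (hL : (entries L).Nodup) :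
    ∃ r : List α →₀ ℤ, diffs L = Finsupp.single (L.map Prod.fst) 1 + r ∧
      (∀ l ∈ r.support, ∃ a ∈ L.map Prod.fst, a ∉ l) := by
  classical
  induction L with
  | nil => exact ⟨0, by simp [diffs], by simp⟩
  | cons p L ih =>
    simp only [entries, List.nodup_cons, List.mem_cons, not_or] at hL
    obtain ⟨r, hr, hr'⟩ := ih hL.2.2
    refine ⟨consAt p.1 r - consAt p.2 (diffs L), ?_, fun l hl => ?_⟩
    · rw [diffs, ← add_sub_assoc]
      congr 1
      rw [hr, map_add]
      congr 1
      simp [consAt, Finsupp.mapDomain_single]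
    · rcases Finset.mem_union.1 (Finsupp.support_sub hl) with h | h
      · obtain ⟨m, hm, rfl⟩ := exists_of_mem_support_consAt h
        obtain ⟨a, ha, ham⟩ := hr' m hm
        refine ⟨a, List.mem_cons_of_mem _ ha, fun h' => ?_⟩
        rcases List.mem_cons.1 h' with rfl | h'
        · exact hL.1.2 (map_fst_subset_entries L _ ha)
        · exact ham h'
      · obtain ⟨m, hm, rfl⟩ := exists_of_mem_support_consAt h
        refine ⟨p.1, List.mem_cons_self, fun h' => ?_⟩
        rcases List.mem_cons.1 h' with h' | h'
        · exact hL.1.1 h'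
        · exact hL.1.2 ((mem_support_diffs L hL.2.2 m hm).2 _ h')

lemma exists_entries_nodup (k : ℕ) {s : List α} (hs : s.Nodup) (h : 2 * k ≤ s.length) :
    ∃ L : List (α × α), L.length = k ∧ (entries L).Nodup ∧ (entries L).length = 2 * k := by
  suffices ∃ L : List (α × α), L.length = k ∧ entries L = s.take (2 * k) by
    obtain ⟨L, h1, h2⟩ := this
    refine ⟨L, h1, ?_, ?_⟩
    · rw [h2]
      exact hs.sublist (List.take_sublist _ _)
    · rw [h2, List.length_take, min_eq_left h]
  clear hs
  induction k generalizing s with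
  | zero => exact ⟨[], rfl, by simp [entries]⟩
  | succ k ih =>
    match s, h with
    | a :: b :: s, h =>
      obtain ⟨L, h1, h2⟩ := ih (s := s) (by simp at h; omega)
      exact ⟨(a, b) :: L, by simp [h1], by simp [entries, h2, Nat.mul_succ]⟩

end Lists

/-! ### Combinations of injections acting on words -/

namespace FI

variable {ℓ k d : ℕ} {S T U : FI}

/-- The action of combinations of injections on words. -/
noncomputable def act (x : WordGroup ℓ S) (T : FI) : InjGroup S T →+ WordGroup ℓ T :=
  evalSum fun g => res ℓ g x

lemma act_single (x : WordGroup ℓ S) (g : T ⟶ S) : act x T (Finsupp.single g 1) = res ℓ g x :=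
  evalSum_single _ _

lemma res_act (x : WordGroup ℓ S) (f : T ⟶ U) (y : InjGroup S U) :
    res ℓ f (act x U y) = act x T (pre S f y) := by
  rw [act, act, pre, Finsupp.mapDomain.addMonoidHom_apply, evalSum_mapDomain, map_evalSum]
  simp only [res_comp, AddMonoidHom.comp_apply]

lemma act_add (x x' : WordGroup ℓ S) (y : InjGroup S T) :
    act (x + x') T y = act x T y + act x' T y := by
  change Finsupp.sum _ _ = Finsupp.sum _ _ + Finsupp.sum _ _
  rw [← Finsupp.sum_add]
  refine Finsupp.sum_congr fun g _ => ?_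
  simp only [LinearMap.coe_smulRight, LinearMap.id_coe, id_eq, map_add, smul_add]

lemma act_map {m : ℕ} (ψ : FJ.of ℓ ⟶ FJ.of m) (x : WordGroup ℓ S) (y : InjGroup S T) :
    wordMap ψ T (act x T y) = act (wordMap ψ S x) T y := by
  rw [act, act, map_evalSum]
  simp only [res_wordMap]

/-- The action on a word of a natural map with values in combinations of injections agrees, in
degrees at most `d`, with a morphism of `FJ`. -/
lemma exists_act {β : ∀ T : FI, WordGroup k T →+ InjGroup S T} (hβ : InjNaturalLE d β)
    (x : WordGroup ℓ S) : ∃ ψ : FJ.of k ⟶ FJ.of ℓ,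
      ∀ T : FI, T.card ≤ d → ∀ y, wordMap ψ T y = act x T (β T y) := by
  obtain ⟨ψ, hψ⟩ := exists_extension (d := d) (φ := fun T => (act x T).comp (β T))
    (fun {T U} f y hU => by
      rw [AddMonoidHom.comp_apply, AddMonoidHom.comp_apply, res_act, hβ f y hU])
  exact ⟨ψ, fun T hT y => by rw [hψ T hT, AddMonoidHom.comp_apply]⟩

/-- For a sufficiently large set `S`, there are a word-combination `e` on `S` and a natural map
`α` such that acting on `e` after `α` is the identity in degree `k`. -/
lemma exists_section (d k : ℕ) (hk : k ≤ d) : ∃ n : ℕ, ∀ S : FI, n ≤ S.card →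
    ∃ (e : WordGroup k S) (α : ∀ T : FI, WordGroup k T →+ InjGroup S T), InjNaturalLE d α ∧
      ∀ T : FI, T.card = k → ∀ y, act e T (α T y) = y := by
  obtain ⟨N, hN⟩ := exists_isChainSeq_avoiding d
  -- Room for k pairs of letters, and for the sequence that is substituted for the second word.
  refine ⟨2 * k + N, fun S hS => ?_⟩
  obtain ⟨q, hq⟩ := exists_enumeration S
  have hqnd : q.Nodup := List.nodup_iff_count_le_one.2 fun s => (hq s).le
  have hqlen : q.length = S.card := by
    rw [FI.card, Nat.card_eq_fintype_card, ← Finset.card_univ, ← List.toFinset_card_of_nodup hqnd]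
    congr 1
    ext s
    simp only [List.mem_toFinset, Finset.mem_univ, iff_true]
    rw [← List.count_pos_iff, hq]
    exact one_pos
  -- The map α substitutes the product of the differences a - b over these pairs, and e has the
  -- letters a as its first word. In degree k only the leading term acts nontrivially on e, because
  -- the other injections miss a distinguished letter.
  obtain ⟨L, rfl, hL, hLc⟩ := exists_entries_nodup k hqnd (by omega)
  have hEc : (entries L).toFinset.card = 2 * L.length := by
    rw [List.toFinset_card_of_nodup hL, hLc]
  obtain ⟨E', c, hdisj, -, hc0, hc, hcE⟩ := hN (entries L).toFinset (by
    rw [hEc, ← Nat.card_eq_fintype_card]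
    exact hS)
  have hsupp := mem_support_diffs L hL
  obtain ⟨r, hr, hr'⟩ := diffs_eq L hL
  set a := L.map Prod.fst with ha
  have hand : a.Nodup := nodup_map_fst L hL
  have hw : IsWord L.length a (a.toFinsetᶜ).toList := by
    refine ⟨by simp [ha], fun x => ?_⟩
    rw [count_toList]
    by_cases h : x ∈ a
    · simp [List.count_eq_one_of_mem hand h, h]
    · simp [List.count_eq_zero_of_not_mem h, h]
  refine ⟨wd L.length a (a.toFinsetᶜ).toList, subst L.length (diffs L) c,
    subst_natural hdisj (fun l hl => (hsupp l hl).1)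
      (fun l hl x hx => List.mem_toFinset.2 ((hsupp l hl).2 x hx)) (face_diffs L) hc hcE,
    fun T hT y => ?_⟩
  have key : (act (wd L.length a (a.toFinsetᶜ).toList) T).comp (subst L.length (diffs L) c T) =
      AddMonoidHom.id _ := by
    refine wordGroup_hom_ext fun u v h => ?_
    have hv : v = [] := List.length_eq_zero_iff.1 (by have := h.length; have := h.1; omega)
    subst hv
    have hu : ∀ t, t ∈ u := fun t => by
      have := h.2 t
      rw [List.count_nil, add_zero] at this
      exact List.count_pos_iff.1 (by omega)
    have hund : u.Nodup := List.nodup_iff_count_le_one.2 fun t => by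
      have := h.2 t
      simp at this
      omega
    rw [AddMonoidHom.comp_apply, subst, desc_wd _ h, AddMonoidHom.id_apply, List.length_nil, hc0]
    simp only [evalSum_single, List.zip_nil_left, List.append_nil]
    rw [hr, map_add, evalSum_single, map_add]
    have hane : u.length = a.length := by rw [h.1, ha, List.length_map]
    have h1 : act (wd L.length a (a.toFinsetᶜ).toList) T (glue (u.zip a)) = wd L.length u [] := by
      obtain ⟨g, hg⟩ := exists_isGraph_zip hund hu hand hane
      have hag : u.map (toEmb g) = a := by
        refine List.ext_getElem (by rw [List.length_map, hane]) fun i h1 h2 => ?_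
        rw [List.getElem_map]
        refine (hg _ _).1 (List.mem_iff_getElem.2 ⟨i, ?_, List.getElem_zip⟩)
        rw [List.length_zip, ← hane, min_self]
        simpa using h1
      rw [hg.glue_eq, act_single, res_wd _ hw]
      congr 1
      · rw [← hag, pull_map]
      · rw [List.eq_nil_iff_forall_not_mem]
        intro t ht
        rw [mem_pull, Finset.mem_toList, Finset.mem_compl, List.mem_toFinset, ← hag] at ht
        exact ht (List.mem_map_of_mem (hu t))
    have h2 : act (wd L.length a (a.toFinsetᶜ).toList) T
        (evalSum (fun l => glue (u.zip l)) r) = 0 := by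
      rw [map_evalSum]
      refine (evalSum_congr fun l hl => ?_).trans evalSum_zero
      obtain ⟨x, hx, hxl⟩ := hr' l hl
      unfold glue
      split_ifs with hg
      · rw [act_single, res_wd _ hw, wd_of_length_ne]
        intro hlen
        have := map_pull_of_length_eq _ (hlen.trans hw.1.symm)
        rw [← this, List.mem_map] at hx
        obtain ⟨t, _, rfl⟩ := hx
        exact hxl (List.of_mem_zip ((hg.choose_spec t _).2 rfl)).2
      · rw [map_zero]
    rw [h1, h2, add_zero]
  exact DFunLike.congr_fun key y

end FI

/-! ### Tensors indexed by arbitrary finite sets -/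

namespace FI

lemma res_res {ℓ : ℕ} {S T U : FI} (f : S ⟶ T) (g : T ⟶ U) (x : WordGroup ℓ U) :
    res ℓ f (res ℓ g x) = res ℓ (f ≫ g) x := by
  rw [res_comp, AddMonoidHom.comp_apply]

/-- A finite set is in bijection with a standard one. -/
noncomputable def toStd (S : FI) : S ⟶ std S.card := (Finite.equivFin S.carrier).toEmbedding

/-- A finite set is in bijection with a standard one. -/
noncomputable def ofStd (S : FI) : std S.card ⟶ S := (Finite.equivFin S.carrier).symm.toEmbedding

@[simp] lemma toStd_ofStd (S : FI) : toStd S ≫ ofStd S = 𝟙 S :=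
  DFunLike.ext (F := S.carrier ↪ S.carrier) _ _ (Finite.equivFin S.carrier).symm_apply_apply

@[simp] lemma card_std (n : ℕ) : (std n).card = n := by
  change Nat.card (Fin n) = n
  simp

end FI

namespace FIMod

variable {R : Type u} [CommRing R] {M M' : FIMod R} {k ℓ : ℕ} {S T : FI}

lemma map_map_apply {U : FI} (f : S ⟶ T) (g : T ⟶ U) (m : M.obj S) :
    M.map g (M.map f m) = M.map (f ≫ g) m := by
  rw [Functor.map_comp]
  rfl

lemma map_id_apply' (m : M.obj S) : M.map (𝟙 S) m = m := by
  rw [CategoryTheory.Functor.map_id]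
  rfl

lemma app_map (g : M ⟶ M') (f : S ⟶ T) (m : M.obj S) :
    g.app T (M.map f m) = M'.map f (g.app S m) :=
  NatTrans.naturality_apply g f m

/-- The pure tensors in the standard degree `n`, in terms of words. -/
noncomputable def tensStd (M : FIMod R) (ℓ n : ℕ) :
    M.obj (std n) →ₗ[R] (WordGroup ℓ (std n) →+ FITensor M (Xi ℓ)) where
  toFun m :=
    { toFun := fun x => FITensor.tmul M (Xi ℓ) n m ((xiEquiv ℓ (std n)).symm x)
      map_zero' := by
        rw [map_zero, FITensor.tmul, TensorSum.tmul, TensorProduct.tmul_zero, map_zero]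
        rfl
      map_add' := fun x y => by
        rw [map_add, FITensor.tmul, TensorSum.tmul, TensorProduct.tmul_add, map_add]
        rfl }
  map_add' m m' := by
    refine AddMonoidHom.ext fun x => ?_
    change FITensor.tmul M (Xi ℓ) n (m + m') ((xiEquiv ℓ (std n)).symm x) =
      FITensor.tmul M (Xi ℓ) n m ((xiEquiv ℓ (std n)).symm x) +
        FITensor.tmul M (Xi ℓ) n m' ((xiEquiv ℓ (std n)).symm x)
    rw [FITensor.tmul, TensorSum.tmul, TensorProduct.add_tmul, map_add]
    rfl
  map_smul' r m := by
    refine AddMonoidHom.ext fun x => ?_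
    change FITensor.tmul M (Xi ℓ) n (r • m) ((xiEquiv ℓ (std n)).symm x) =
      r • FITensor.tmul M (Xi ℓ) n m ((xiEquiv ℓ (std n)).symm x)
    rw [FITensor.tmul, TensorSum.tmul, ← TensorProduct.smul_tmul', map_smul]
    rfl

lemma tensStd_map {m n : ℕ} (f : std m ⟶ std n) (a : M.obj (std m))
    (x : WordGroup ℓ (std n)) : tensStd M ℓ n (M.map f a) x = tensStd M ℓ m a (res ℓ f x) := by
  have h := (Submodule.Quotient.eq (tensorRelations M (Xi ℓ))).2
    (Submodule.subset_span ⟨m, n, f, a, (xiEquiv ℓ (std n)).symm x, rfl⟩)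
  refine h.trans (congrArg (FITensor.tmul M (Xi ℓ) m a) ?_)
  refine (xiEquiv ℓ (std m)).injective ?_
  rw [xiEquiv_map, AddEquiv.apply_symm_apply, AddEquiv.apply_symm_apply]

/-- The pure tensors in degree `S`, in terms of words. -/
noncomputable def tens (M : FIMod R) (ℓ : ℕ) (S : FI) :
    M.obj S →ₗ[R] (WordGroup ℓ S →+ FITensor M (Xi ℓ)) where
  toFun m := (tensStd M ℓ S.card (M.map (toStd S) m)).comp (res ℓ (ofStd S))
  map_add' m m' := by
    rw [map_add, map_add]
    rfl
  map_smul' r m := by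
    rw [map_smul, map_smul]
    rfl

lemma tens_apply (m : M.obj S) (x : WordGroup ℓ S) :
    tens M ℓ S m x = tensStd M ℓ S.card (M.map (toStd S) m) (res ℓ (ofStd S) x) := rfl

lemma tens_std (n : ℕ) (m : M.obj (std n)) (x : WordGroup ℓ (std n)) :
    tens M ℓ (std n) m x = tensStd M ℓ n m x := by
  rw [tens_apply, tensStd_map (M := M) (m := n) (n := (std n).card) (toStd (std n)),
    res_res, toStd_ofStd, res_id, AddMonoidHom.id_apply]

lemma tens_map (f : S ⟶ T) (m : M.obj S) (x : WordGroup ℓ T) :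
    tens M ℓ T (M.map f m) x = tens M ℓ S m (res ℓ f x) := by
  rw [tens_apply, tens_apply, map_map_apply]
  have h1 : f ≫ toStd T = toStd S ≫ (ofStd S ≫ f ≫ toStd T) := by
    rw [← Category.assoc, toStd_ofStd, Category.id_comp]
  rw [h1, ← map_map_apply, tensStd_map, res_res, res_res]
  congr 3
  simp

lemma tmul_eq_tens (n : ℕ) (m : M.obj (std n)) (b : (Xi ℓ).obj (op (std n))) :
    FITensor.tmul M (Xi ℓ) n m b = tens M ℓ (std n) m (xiEquiv ℓ (std n) b) := by
  rw [tens_std]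
  exact congrArg _ ((xiEquiv ℓ (std n)).symm_apply_apply b).symm

lemma tens_ext {P : Type*} [AddCommGroup P] [Module R P] {f g : FITensor M (Xi ℓ) →ₗ[R] P}
    (h : ∀ S m x, f (tens M ℓ S m x) = g (tens M ℓ S m x)) : f = g :=
  FITensor.hom_ext fun n a b => by rw [tmul_eq_tens, h]

lemma tens_induction {P : FITensor M (Xi ℓ) → Prop} (z : FITensor M (Xi ℓ))
    (htens : ∀ S m x, P (tens M ℓ S m x)) (h0 : P 0) (hadd : ∀ a b, P a → P b → P (a + b)) :
    P z := by
  obtain ⟨z, rfl⟩ := Submodule.Quotient.mk_surjective _ z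
  induction z using DirectSum.induction_on with
  | zero => exact h0
  | add a b ha hb => exact hadd _ _ ha hb
  | of n z =>
    induction z using TensorProduct.induction_on with
    | zero => rw [map_zero]; exact h0
    | add a b ha hb => rw [map_add]; exact hadd _ _ ha hb
    | tmul a b =>
      have := htens (std n) a (xiEquiv ℓ (std n) b)
      rwa [← tmul_eq_tens] at this

/-- A compatible family of pairings defines a map on the functor tensor product. -/
lemma exists_lift {P : Type*} [AddCommGroup P] [Module R P]
    (h : ∀ S : FI, M.obj S →ₗ[R] (WordGroup ℓ S →+ P))
    (hh : ∀ {S T : FI} (f : S ⟶ T) m x, h T (M.map f m) x = h S m (res ℓ f x)) :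
    ∃ L : FITensor M (Xi ℓ) →ₗ[R] P, ∀ S m x, L (tens M ℓ S m x) = h S m x := by
  let L₀ : TensorSum M (Xi ℓ) →ₗ[R] P := DirectSum.toModule R ℕ P fun n =>
    TensorProduct.AlgebraTensorModule.lift
      { toFun := fun m => ((h (std n) m).comp (xiEquiv ℓ (std n)).toAddMonoidHom).toIntLinearMap
        map_add' := fun m m' => by
          refine LinearMap.ext fun x => ?_
          exact DFunLike.congr_fun (map_add (h (std n)) m m') _
        map_smul' := fun r m => by
          refine LinearMap.ext fun x => ?_
          exact DFunLike.congr_fun (map_smul (h (std n)) r m) _ }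
  have hL₀ : ∀ n m b, L₀ (TensorSum.tmul M (Xi ℓ) n m b) =
      h (std n) m (xiEquiv ℓ (std n) b) := fun n m b => by
    simp only [L₀, TensorSum.tmul, DirectSum.toModule_lof]
    rfl
  refine ⟨Submodule.liftQ _ L₀ ?_, fun S m x => ?_⟩
  · rw [tensorRelations, Submodule.span_le]
    rintro _ ⟨m, n, f, a, b, rfl⟩
    rw [SetLike.mem_coe, LinearMap.mem_ker, map_sub, hL₀, hL₀, xiEquiv_map, sub_eq_zero]
    exact hh f a _
  · have h1 : ∀ n m x, Submodule.liftQ _ L₀ (by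
        rw [tensorRelations, Submodule.span_le]
        rintro _ ⟨m, n, f, a, b, rfl⟩
        rw [SetLike.mem_coe, LinearMap.mem_ker, map_sub, hL₀, hL₀, xiEquiv_map, sub_eq_zero]
        exact hh f a _) (tensStd M ℓ n m x) = h (std n) m x := fun n m x => by
      refine (hL₀ n m _).trans ?_
      rw [AddEquiv.apply_symm_apply]
    rw [tens_apply, h1, ← hh]
    refine DFunLike.congr_fun (congrArg (h S) ?_) x
    rw [map_map_apply, toStd_ofStd, map_id_apply']

lemma tensorXi_map_app (g : M ⟶ M') (m : M.obj S) (x : WordGroup ℓ S) :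
    ((tensorXi R).map g).app (FJ.of ℓ) (tens M ℓ S m x) = tens M' ℓ S (g.app S m) x := by
  rw [tens_apply, tens_apply, ← app_map]
  exact FITensor.map_tmul g (𝟙 (Xi ℓ)) _ _ _

lemma tensorXi_obj_map (ψ : FJ.of k ⟶ FJ.of ℓ) (m : M.obj S) (x : WordGroup k S) :
    ((tensorXi R).obj M).map ψ (tens M k S m x) = tens M ℓ S m (wordMap ψ S x) := by
  rw [tens_apply, tens_apply, res_wordMap]
  refine (FITensor.map_tmul (𝟙 M) ψ.hom _ _ _).trans ?_
  refine congrArg (FITensor.tmul M (Xi ℓ) S.card (M.map (toStd S) m)) ?_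
  refine (xiEquiv ℓ (std S.card)).injective ?_
  rw [xiEquiv_app, AddEquiv.apply_symm_apply, AddEquiv.apply_symm_apply]

end FIMod

/-! ### Exactness of the functor tensor product -/

namespace FIMod

variable {R : Type u} [CommRing R] {A B C M M' : FIMod R} {k ℓ : ℕ} {S T : FI}

/-- The map on functor tensor products induced by a morphism of `FI`-modules. -/
noncomputable abbrev tensMap (g : M ⟶ M') (ℓ : ℕ) :
    FITensor M (Xi ℓ) →ₗ[R] FITensor M' (Xi ℓ) := FITensor.map g (𝟙 (Xi ℓ))

lemma tensMap_tens (g : M ⟶ M') (m : M.obj S) (x : WordGroup ℓ S) :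
    tensMap g ℓ (tens M ℓ S m x) = tens M' ℓ S (g.app S m) x :=
  tensorXi_map_app g m x

/-- Since appended letters are removed by restriction, every tensor can be moved to a set with at
least n elements. Hence M ⊗ Ξ(ℓ) only depends on M on large sets. -/
lemma tens_append (n : ℕ) (m : M.obj S) (x : WordGroup ℓ S) :
    tens M ℓ (addStd S n) (M.map (addStdι S n) m) (append ℓ (addStdι S n) (stdList S n) x) =
      tens M ℓ S m x := by
  rw [tens_map, res_append_self (isCompl_stdList S n)]

lemma exists_factor {X Y Z : Type*} [AddCommGroup X] [AddCommGroup Y] [AddCommGroup Z] [Module R X]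
    [Module R Y] [Module R Z] (p : X →ₗ[R] Y) (hp : Function.Surjective p) (φ : X →ₗ[R] Z)
    (h : ∀ x, p x = 0 → φ x = 0) : ∃ ψ : Y →ₗ[R] Z, ∀ x, ψ (p x) = φ x := by
  refine ⟨(Submodule.liftQ (LinearMap.ker p) φ fun x hx => h x hx).comp
    (p.quotKerEquivOfSurjective hp).symm.toLinearMap, fun x => ?_⟩
  have : (p.quotKerEquivOfSurjective hp).symm (p x) = Submodule.Quotient.mk x := by
    rw [LinearEquiv.symm_apply_eq]
    rfl
  rw [LinearMap.comp_apply, LinearEquiv.coe_coe, this]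
  rfl

/-- Postcomposition of additive maps with a linear map. -/
def compLeft (W : Type*) [AddCommGroup W] {P Q : Type*} [AddCommGroup P] [AddCommGroup Q]
    [Module R P] [Module R Q] (f : P →ₗ[R] Q) : (W →+ P) →ₗ[R] (W →+ Q) where
  toFun g := f.toAddMonoidHom.comp g
  map_add' _ _ := AddMonoidHom.ext fun _ => map_add f _ _
  map_smul' _ _ := AddMonoidHom.ext fun _ => map_smul f _ _

lemma tensMap_surjective {p : B ⟶ C} (n : ℕ)
    (hp : ∀ S : FI, n ≤ S.card → Function.Surjective (p.app S)) (ℓ : ℕ) :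
    Function.Surjective (tensMap p ℓ) := by
  intro z
  refine tens_induction (P := fun z => ∃ y, tensMap p ℓ y = z) z (fun S m x => ?_)
    ⟨0, map_zero _⟩ ?_
  · obtain ⟨b, hb⟩ := hp (addStd S n) (by rw [card_addStd]; omega) (C.map (addStdι S n) m)
    refine ⟨tens B ℓ (addStd S n) b (append ℓ (addStdι S n) (stdList S n) x), ?_⟩
    rw [tensMap_tens, hb, tens_append]
  · rintro a b ⟨y, rfl⟩ ⟨y', rfl⟩
    exact ⟨y + y', map_add _ _ _⟩

/-- A left inverse is constructed from C ⊗ Ξ(ℓ) to the cokernel of `tensMap r ℓ`: move a tensor to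
`addStd S n`, where p is surjective, lift it, and observe that exactness makes the lift unique
modulo the image of r. Compatibility with injections is `res_addStdMap_append`. -/
lemma tensMap_exact {r : A ⟶ B} {p : B ⟶ C} (n : ℕ)
    (h : ∀ S : FI, n ≤ S.card → Function.Exact (r.app S) (p.app S) ∧
      Function.Surjective (p.app S)) (ℓ : ℕ) :
    Function.Exact (tensMap r ℓ) (tensMap p ℓ) := by
  have hcard : ∀ S : FI, n ≤ (addStd S n).card := fun S => by rw [card_addStd]; omega
  set Q := LinearMap.range (tensMap r ℓ) with hQ
  have hfac : ∀ S : FI, ∃ ψ : C.obj (addStd S n) →ₗ[R]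
      (WordGroup ℓ (addStd S n) →+ FITensor B (Xi ℓ) ⧸ Q), ∀ b x,
        ψ (p.app (addStd S n) b) x = Q.mkQ (tens B ℓ (addStd S n) b x) := by
    intro S
    obtain ⟨ψ, hψ⟩ := exists_factor (p.app (addStd S n)).hom (h _ (hcard S)).2
      ((compLeft (WordGroup ℓ (addStd S n)) Q.mkQ).comp (tens B ℓ (addStd S n))) (fun b hb => by
        obtain ⟨a, rfl⟩ := ((h _ (hcard S)).1 b).1 hb
        refine AddMonoidHom.ext fun x => ?_
        refine (Submodule.Quotient.mk_eq_zero Q).2 ⟨tens A ℓ _ a x, ?_⟩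
        exact tensMap_tens r a x)
    exact ⟨ψ, fun b x => DFunLike.congr_fun (hψ b) x⟩
  choose ψ hψ using hfac
  obtain ⟨L, hL⟩ := exists_lift (M := C) (ℓ := ℓ) (P := FITensor B (Xi ℓ) ⧸ Q)
    (fun S =>
      { toFun := fun c => (ψ S (C.map (addStdι S n) c)).comp
          (append ℓ (addStdι S n) (stdList S n))
        map_add' := fun c c' => by
          rw [map_add, map_add]
          rfl
        map_smul' := fun r c => by
          rw [map_smul, map_smul]
          rfl })
    (fun {S T} f c x => by
      change ψ T (C.map (addStdι T n) (C.map f c)) (append ℓ (addStdι T n) (stdList T n) x) =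
        ψ S (C.map (addStdι S n) c) (append ℓ (addStdι S n) (stdList S n) (res ℓ f x))
      obtain ⟨b, hb⟩ := (h _ (hcard S)).2 (C.map (addStdι S n) c)
      rw [map_map_apply, ← addStdι_naturality, ← map_map_apply, ← hb, ← app_map, hψ, hψ, tens_map,
        res_addStdMap_append])
  have key : L.comp (tensMap p ℓ) = Q.mkQ := by
    refine tens_ext fun S b x => ?_
    rw [LinearMap.comp_apply, tensMap_tens, hL]
    change ψ S (C.map (addStdι S n) (p.app S b)) (append ℓ (addStdι S n) (stdList S n) x) = _
    rw [← app_map, hψ, tens_append]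
  intro y
  constructor
  · intro hy
    have h1 : Q.mkQ y = 0 := by rw [← key, LinearMap.comp_apply, hy, map_zero]
    exact (Submodule.Quotient.mk_eq_zero Q).1 h1
  · rintro ⟨z, rfl⟩
    refine tens_induction (P := fun z => tensMap p ℓ (tensMap r ℓ z) = 0) z (fun S a x => ?_)
      (by rw [map_zero, map_zero]) ?_
    · rw [← tens_append n, tensMap_tens, tensMap_tens,
        ((h _ (hcard S)).1 _).2 ⟨_, rfl⟩, map_zero, AddMonoidHom.zero_apply]
    · intro a b ha hb
      rw [map_add, map_add, ha, hb, add_zero]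

lemma tensMap_bijective {p : B ⟶ C} (n : ℕ)
    (h : ∀ S : FI, n ≤ S.card → Function.Bijective (p.app S)) (ℓ : ℕ) :
    Function.Bijective (tensMap p ℓ) := by
  have h0 : ∀ S : FI, n ≤ S.card → Function.Exact ((0 : B ⟶ B).app S) (p.app S) ∧
      Function.Surjective (p.app S) := fun S hS => by
    refine ⟨fun b => ⟨fun hb => ⟨0, ?_⟩, ?_⟩, (h S hS).2⟩
    · rw [map_zero]
      exact ((h S hS).1 (hb.trans (map_zero _).symm)).symm
    · rintro ⟨b, rfl⟩
      exact map_zero _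
  refine ⟨(injective_iff_map_eq_zero _).2 fun y hy => ?_,
    tensMap_surjective n (fun S hS => (h S hS).2) ℓ⟩
  obtain ⟨z, rfl⟩ := (tensMap_exact n h0 ℓ y).1 hy
  refine tens_induction (P := fun z => tensMap (0 : B ⟶ B) ℓ z = 0) z (fun S a x => ?_)
    (map_zero _) fun a b ha hb => by rw [map_add, ha, hb, add_zero]
  rw [tensMap_tens]
  exact DFunLike.congr_fun (map_zero (tens B ℓ S)) x

/-! ### Free modules -/

variable {ι : Type u} {deg : ι → ℕ}

/-- The generators of a free `FI`-module. -/
noncomputable def gen (deg : ι → ℕ) (i : ι) : (free R deg).obj (std (deg i)) :=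
  Finsupp.single ⟨i, 𝟙 _⟩ 1

lemma free_map_single (f : S ⟶ T) (i : ι) (g : std (deg i) ⟶ S) (c : R) :
    (free R deg).map f (Finsupp.single ⟨i, g⟩ c : (Σ i, (std (deg i) ⟶ S)) →₀ R) =
      (Finsupp.single ⟨i, g ≫ f⟩ c : (Σ i, (std (deg i) ⟶ T)) →₀ R) :=
  Finsupp.mapDomain_single

lemma map_gen (i : ι) (g : std (deg i) ⟶ S) :
    (free R deg).map g (gen deg i) = (Finsupp.single ⟨i, g⟩ 1 : (Σ i, (std (deg i) ⟶ S)) →₀ R) :=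
  free_map_single g i (𝟙 _) 1

lemma free_induction {P : (free R deg).obj S → Prop} (y : (free R deg).obj S)
    (h0 : P 0) (hadd : ∀ a b, P a → P b → P (a + b))
    (hsingle : ∀ (i : ι) (g : std (deg i) ⟶ S) (c : R), P (c • (free R deg).map g (gen deg i))) :
    P y := by
  refine Finsupp.induction_linear (motive := P) y h0 hadd ?_
  rintro ⟨i, g⟩ c
  have := hsingle i g c
  rw [map_gen] at this
  have h2 : c • (Finsupp.single ⟨i, g⟩ 1 : (Σ i, (std (deg i) ⟶ S)) →₀ R) =
      Finsupp.single ⟨i, g⟩ c := by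
    rw [Finsupp.smul_single, smul_eq_mul, mul_one]
  rw [← h2]
  exact this

/-- The morphism from a free module with given values at the generators. -/
noncomputable def freeLift (deg : ι → ℕ) (a : ∀ i, M.obj (std (deg i))) : free R deg ⟶ M where
  app S := ModuleCat.ofHom
    (Finsupp.linearCombination R fun p : Σ i, (std (deg i) ⟶ S) => M.map p.2 (a p.1))
  naturality S T f := by
    refine ModuleCat.hom_ext (Finsupp.lhom_ext fun p c => ?_)
    have h1 : (Finsupp.linearCombination R fun p : Σ i, (std (deg i) ⟶ T) => M.map p.2 (a p.1))
        (Finsupp.single ⟨p.1, p.2 ≫ f⟩ c) = M.map f ((Finsupp.linearCombination R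
          fun p : Σ i, (std (deg i) ⟶ S) => M.map p.2 (a p.1)) (Finsupp.single p c)) := by
      rw [Finsupp.linearCombination_single, Finsupp.linearCombination_single, map_smul,
        map_map_apply]
    refine Eq.trans ?_ h1
    exact congrArg (Finsupp.linearCombination R fun p : Σ i, (std (deg i) ⟶ T) =>
      M.map p.2 (a p.1)) (free_map_single (deg := deg) f p.1 p.2 c)

lemma freeLift_gen (deg : ι → ℕ) (a : ∀ i, M.obj (std (deg i))) (i : ι) :
    (freeLift deg a).app _ (gen deg i) = a i := by
  refine (Finsupp.linearCombination_single R _ _).trans ?_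
  rw [one_smul, map_id_apply']

lemma free_hom_ext {f g : free R deg ⟶ M} (h : ∀ i, f.app _ (gen deg i) = g.app _ (gen deg i)) :
    f = g := by
  refine NatTrans.ext (funext fun S => ModuleCat.hom_ext (LinearMap.ext fun y => ?_))
  refine free_induction (P := fun y => f.app S y = g.app S y) y (by rw [map_zero, map_zero])
    (fun a b ha hb => by rw [map_add, map_add, ha, hb]) fun i k c => ?_
  rw [map_smul, map_smul, app_map, app_map, h]

lemma _root_.FI.wordGroup_eq_zero (h : S.card < ℓ) (x : WordGroup ℓ S) : x = 0 := by
  have : IsEmpty (Word ℓ S) := ⟨fun w => by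
    have h1 := w.isWord.length
    have h2 := w.isWord.1
    omega⟩
  exact Subsingleton.elim _ _

/-- A tensor can be moved to the degree of a generator, which is less than ℓ, and Ξ(ℓ) vanishes
there. -/
lemma tens_eq_zero_of_free {d : ℕ} (hdeg : ∀ i, deg i ≤ d) {p : free R deg ⟶ M}
    (hp : ∀ S, Function.Surjective (p.app S)) {ℓ : ℕ} (hℓ : d < ℓ) (z : FITensor M (Xi ℓ)) :
    z = 0 := by
  refine tens_induction (P := fun z => z = 0) z (fun S m x => ?_) rfl
    fun a b ha hb => by rw [ha, hb, add_zero]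
  obtain ⟨y, rfl⟩ := hp S m
  refine free_induction (P := fun y => tens M ℓ S (p.app S y) x = 0) y
    (by rw [map_zero, map_zero]; rfl) (fun a b ha hb => ?_) fun i g c => ?_
  · rw [map_add, map_add, AddMonoidHom.add_apply, ha, hb, add_zero]
  · have := hdeg i
    rw [map_smul, app_map, map_smul, AddMonoidHom.smul_apply, tens_map,
      wordGroup_eq_zero (by rw [card_std]; omega) (res ℓ g x), map_zero, smul_zero]

end FIMod

/-! ### The right adjoint -/

namespace FJFunctor

variable {R : Type u} [CommRing R] {N N' : FJFunctor R} {k ℓ : ℕ} {S T : FI}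

/-- The families of additive maps `Ξ(ℓ)_S → N_ℓ` that are natural in `ℓ`. -/
def families (N : FJFunctor R) (S : FI) :
    Submodule R (∀ ℓ : ℕ, WordGroup ℓ S →+ N.obj (FJ.of ℓ)) where
  carrier := {θ | ∀ (k ℓ : ℕ) (ψ : FJ.of k ⟶ FJ.of ℓ) (x : WordGroup k S),
    N.map ψ (θ k x) = θ ℓ (wordMap ψ S x)}
  zero_mem' _ _ _ _ := map_zero _
  add_mem' {θ θ'} h h' k ℓ ψ x := by
    change N.map ψ (θ k x + θ' k x) = θ ℓ _ + θ' ℓ _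
    rw [map_add, h, h']
  smul_mem' r θ h k ℓ ψ x := by
    change N.map ψ (r • θ k x) = r • θ ℓ _
    rw [map_smul, h]

lemma map_family (θ : families N S) (ψ : FJ.of k ⟶ FJ.of ℓ) (x : WordGroup k S) :
    N.map ψ (θ.1 k x) = θ.1 ℓ (wordMap ψ S x) := θ.2 k ℓ ψ x

lemma family_ext {θ θ' : families N S} (h : ∀ ℓ x, θ.1 ℓ x = θ'.1 ℓ x) : θ = θ' :=
  Subtype.ext (funext fun ℓ => AddMonoidHom.ext (h ℓ))

/-- Restriction of families along an injection. -/
noncomputable def familiesMap (N : FJFunctor R) (f : S ⟶ T) : families N S →ₗ[R] families N T where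
  toFun θ := ⟨fun ℓ => (θ.1 ℓ).comp (res ℓ f), fun k ℓ ψ x => by
    rw [AddMonoidHom.comp_apply, AddMonoidHom.comp_apply, map_family, res_wordMap]⟩
  map_add' _ _ := rfl
  map_smul' _ _ := rfl

/-- The `FI`-module of natural families. -/
noncomputable def toFIMod (N : FJFunctor R) : FIMod R where
  obj S := ModuleCat.of R (families N S)
  map f := ModuleCat.ofHom (familiesMap N f)
  map_id S := by
    refine ModuleCat.hom_ext (LinearMap.ext fun θ => family_ext fun ℓ x => ?_)
    change θ.1 ℓ (res ℓ (𝟙 S) x) = θ.1 ℓ x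
    rw [res_id, AddMonoidHom.id_apply]
  map_comp f g := by
    refine ModuleCat.hom_ext (LinearMap.ext fun θ => family_ext fun ℓ x => ?_)
    change θ.1 ℓ (res ℓ (f ≫ g) x) = θ.1 ℓ (res ℓ f (res ℓ g x))
    rw [res_res]

/-- The map on natural families induced by a natural transformation. -/
noncomputable def familiesComp (q : N ⟶ N') (S : FI) : families N S →ₗ[R] families N' S where
  toFun θ := ⟨fun ℓ => (q.app (FJ.of ℓ)).hom.toAddMonoidHom.comp (θ.1 ℓ), fun k ℓ ψ x => by
    change N'.map ψ (q.app _ (θ.1 k x)) = q.app _ (θ.1 ℓ (wordMap ψ S x))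
    rw [← NatTrans.naturality_apply, map_family]⟩
  map_add' θ θ' := family_ext fun ℓ x => map_add (q.app (FJ.of ℓ)).hom (θ.1 ℓ x) (θ'.1 ℓ x)
  map_smul' r θ := family_ext fun ℓ x => map_smul (q.app (FJ.of ℓ)).hom r (θ.1 ℓ x)

end FJFunctor

open FJFunctor FIMod

section

variable (R : Type u) [CommRing R]

/-- The functor sending a functor on `FJ` to the `FI`-module of natural families. -/
noncomputable def familiesFunctor : FJFunctor R ⥤ FIMod R where
  obj N := toFIMod N
  map q :=
    { app := fun S => ModuleCat.ofHom (familiesComp q S)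
      naturality := fun _ _ _ => rfl }
  map_id _ := rfl
  map_comp _ _ := rfl

variable {R}

/-- The family of tensors with a given element. -/
noncomputable def unitLin (M : FIMod R) (S : FI) :
    M.obj S →ₗ[R] families ((tensorXi R).obj M) S where
  toFun m := ⟨fun ℓ => tens M ℓ S m, fun _ _ ψ x => tensorXi_obj_map ψ m x⟩
  map_add' m m' := family_ext fun ℓ x => DFunLike.congr_fun (map_add (tens M ℓ S) m m') x
  map_smul' r m := family_ext fun ℓ x => DFunLike.congr_fun (map_smul (tens M ℓ S) r m) x

lemma exists_counitLin (N : FJFunctor R) (ℓ : ℕ) :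
    ∃ L : FITensor (toFIMod N) (Xi ℓ) →ₗ[R] N.obj (FJ.of ℓ),
      ∀ (S : FI) (θ : families N S) x, L (tens (toFIMod N) ℓ S θ x) = θ.1 ℓ x :=
  exists_lift (M := toFIMod N)
    (fun S =>
      { toFun := fun θ : families N S => θ.1 ℓ
        map_add' := fun _ _ => rfl
        map_smul' := fun _ _ => rfl })
    (fun _ _ _ => rfl)

/-- Evaluation of natural families. -/
noncomputable def counitLin (N : FJFunctor R) (ℓ : ℕ) :
    FITensor (toFIMod N) (Xi ℓ) →ₗ[R] N.obj (FJ.of ℓ) :=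
  (exists_counitLin N ℓ).choose

lemma counitLin_tens (N : FJFunctor R) (ℓ : ℕ) {S : FI} (θ : families N S) (x : WordGroup ℓ S) :
    counitLin N ℓ (tens (toFIMod N) ℓ S θ x) = θ.1 ℓ x :=
  (exists_counitLin N ℓ).choose_spec S θ x

variable (R)

/-- The unit of the adjunction. -/
noncomputable def tensorXiUnit : 𝟭 (FIMod R) ⟶ tensorXi R ⋙ familiesFunctor R where
  app M :=
    { app := fun S => ModuleCat.ofHom (unitLin M S)
      naturality := fun _ _ f => ModuleCat.hom_ext (LinearMap.ext fun m =>
        family_ext fun _ x => tens_map f m x) }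
  naturality _ _ g := NatTrans.ext (funext fun _ => ModuleCat.hom_ext (LinearMap.ext fun m =>
    family_ext fun _ x => (tensMap_tens g m x).symm))

/-- The counit of the adjunction. -/
noncomputable def tensorXiCounit : familiesFunctor R ⋙ tensorXi R ⟶ 𝟭 (FJFunctor R) where
  app N :=
    { app := fun ℓ => ModuleCat.ofHom (counitLin N ℓ)
      naturality := fun k ℓ ψ => ModuleCat.hom_ext (tens_ext fun S θ x => by
        change counitLin N ℓ (((tensorXi R).obj (toFIMod N)).map ψ (tens (toFIMod N) k S θ x)) =
          N.map ψ (counitLin N k (tens (toFIMod N) k S θ x))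
        refine (congrArg (counitLin N ℓ) (tensorXi_obj_map (M := toFIMod N) ψ θ x)).trans
          ((counitLin_tens N ℓ θ _).trans ?_)
        exact (map_family θ ψ x).symm.trans
          (congrArg (N.map ψ) (counitLin_tens N k θ x).symm)) }
  naturality N N' q := NatTrans.ext (funext fun ℓ => ModuleCat.hom_ext (tens_ext fun S θ x => by
    change counitLin N' ℓ (tensMap ((familiesFunctor R).map q) ℓ (tens (toFIMod N) ℓ S θ x)) =
      q.app ℓ (counitLin N ℓ (tens (toFIMod N) ℓ S θ x))
    refine (congrArg (counitLin N' ℓ)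
      (tensMap_tens (M := toFIMod N) ((familiesFunctor R).map q) θ x)).trans ?_
    exact (counitLin_tens N' ℓ (familiesComp q S θ) x).trans
      (congrArg (q.app ℓ) (counitLin_tens N ℓ θ x).symm)))

/-- The functor tensor product with `Ξ` is left adjoint to the functor of natural families. -/
noncomputable def tensorXiAdjunction : tensorXi R ⊣ familiesFunctor R :=
  Adjunction.mkOfUnitCounit
    { unit := tensorXiUnit R
      counit := tensorXiCounit R
      left_triangle := by
        refine NatTrans.ext (funext fun M => NatTrans.ext (funext fun ℓ => ModuleCat.hom_ext
          (tens_ext fun S m x => ?_)))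
        change counitLin _ ℓ (tensMap ((tensorXiUnit R).app M) ℓ (tens M ℓ S m x)) =
          tens M ℓ S m x
        exact (congrArg (counitLin ((tensorXi R).obj M) ℓ)
          (tensMap_tens ((tensorXiUnit R).app M) m x)).trans
            (counitLin_tens ((tensorXi R).obj M) ℓ (unitLin M S m) x)
      right_triangle := by
        refine NatTrans.ext (funext fun N => NatTrans.ext (funext fun S => ModuleCat.hom_ext
          (LinearMap.ext fun θ => family_ext fun ℓ x => ?_)))
        exact counitLin_tens N ℓ θ x }

end

/-! ### The unit of the adjunction at free modules -/

namespace FI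

variable {ℓ m : ℕ} {S T : FI}

open scoped Classical in
lemma wd_apply (u v : List S.carrier) (p : Word ℓ S) :
    wd ℓ u v p = if p.fst = u ∧ p.snd = v then 1 else 0 := by
  by_cases h : IsWord ℓ u v
  · rw [wd_of_isWord h, Finsupp.single_apply]
    congr 1
    rw [Word.mk.injEq]
    exact propext ⟨fun h => ⟨h.1.symm, h.2.symm⟩, fun h => ⟨h.1.symm, h.2.symm⟩⟩
  · rw [wd, dif_neg h, if_neg]
    · rfl
    · rintro ⟨rfl, rfl⟩
      exact h p.isWord

instance finite_hom (S T : FI) : Finite (S ⟶ T) :=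
  inferInstanceAs (Finite (S.carrier ↪ T.carrier))

lemma card_le_of_hom (f : S ⟶ T) : S.card ≤ T.card :=
  Finite.card_le_of_embedding (toEmb f)

lemma surjective_of_card_le (f : S ⟶ T) (h : T.card ≤ S.card) (t : T.carrier) :
    ∃ s, toEmb f s = t :=
  ((Nat.bijective_iff_injective_and_card _).2 ⟨(toEmb f).injective,
    le_antisymm (card_le_of_hom f) h⟩).2 t

/-- The list of the elements of a standard finite set. -/
def stdEnum (m : ℕ) : List (std m).carrier := List.finRange m

lemma stdEnum_nodup (m : ℕ) : (stdEnum m).Nodup := List.nodup_finRange m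

lemma mem_stdEnum (j : (std m).carrier) : j ∈ stdEnum m := List.mem_finRange j

lemma length_stdEnum (m : ℕ) : (stdEnum m).length = m := List.length_finRange

lemma isWord_stdEnum (m : ℕ) : IsWord m (stdEnum m) [] :=
  ⟨length_stdEnum m, fun t => by
    simpa using List.count_eq_one_of_mem (stdEnum_nodup m) (mem_stdEnum t)⟩

/-- The word of length `m` in the standard set with `m` elements given by the standard order. -/
def idWord (m : ℕ) : Word m (std m) := ⟨stdEnum m, [], isWord_stdEnum m⟩

/-- The values of an injection on a standard finite set. -/
def homList (g : std m ⟶ S) : List S.carrier := (stdEnum m).map (toEmb g)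

lemma length_homList (g : std m ⟶ S) : (homList g).length = m := by
  rw [homList, List.length_map, length_stdEnum]

lemma homList_nodup (g : std m ⟶ S) : (homList g).Nodup :=
  (stdEnum_nodup m).map (toEmb g).injective

lemma homList_injective {g g' : std m ⟶ S} (h : homList g = homList g') : g = g' :=
  DFunLike.ext (F := (std m).carrier ↪ S.carrier) _ _ fun j => by
    exact List.map_inj_left.1 h j (mem_stdEnum j)

lemma homList_comp (g : std m ⟶ S) (f : S ⟶ T) : homList (g ≫ f) = (homList g).map (toEmb f) := by
  rw [homList, homList, List.map_map]
  rfl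

lemma homList_id (m : ℕ) : homList (𝟙 (std m)) = stdEnum m := List.map_id _

lemma exists_homList {u : List S.carrier} (hu : u.Nodup) (hm : u.length = m) :
    ∃ g : std m ⟶ S, homList g = u := by
  subst hm
  exact ⟨(⟨u.get, List.nodup_iff_injective_get.1 hu⟩ : Fin u.length ↪ S.carrier),
    List.map_get_finRange u⟩

/-- The word given by an injection on a standard finite set. -/
noncomputable def homWord (g : std m ⟶ S) : WordGroup m S :=
  wd m (homList g) ((homList g).toFinsetᶜ).toList

lemma isWord_homWord (g : std m ⟶ S) :
    IsWord m (homList g) ((homList g).toFinsetᶜ).toList := by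
  refine ⟨length_homList g, fun x => ?_⟩
  rw [count_toList]
  by_cases h : x ∈ homList g
  · simp [List.count_eq_one_of_mem (homList_nodup g) h, h]
  · simp [List.count_eq_zero_of_not_mem h, h]

-- The classes `homWord g` are dual to the injections under the coefficient at `idWord`.
open scoped Classical in
lemma res_homWord_idWord (f g : std m ⟶ S) :
    res m f (homWord g) (idWord m) = if f = g then 1 else 0 := by
  rw [homWord, res_wd _ (isWord_homWord g), wd_apply]
  congr 1
  refine propext ⟨fun h => homList_injective ?_, ?_⟩
  · have h1 : stdEnum m = pull f (homList g) := h.1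
    have h2 := map_pull_of_length_eq f (l := homList g)
      (by rw [← h1, length_stdEnum, length_homList])
    rwa [← h1] at h2
  · rintro rfl
    refine ⟨(pull_map f _).symm, ?_⟩
    change [] = _
    rw [eq_comm, List.eq_nil_iff_forall_not_mem]
    intro t ht
    rw [mem_pull, Finset.mem_toList, Finset.mem_compl, List.mem_toFinset] at ht
    exact ht (List.mem_map_of_mem (mem_stdEnum t))

/-- The words given by the combinations of bijections with a standard finite set. -/
noncomputable def homWords (m : ℕ) (S : FI) : InjGroup S (std m) →+ WordGroup m S :=
  evalSum fun g => wd m (homList g) []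

lemma isWord_homList (g : std m ⟶ S) (hS : S.card = m) : IsWord m (homList g) [] := by
  refine ⟨length_homList g, fun s => ?_⟩
  obtain ⟨j, rfl⟩ := surjective_of_card_le g (by rw [card_std, hS]) s
  simpa using List.count_eq_one_of_mem (homList_nodup g) (List.mem_map_of_mem (mem_stdEnum j))

lemma IsWord.nodup {u v : List S.carrier} (h : IsWord ℓ u v) : (u ++ v).Nodup :=
  List.nodup_iff_count_le_one.2 fun s => (h.count_append s).le

lemma IsWord.mem {u v : List S.carrier} (h : IsWord ℓ u v) (s : S.carrier) : s ∈ u ++ v :=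
  List.count_pos_iff.1 (by rw [h.count_append]; exact one_pos)

lemma IsGraph.map {U : FI} {g : U ⟶ S} {z : List U.carrier} {w : List S.carrier}
    (h : IsGraph g (z.zip w)) (f : S ⟶ T) : IsGraph (g ≫ f) (z.zip (w.map (toEmb f))) := by
  intro t s
  rw [List.zip_map_right, List.mem_map]
  constructor
  · rintro ⟨⟨a, b⟩, hab, hs⟩
    cases hs
    exact congrArg (toEmb f) ((h a b).1 hab)
  · rintro rfl
    exact ⟨(t, toEmb g t), (h _ _).2 rfl, rfl⟩

/-- For every word `y` in the standard set with `m` elements there is a morphism of `FJ` that maps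
`y`, and no other word, to the standard word. -/
lemma exists_detect (y : Word ℓ (std m)) : ∃ c : FJ.of ℓ ⟶ FJ.of m,
    ∀ x : WordGroup ℓ (std m), wordMap c (std m) x (idWord m) = x y := by
  set z := y.fst ++ y.snd with hz
  have hzl : z.length = m := by
    rw [hz, List.length_append, y.isWord.length, card_std]
  have hgraph : ∀ {S : FI} {u v : List S.carrier}, IsWord ℓ u v → S.card = m →
      ∃ g : std m ⟶ S, IsGraph g (z.zip (u ++ v)) := fun h hS =>
    exists_isGraph_zip y.isWord.nodup y.isWord.mem h.nodup
      (by rw [hzl, List.length_append, h.length, hS])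
  -- In degree m, both y and (u, v) are orderings of m letters; the word (u, v) is sent to the
  -- bijection g that carries the first ordering to the second. The result is the standard word
  -- exactly when g is the identity, that is when (u, v) = y. Only degree m needs checking for
  -- naturality up to m, as Ξ(m) vanishes below; `exists_extension` supplies the other degrees.
  let φ : ∀ S : FI, WordGroup ℓ S →+ WordGroup m S := fun S =>
    desc fun u v => homWords m S (glue (z.zip (u ++ v)))
  have hφ : NaturalLE m φ := by
    intro S T f x hT
    by_cases hS : S.card < m
    · rw [wordGroup_eq_zero hS (res m f _), wordGroup_eq_zero hS (φ S _)]
    refine desc_res f _ (fun u v h => ?_) x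
    have hTS := card_le_of_hom f
    have hsurj := surjective_of_card_le f (by omega)
    have hu : (pull f u).length = u.length := length_pull_eq f fun t _ => hsurj t
    have hv : (pull f v).length = v.length := length_pull_eq f fun t _ => hsurj t
    rw [if_pos (hu.trans h.1)]
    obtain ⟨g, hg⟩ := hgraph (h.pull f (hu.trans h.1)) (by omega)
    have hg' := hg.map f
    rw [List.map_append, map_pull_of_length_eq f hu, map_pull_of_length_eq f hv] at hg'
    rw [hg.glue_eq, hg'.glue_eq, homWords, homWords, evalSum_single, evalSum_single,
      res_wd f (isWord_homList _ (by omega)), homList_comp, pull_map, pull_nil]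
  obtain ⟨c, hc⟩ := exists_extension hφ
  refine ⟨c, fun x => ?_⟩
  rw [hc _ (card_std m).le]
  suffices ((Finsupp.applyAddHom (idWord m)).comp (φ (std m)) : WordGroup ℓ (std m) →+ ℤ) =
      Finsupp.applyAddHom y from DFunLike.congr_fun this x
  refine wordGroup_hom_ext fun u v h => ?_
  classical
  obtain ⟨g, hg⟩ := hgraph h (card_std m)
  simp only [AddMonoidHom.comp_apply, φ, Finsupp.applyAddHom_apply]
  rw [desc_wd _ h, hg.glue_eq, homWords, evalSum_single, wd_apply, wd_apply]
  congr 1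
  have huv : z.map (toEmb g) = u ++ v := by
    refine List.ext_getElem (by rw [List.length_map, hzl, List.length_append, h.length, card_std])
      fun i h1 h2 => ?_
    rw [List.getElem_map]
    refine (hg _ _).1 (List.mem_iff_getElem.2 ⟨i, ?_, List.getElem_zip⟩)
    rw [List.length_map] at h1
    rw [List.length_zip]
    exact lt_min h1 h2
  refine propext ⟨fun h' => ?_, ?_⟩
  · have : 𝟙 (std m) = g := homList_injective ((homList_id m).trans h'.1)
    rw [← this] at huv
    have h2 : z = u ++ v := (List.map_id z).symm.trans huv
    exact List.append_inj h2 (y.isWord.1.trans h.1.symm)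
  · rintro ⟨rfl, rfl⟩
    refine ⟨?_, rfl⟩
    have : 𝟙 (std m) = g := DFunLike.ext (F := (std m).carrier ↪ (std m).carrier) _ _ fun j =>
      (List.map_inj_left.1 ((List.map_id z).trans huv.symm) j (y.isWord.mem j))
    rw [← this, homList_id]
    rfl

/-- Two words with the same first part agree up to the images of `rotate` and `swap`. -/
lemma exists_sub_eq {u v v' : List S.carrier} (h : IsWord m u v) (h' : IsWord m u v') :
    ∃ (z₁ : WordGroup (m + 1) S) (z₂ : WordGroup (m + 2) S),
      wd m u v - wd m u v' = wordMap (rotateHom m) S z₁ + wordMap (swapHom m) S z₂ := by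
  obtain ⟨z₁, z₂, hz, -⟩ := exists_rotate_add_swap (wd m u v - wd m u v') fun B hB => by
    rw [map_sub, res_wd _ h, res_wd _ h', sub_eq_zero]
    by_cases hl : (pull (subι B) u).length = m
    · have h1 := (h.pull _ hl).length
      have h2 := (h'.pull _ hl).length
      rw [card_sub, hB] at h1 h2
      rw [List.length_eq_zero_iff.1 (by omega : (pull (subι B) v).length = 0),
        List.length_eq_zero_iff.1 (by omega : (pull (subι B) v').length = 0)]
    · rw [wd_of_length_ne hl, wd_of_length_ne hl]
  exact ⟨z₁, z₂, hz⟩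

end FI

namespace FIMod

variable {R : Type u} [CommRing R] {ι : Type u} {deg : ι → ℕ} {k ℓ m : ℕ} {S T : FI}

/-- The coordinates of an element of `Ξ(ℓ)` in degree `deg i`. -/
noncomputable def coordAt (R : Type u) [CommRing R] (deg : ι → ℕ) (ℓ : ℕ) (i : ι) :
    WordGroup ℓ (std (deg i)) →+ ((Σ i, Word ℓ (std (deg i))) →₀ R) :=
  evalSum fun y => Finsupp.single ⟨i, y⟩ 1

lemma coordAt_apply_self (i : ι) (x : WordGroup ℓ (std (deg i))) (y : Word ℓ (std (deg i))) :
    coordAt R deg ℓ i x ⟨i, y⟩ = (x y : R) := by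
  classical
  change (Finsupp.applyAddHom (⟨i, y⟩ : Σ i, Word ℓ (std (deg i)))) (coordAt R deg ℓ i x) =
    ((Int.castAddHom R).comp (Finsupp.applyAddHom y)) x
  rw [← AddMonoidHom.comp_apply]
  refine DFunLike.congr_fun (Finsupp.addHom_ext' fun p => AddMonoidHom.ext_int ?_) x
  change coordAt R deg ℓ i (Finsupp.single p 1) ⟨i, y⟩ = ((Finsupp.single p (1 : ℤ) y : ℤ) : R)
  rw [coordAt, evalSum_single, Finsupp.single_apply, Finsupp.single_apply]
  simp

lemma coordAt_apply_of_ne {i j : ι} (h : j ≠ i) (x : WordGroup ℓ (std (deg j)))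
    (y : Word ℓ (std (deg i))) : coordAt R deg ℓ j x ⟨i, y⟩ = 0 := by
  classical
  change ((Finsupp.applyAddHom (⟨i, y⟩ : Σ i, Word ℓ (std (deg i)))).comp (coordAt R deg ℓ j)) x =
    (0 : _ →+ R) x
  refine DFunLike.congr_fun (Finsupp.addHom_ext' fun p => AddMonoidHom.ext_int ?_) x
  change coordAt R deg ℓ j (Finsupp.single p 1) ⟨i, y⟩ = 0
  rw [coordAt, evalSum_single, Finsupp.single_apply, if_neg]
  rintro h'
  exact h (congrArg Sigma.fst h')

/-- The co-Yoneda lemma: a generator of degree m contributes R ⊗ Ξ(ℓ)_[m], which is free on the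
words in [m]. -/
lemma exists_coord (deg : ι → ℕ) (ℓ : ℕ) :
    ∃ L : FITensor (free R deg) (Xi ℓ) →ₗ[R] ((Σ i, Word ℓ (std (deg i))) →₀ R),
      ∀ (S : FI) (i : ι) (g : std (deg i) ⟶ S) (x : WordGroup ℓ S),
        L (tens (free R deg) ℓ S ((free R deg).map g (gen deg i)) x) =
          coordAt R deg ℓ i (res ℓ g x) := by
  let h : ∀ S : FI, (free R deg).obj S →ₗ[R]
      (WordGroup ℓ S →+ ((Σ i, Word ℓ (std (deg i))) →₀ R)) := fun S =>
    Finsupp.linearCombination R fun p : Σ i, (std (deg i) ⟶ S) =>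
      (coordAt R deg ℓ p.1).comp (res ℓ p.2)
  have h1 : ∀ (S : FI) (i : ι) (g : std (deg i) ⟶ S) (x : WordGroup ℓ S),
      h S ((free R deg).map g (gen deg i)) x = coordAt R deg ℓ i (res ℓ g x) := by
    intro S i g x
    rw [map_gen]
    refine (DFunLike.congr_fun (Finsupp.linearCombination_single R _ _) x).trans ?_
    rw [one_smul]
    rfl
  obtain ⟨L, hL⟩ := exists_lift h fun {S T} f m x => by
    refine free_induction (P := fun m => h T ((free R deg).map f m) x = h S m (res ℓ f x)) m
      ?_ ?_ ?_
    · rw [map_zero, map_zero, map_zero]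
      rfl
    · intro a b ha hb
      rw [map_add, map_add, map_add, AddMonoidHom.add_apply, AddMonoidHom.add_apply, ha, hb]
    · intro i g c
      rw [map_smul, map_smul, map_smul, map_map_apply, AddMonoidHom.smul_apply,
        AddMonoidHom.smul_apply, h1, h1, res_res]
  exact ⟨L, fun S i g x => (hL _ _ _).trans (h1 S i g x)⟩

/-- The coordinates of the functor tensor product of a free module with `Ξ(ℓ)`. -/
noncomputable def coord (deg : ι → ℕ) (ℓ : ℕ) :
    FITensor (free R deg) (Xi ℓ) →ₗ[R] ((Σ i, Word ℓ (std (deg i))) →₀ R) :=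
  (exists_coord deg ℓ).choose

lemma coord_tens (i : ι) (g : std (deg i) ⟶ S) (x : WordGroup ℓ S) :
    coord deg ℓ (tens (free R deg) ℓ S ((free R deg).map g (gen deg i)) x) =
      coordAt R deg ℓ i (res ℓ g x) :=
  (exists_coord deg ℓ).choose_spec S i g x

lemma tens_free_induction {P : FITensor (free R deg) (Xi ℓ) → Prop}
    (z : FITensor (free R deg) (Xi ℓ)) (h0 : P 0) (hadd : ∀ a b, P a → P b → P (a + b))
    (htens : ∀ (S : FI) (i : ι) (g : std (deg i) ⟶ S) (c : R) (x : WordGroup ℓ S),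
      P (c • tens (free R deg) ℓ S ((free R deg).map g (gen deg i)) x)) : P z := by
  refine tens_induction z (fun S m x => ?_) h0 hadd
  refine free_induction (P := fun m => P (tens (free R deg) ℓ S m x)) m ?_ (fun a b ha hb => ?_)
    fun i g c => ?_
  · rw [map_zero]
    exact h0
  · rw [map_add]
    exact hadd _ _ ha hb
  · rw [map_smul]
    exact htens S i g c x

lemma coord_injective (deg : ι → ℕ) (ℓ : ℕ) :
    Function.Injective (coord (R := R) deg ℓ) := by
  let Ψ : ((Σ i, Word ℓ (std (deg i))) →₀ R) →ₗ[R] FITensor (free R deg) (Xi ℓ) :=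
    Finsupp.linearCombination R fun p =>
      tens (free R deg) ℓ (std (deg p.1)) (gen deg p.1) (Finsupp.single p.2 1)
  have h1 : ∀ i (x : WordGroup ℓ (std (deg i))), Ψ (coordAt R deg ℓ i x) =
      tens (free R deg) ℓ (std (deg i)) (gen deg i) x := by
    intro i x
    have : Ψ.toAddMonoidHom.comp (coordAt R deg ℓ i) =
        tens (free R deg) ℓ (std (deg i)) (gen deg i) := by
      refine Finsupp.addHom_ext' fun p => AddMonoidHom.ext_int ?_
      change Ψ (coordAt R deg ℓ i (Finsupp.single p 1)) =
        tens (free R deg) ℓ (std (deg i)) (gen deg i) (Finsupp.single p 1)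
      rw [coordAt, evalSum_single]
      exact (Finsupp.linearCombination_single R _ _).trans (one_smul R _)
    exact DFunLike.congr_fun this x
  refine Function.LeftInverse.injective (g := Ψ) fun z => ?_
  refine tens_free_induction (P := fun z => Ψ (coord deg ℓ z) = z) z (by rw [map_zero, map_zero])
    (fun a b ha hb => by rw [map_add, map_add, ha, hb]) fun S i g c x => ?_
  rw [map_smul, map_smul, coord_tens, h1, tens_map]

/-- The map on functor tensor products induced by a morphism of `FJ`. -/
noncomputable abbrev tensPush (M : FIMod R) (ψ : FJ.of k ⟶ FJ.of ℓ) :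
    FITensor M (Xi k) →ₗ[R] FITensor M (Xi ℓ) := FITensor.map (𝟙 M) ψ.hom

lemma tensPush_tens {M : FIMod R} (ψ : FJ.of k ⟶ FJ.of ℓ) (m : M.obj S) (x : WordGroup k S) :
    tensPush M ψ (tens M k S m x) = tens M ℓ S m (wordMap ψ S x) :=
  tensorXi_obj_map ψ m x

lemma coord_map (ψ : FJ.of k ⟶ FJ.of ℓ) (i : ι) (y : Word ℓ (std (deg i)))
    (y' : Word k (std (deg i)))
    (h : ∀ x : WordGroup k (std (deg i)), wordMap ψ (std (deg i)) x y = x y')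
    (z : FITensor (free R deg) (Xi k)) :
    coord deg ℓ (tensPush (free R deg) ψ z) ⟨i, y⟩ = coord deg k z ⟨i, y'⟩ := by
  refine tens_free_induction (P := fun z => coord deg ℓ (tensPush (free R deg) ψ z)
    ⟨i, y⟩ = coord deg k z ⟨i, y'⟩) z ?_ ?_ fun S j g c x => ?_
  · rw [map_zero, map_zero, map_zero]
    rfl
  · intro a b ha hb
    rw [map_add, map_add, map_add, Finsupp.add_apply, Finsupp.add_apply, ha, hb]
  · rw [map_smul, map_smul, map_smul, tensPush_tens, coord_tens, coord_tens, Finsupp.smul_apply,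
      Finsupp.smul_apply, res_wordMap]
    congr 1
    by_cases hj : j = i
    · subst hj
      rw [coordAt_apply_self, coordAt_apply_self, h]
    · rw [coordAt_apply_of_ne hj, coordAt_apply_of_ne hj]

/-- At the i-th generator the map factors through Ξ(k) in degree `deg i`, which is zero. -/
lemma coord_map_eq_zero (ψ : FJ.of k ⟶ FJ.of ℓ) (i : ι) (hk : deg i < k)
    (y : Word ℓ (std (deg i))) (z : FITensor (free R deg) (Xi k)) :
    coord deg ℓ (tensPush (free R deg) ψ z) ⟨i, y⟩ = 0 := by
  refine tens_free_induction (P := fun z => coord deg ℓ (tensPush (free R deg) ψ z)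
    ⟨i, y⟩ = 0) z ?_ ?_ fun S j g c x => ?_
  · rw [map_zero, map_zero]
    rfl
  · intro a b ha hb
    rw [map_add, map_add, Finsupp.add_apply, ha, hb, add_zero]
  · rw [map_smul, map_smul, tensPush_tens, coord_tens, Finsupp.smul_apply, res_wordMap]
    by_cases hj : j = i
    · subst hj
      rw [wordGroup_eq_zero (by rwa [card_std]) (res k g x), map_zero, map_zero]
      exact smul_zero c
    · rw [coordAt_apply_of_ne hj, smul_zero]

/-- The coefficients of an element of a free module. -/
noncomputable def coeffs : (free R deg).obj S →ₗ[R] ((Σ i, (std (deg i) ⟶ S)) →₀ R) := LinearMap.id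

lemma coeffs_map_gen (i : ι) (g : std (deg i) ⟶ S) :
    coeffs ((free R deg).map g (gen deg i)) = Finsupp.single ⟨i, g⟩ 1 := map_gen i g

lemma coord_tens_homWord (y : (free R deg).obj S) (i : ι) (g : std (deg i) ⟶ S) :
    coord deg (deg i) (tens (free R deg) (deg i) S y (homWord g)) ⟨i, idWord (deg i)⟩ =
      coeffs y ⟨i, g⟩ := by
  classical
  refine free_induction (P := fun y => coord deg (deg i) (tens (free R deg) (deg i) S y (homWord g))
    ⟨i, idWord (deg i)⟩ = coeffs y ⟨i, g⟩) y ?_ ?_ fun j f c => ?_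
  · rw [map_zero, AddMonoidHom.zero_apply, map_zero, map_zero]
    rfl
  · intro a b ha hb
    rw [map_add, AddMonoidHom.add_apply, map_add, Finsupp.add_apply, ha, hb, map_add,
      Finsupp.add_apply]
  · rw [map_smul, AddMonoidHom.smul_apply, map_smul, coord_tens, Finsupp.smul_apply, map_smul,
      Finsupp.smul_apply, coeffs_map_gen]
    congr 1
    by_cases hj : j = i
    · subst hj
      rw [coordAt_apply_self, res_homWord_idWord, Finsupp.single_apply]
      by_cases hf : f = g
      · simp [hf]
      · simp [hf]
    · rw [coordAt_apply_of_ne hj, Finsupp.single_apply, if_neg]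
      rintro h'
      exact hj (congrArg Sigma.fst h')

lemma unitLin_injective (deg : ι → ℕ) (S : FI) :
    Function.Injective (unitLin (free R deg) S) := by
  refine (injective_iff_map_eq_zero _).2 fun y hy => ?_
  refine Finsupp.ext (α := Σ i, (std (deg i) ⟶ S)) ?_
  rintro ⟨i, g⟩
  have h1 : tens (free R deg) (deg i) S y (homWord g) = 0 :=
    congrArg (fun θ : families ((tensorXi R).obj (free R deg)) S => θ.1 (deg i) (homWord g)) hy
  refine (coord_tens_homWord y i g).symm.trans ?_
  rw [h1, map_zero]
  rfl

/-- By `exists_detect` each coordinate of θ is a coordinate at some `idWord` in degree `deg i`. That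
coordinate vanishes on the images of `rotate` and `swap`, as these come from larger objects of FJ,
so it takes equal values on words with the same first part. This leaves only the words `homWord g`.
-/
lemma family_eq_zero (θ : families ((tensorXi R).obj (free R deg)) S)
    (hθ : ∀ (i : ι) (g : std (deg i) ⟶ S),
      coord deg (deg i) (θ.1 (deg i) (homWord g)) ⟨i, idWord (deg i)⟩ = 0) : θ = 0 := by
  have h1 : ∀ (i : ι) (x : WordGroup (deg i) S),
      coord deg (deg i) (θ.1 (deg i) x) ⟨i, idWord (deg i)⟩ = 0 := by
    intro i x
    let μ : WordGroup (deg i) S →+ R := (Finsupp.applyAddHom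
      (⟨i, idWord (deg i)⟩ : Σ i', Word (deg i) (std (deg i')))).comp
        ((coord (R := R) deg (deg i)).toAddMonoidHom.comp (θ.1 (deg i)))
    have hμ : ∀ {k : ℕ} (ψ : FJ.of k ⟶ FJ.of (deg i)) (_ : deg i < k) (z : WordGroup k S),
        μ (wordMap ψ S z) = 0 := fun ψ hk z => by
      change coord deg (deg i) (θ.1 (deg i) (wordMap ψ S z)) ⟨i, idWord (deg i)⟩ = 0
      rw [← map_family]
      exact coord_map_eq_zero ψ i hk _ _
    suffices μ = 0 from DFunLike.congr_fun this x
    refine wordGroup_hom_ext fun u v h => ?_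
    obtain ⟨g, rfl⟩ := exists_homList (List.Nodup.of_append_left h.nodup) h.1
    obtain ⟨z₁, z₂, hz⟩ := exists_sub_eq h (isWord_homWord g)
    have h2 : μ (homWord g) = 0 := hθ i g
    rw [sub_eq_iff_eq_add] at hz
    rw [hz, map_add, map_add, hμ _ (by omega), hμ _ (by omega), add_zero, zero_add]
    exact h2
  refine family_ext fun ℓ x => coord_injective deg ℓ (Finsupp.ext ?_)
  rintro ⟨i, y⟩
  obtain ⟨c, hc⟩ := exists_detect y
  have h2 := coord_map (R := R) (deg := deg) c i _ y hc (θ.1 ℓ x)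
  have h3 := map_family θ c x
  have h4 := h1 i (wordMap c S x)
  rw [← h3] at h4
  refine (h2.symm.trans h4).trans ?_
  change 0 = coord deg ℓ 0 ⟨i, y⟩
  rw [map_zero]
  rfl

lemma unitLin_surjective (deg : ι → ℕ) (S : FI) :
    Function.Surjective (unitLin (free R deg) S) := by
  classical
  intro θ
  let a : (Σ i, (std (deg i) ⟶ S)) → R := fun p =>
    coord deg (deg p.1) (θ.1 (deg p.1) (homWord p.2)) ⟨p.1, idWord (deg p.1)⟩
  -- An injection g forces `deg i` ≤ |S|; for each such degree there are finitely many g, and each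
  -- value of θ has finitely many nonzero coordinates, hence involves finitely many i.
  have hfin : (Function.support a).Finite := by
    let I : Set ι := ⋃ m ∈ Set.Iic S.card, ⋃ g : std m ⟶ S,
      Sigma.fst '' ((coord (R := R) deg m (θ.1 m (homWord g))).support :
        Set (Σ i, Word m (std (deg i))))
    have hI : I.Finite := Set.Finite.biUnion (Set.finite_Iic _) fun m _ =>
      Set.finite_iUnion fun g => (Finset.finite_toSet _).image _
    refine (hI.biUnion (t := fun i => Set.range fun g : std (deg i) ⟶ S =>
      (⟨i, g⟩ : Σ i, (std (deg i) ⟶ S))) fun i _ => Set.finite_range _).subset ?_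
    rintro ⟨i, g⟩ hp
    refine Set.mem_biUnion (x := i) ?_ ⟨g, rfl⟩
    refine Set.mem_biUnion (x := deg i) (by simpa using card_le_of_hom g) ?_
    exact Set.mem_iUnion.2 ⟨g, ⟨i, idWord (deg i)⟩, Finsupp.mem_support_iff.2 hp, rfl⟩
  let y : (free R deg).obj S := (Finsupp.onFinset hfin.toFinset a fun p hp =>
    hfin.mem_toFinset.2 hp : (Σ i, (std (deg i) ⟶ S)) →₀ R)
  refine ⟨y, (sub_eq_zero.1 (family_eq_zero (θ - unitLin (free R deg) S y) fun i g => ?_)).symm⟩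
  refine (congrArg (fun z => z ⟨i, idWord (deg i)⟩) (map_sub (coord (R := R) deg (deg i))
    (θ.1 (deg i) (homWord g)) (tens (free R deg) (deg i) S y (homWord g)))).trans ?_
  exact sub_eq_zero.2 (coord_tens_homWord y i g).symm

end FIMod

/-! ### `FJ`-modules supported in finite degree -/

namespace FJFunctor

variable {R : Type u} [CommRing R] {N N' N'' : FJFunctor R} {k ℓ d : ℕ} {S T : FI}

/-- The functor `N` vanishes in degrees larger than `d`. -/
def VanishesAbove (N : FJFunctor R) (d : ℕ) : Prop :=
  ∀ ℓ : ℕ, d < ℓ → ∀ n : N.obj (FJ.of ℓ), n = 0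

lemma map_add_apply (N : FJFunctor R) [N.Additive] (ψ φ : FJ.of k ⟶ FJ.of ℓ)
    (n : N.obj (FJ.of k)) : N.map (ψ + φ) n = N.map ψ n + N.map φ n := by
  rw [Functor.map_add]
  rfl

lemma map_sub_apply (N : FJFunctor R) [N.Additive] (ψ φ : FJ.of k ⟶ FJ.of ℓ)
    (n : N.obj (FJ.of k)) : N.map (ψ - φ) n = N.map ψ n - N.map φ n := by
  rw [Functor.map_sub]
  rfl

lemma map_comp_apply {m : ℕ} (N : FJFunctor R) (ψ : FJ.of k ⟶ FJ.of ℓ) (φ : FJ.of ℓ ⟶ FJ.of m)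
    (n : N.obj (FJ.of k)) : N.map (ψ ≫ φ) n = N.map φ (N.map ψ n) := by
  rw [Functor.map_comp]
  rfl

/-- A module vanishing in degrees larger than `d` annihilates the morphisms that vanish in degrees
at most `d`. -/
lemma map_eq_zero {k ℓ : ℕ} [N.Additive] (hN : VanishesAbove N d) (ψ : FJ.of k ⟶ FJ.of ℓ)
    (hψ : ∀ S : FI, S.card ≤ d → wordMap ψ S = 0) (n : N.obj (FJ.of k)) : N.map ψ n = 0 := by
  by_cases hℓ : d < ℓ
  · exact hN ℓ hℓ _
  -- As ψ vanishes in degree ℓ ≤ d, it factors through ℓ+1 and ℓ+2, and the first factors again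
  -- vanish in degrees at most d. The recursion ends above d, where N is zero.
  · obtain ⟨a₁, a₂, h, ha⟩ := exists_comp_rotate_add_comp_swap ψ fun S hS => hψ S (by omega)
    rw [h, map_add_apply, map_comp_apply, map_comp_apply,
      map_eq_zero hN a₁ (fun S hS => (ha S (hψ S hS)).1),
      map_eq_zero hN a₂ (fun S hS => (ha S (hψ S hS)).2), map_zero, map_zero, add_zero]
termination_by d + 1 - ℓ

lemma map_eq_map [N.Additive] (hN : VanishesAbove N d) {ψ φ : FJ.of k ⟶ FJ.of ℓ}
    (h : ∀ S : FI, S.card ≤ d → wordMap ψ S = wordMap φ S) (n : N.obj (FJ.of k)) :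
    N.map ψ n = N.map φ n := by
  rw [← sub_eq_zero, ← map_sub_apply]
  exact map_eq_zero hN _ (fun S hS => by rw [wordMap_sub, h S hS, sub_self]) n

/-- A natural family with values in a module vanishing in degrees larger than `d` vanishes at
the elements whose restrictions to degrees at most `d` vanish. -/
lemma family_apply_eq_zero {ℓ : ℕ} (hN : VanishesAbove N d) (θ : families N S) (z : WordGroup ℓ S)
    (hz : ∀ {T : FI} (f : T ⟶ S), T.card ≤ d → res ℓ f z = 0) : θ.1 ℓ z = 0 := by
  by_cases hℓ : d < ℓ
  · exact hN ℓ hℓ _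
  · obtain ⟨z₁, z₂, h, hz'⟩ := exists_rotate_add_swap z fun B hB => hz _ (by rw [card_sub]; omega)
    rw [h, map_add, ← map_family, ← map_family,
      family_apply_eq_zero hN θ z₁ fun f hf => (hz' f (hz f hf)).1,
      family_apply_eq_zero hN θ z₂ fun f hf => (hz' f (hz f hf)).2, map_zero, map_zero, add_zero]
termination_by d + 1 - ℓ

/-- A natural map to combinations of injections and an element of a module give rise to a natural
family. -/
lemma exists_family [N.Additive] (hN : VanishesAbove N d)
    {α : ∀ T : FI, WordGroup k T →+ InjGroup S T} (hα : InjNaturalLE d α) (n : N.obj (FJ.of k)) :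
    ∃ θ : families N S, ∀ (ℓ : ℕ) (x : WordGroup ℓ S), ∃ ψ : FJ.of k ⟶ FJ.of ℓ,
      (∀ T : FI, T.card ≤ d → ∀ y, wordMap ψ T y = act x T (α T y)) ∧ θ.1 ℓ x = N.map ψ n := by
  -- The family sends x to the image of n under a morphism that extends the truncated map y ↦ `act x
  -- T (α T y)`. Since N only sees degrees at most d, additivity and naturality in x can be checked
  -- on the truncations.
  choose ψ hψ using fun (ℓ : ℕ) (x : WordGroup ℓ S) => exists_act hα x
  refine ⟨⟨fun ℓ => AddMonoidHom.mk' (fun x => N.map (ψ ℓ x) n) fun x x' => ?_,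
    fun ℓ m χ x => ?_⟩, fun ℓ x => ⟨ψ ℓ x, hψ ℓ x, rfl⟩⟩
  · rw [← map_add_apply]
    refine map_eq_map hN (fun T hT => AddMonoidHom.ext fun y => ?_) n
    rw [wordMap_add, AddMonoidHom.add_apply, hψ ℓ _ T hT, hψ ℓ _ T hT, hψ ℓ _ T hT, act_add]
  · change N.map χ (N.map (ψ ℓ x) n) = N.map (ψ m (wordMap χ S x)) n
    rw [← map_comp_apply]
    refine map_eq_map hN (fun T hT => AddMonoidHom.ext fun y => ?_) n
    rw [wordMap_comp, AddMonoidHom.comp_apply, hψ ℓ _ T hT, hψ m _ T hT, act_map]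

variable (R) in
/-- Natural families on sufficiently large sets can be lifted along exact sequences of modules
supported in bounded degree. -/
lemma exists_family_lift (d : ℕ) : ∃ n : ℕ, ∀ {N N' N'' : FJFunctor R} [N.Additive]
    (_ : VanishesAbove N d) (_ : VanishesAbove N' d) (i : N ⟶ N') (q : N' ⟶ N'')
    (_ : ∀ (ℓ : ℕ) (y : N'.obj (FJ.of ℓ)), q.app (FJ.of ℓ) y = 0 → ∃ x, i.app (FJ.of ℓ) x = y)
    {S : FI} (_ : n ≤ S.card) (θ : families N' S)
    (_ : ∀ ℓ x, q.app (FJ.of ℓ) (θ.1 ℓ x) = 0),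
    ∃ θ' : families N S, ∀ ℓ x, i.app (FJ.of ℓ) (θ'.1 ℓ x) = θ.1 ℓ x := by
  obtain ⟨n, hn⟩ := exists_resolution d
  refine ⟨n, ?_⟩
  intro N N' N'' _ hN hN' i q hex S hS θ hθ
  obtain ⟨β, hβn, hβ⟩ := hn S hS
  -- It suffices to lift the values of θ at the finitely many classes `setWord A`; the maps β spread
  -- these lifts to natural families whose sum lifts θ.
  choose y hy using fun A : Finset S.carrier => hex A.card (θ.1 A.card (setWord A)) (hθ _ _)
  choose η ψ hψ hη using fun A : Finset S.carrier => exists_family hN (hβn A) (y A)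
  refine ⟨∑ A, η A, fun ℓ x => ?_⟩
  have h1 : (∑ A, η A).1 ℓ x = ∑ A, (η A).1 ℓ x := by
    rw [Submodule.coe_sum, Finset.sum_apply, AddMonoidHom.finsetSum_apply]
  have h2 : ∀ A, i.app (FJ.of ℓ) ((η A).1 ℓ x) = θ.1 ℓ (wordMap (ψ A ℓ x) S (setWord A)) := by
    intro A
    rw [hη, NatTrans.naturality_apply, hy, map_family]
  rw [h1, map_sum, Finset.sum_congr rfl fun A _ => h2 A, ← map_sum, ← sub_eq_zero, ← map_sub]
  -- The resolving identity for β holds only for sources of size at most d, and θ does not see more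
  -- than that.
  refine family_apply_eq_zero hN' θ _ fun {T} f hf => ?_
  rw [map_sub, map_sum, sub_eq_zero, ← act_single, ← hβ f hf, map_sum]
  refine Finset.sum_congr rfl fun A _ => ?_
  rw [res_wordMap, hψ A ℓ x T hf]

variable (R) in
/-- The elements of a submodule are generated by the values of the natural families in the
submodule on any sufficiently large set. -/
lemma exists_generation (d : ℕ) : ∃ n : ℕ, ∀ {N : FJFunctor R} [N.Additive]
    (_ : VanishesAbove N d) (K : ∀ ℓ : ℕ, AddSubgroup (N.obj (FJ.of ℓ)))
    (_ : ∀ {k ℓ : ℕ} (ψ : FJ.of k ⟶ FJ.of ℓ), ∀ y ∈ K k, N.map ψ y ∈ K ℓ)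
    {S : FI} (_ : n ≤ S.card) (k : ℕ), ∀ y ∈ K k, y ∈ AddSubgroup.closure
      {z | ∃ θ : families N S, (∀ ℓ x, θ.1 ℓ x ∈ K ℓ) ∧ ∃ x, z = θ.1 k x} := by
  choose! n hn using fun k => exists_section d k
  refine ⟨(Finset.range (d + 1)).sup n, ?_⟩
  intro N _ hN K hK S hS k y hy
  set C : ∀ k : ℕ, AddSubgroup (N.obj (FJ.of k)) := fun k => AddSubgroup.closure
    {z | ∃ θ : families N S, (∀ ℓ x, θ.1 ℓ x ∈ K ℓ) ∧ ∃ x, z = θ.1 k x} with hC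
  have hCmap : ∀ {k ℓ : ℕ} (ψ : FJ.of k ⟶ FJ.of ℓ), ∀ z ∈ C k, N.map ψ z ∈ C ℓ := by
    intro k ℓ ψ z hz
    induction hz using AddSubgroup.closure_induction with
    | mem z hz =>
      obtain ⟨θ, h1, x, rfl⟩ := hz
      exact AddSubgroup.subset_closure ⟨θ, h1, _, map_family θ ψ x⟩
    | zero => rw [map_zero]; exact zero_mem _
    | add a b _ _ ha hb => rw [map_add]; exact add_mem ha hb
    | neg a _ ha => rw [map_neg]; exact neg_mem ha
  -- Descending induction on k, with e counting down to the degrees above d, where N vanishes.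
  suffices ∀ e k : ℕ, d + 1 ≤ k + e → ∀ y ∈ K k, y ∈ C k from this (d + 1) k (by omega) y hy
  clear hy y k
  intro e
  induction e with
  | zero =>
    intro k hk y _
    rw [hN k (by omega) y]
    exact zero_mem _
  | succ e ih =>
    intro k hk y hy
    by_cases hkd : d < k
    · rw [hN k hkd y]
      exact zero_mem _
    obtain ⟨w, α, hα, hw⟩ := hn k (by omega) S
      ((Finset.le_sup (f := n) (Finset.mem_range.2 (by omega))).trans hS)
    obtain ⟨θ, hθ⟩ := exists_family hN hα y
    obtain ⟨ψ, hψ, hψy⟩ := hθ k w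
    have hmem : θ.1 k w ∈ C k := by
      refine AddSubgroup.subset_closure ⟨θ, fun ℓ x => ?_, w, rfl⟩
      obtain ⟨φ, -, hφ⟩ := hθ ℓ x
      rw [hφ]
      exact hK φ y hy
    -- The value of the family at w is the image of y under ψ, and ψ is the identity in degree k. So
    -- the error ψ - 𝟙 factors through k+1 and k+2, where the induction hypothesis applies.
    obtain ⟨a₁, a₂, ha, -⟩ := exists_comp_rotate_add_comp_swap (ψ - 𝟙 _) fun T hT => by
      refine AddMonoidHom.ext fun z => ?_
      rw [wordMap_sub, wordMap_id, AddMonoidHom.sub_apply, hψ T (by omega), hw T hT]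
      exact sub_self z
    have h1 : N.map (ψ - 𝟙 _) y ∈ C k := by
      rw [ha, map_add_apply, map_comp_apply, map_comp_apply]
      exact add_mem (hCmap _ _ (ih _ (by omega) _ (hK a₁ y hy)))
        (hCmap _ _ (ih _ (by omega) _ (hK a₂ y hy)))
    have h2 : y = θ.1 k w - N.map (ψ - 𝟙 _) y := by
      rw [map_sub_apply, hψy, CategoryTheory.Functor.map_id]
      change y = N.map ψ y - (N.map ψ y - y)
      abel
    rw [h2]
    exact sub_mem hmem h1

end FJFunctor

/-! ### Modules presented in finite degree -/

namespace FIMod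

variable {R : Type u} [CommRing R] {M M' : FIMod R} {ι κ : Type u} {deg₀ : ι → ℕ} {deg₁ : κ → ℕ}
  {n d : ℕ} {S T : FI}

/-- A sequence of `FI`-modules that is right exact on sets with at least `n` elements. -/
def RightExactGE {A B C : FIMod R} (r : A ⟶ B) (p : B ⟶ C) (n : ℕ) : Prop :=
  ∀ S : FI, n ≤ S.card → Function.Exact (r.app S) (p.app S) ∧ Function.Surjective (p.app S)

lemma exists_free_lift {P : FIMod R} (p : free R deg₀ ⟶ M) (q : P ⟶ M)
    (h : ∀ i, Function.Surjective (q.app (std (deg₀ i)))) : ∃ s : free R deg₀ ⟶ P, s ≫ q = p := by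
  choose a ha using fun i => h i (p.app _ (gen deg₀ i))
  refine ⟨freeLift deg₀ a, free_hom_ext fun i => ?_⟩
  exact (congrArg (q.app _) (freeLift_gen deg₀ a i)).trans (ha i)

lemma exists_map_std (m : M.obj S) : ∃ m' : M.obj (std S.card), M.map (ofStd S) m' = m :=
  ⟨M.map (toStd S) m, by rw [map_map_apply, toStd_ofStd, map_id_apply']⟩

lemma _root_.FI.exists_factor_card (g : S ⟶ T) {c : ℕ} (h₁ : S.card ≤ c) (h₂ : c ≤ T.card) :
    ∃ (U : FI) (g₁ : S ⟶ U) (g₂ : U ⟶ T), U.card = c ∧ g₁ ≫ g₂ = g := by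
  classical
  have := Fintype.ofFinite S.carrier
  have := Fintype.ofFinite T.carrier
  obtain ⟨B, hB, hc⟩ := Finset.exists_superset_card_eq
    (s := Finset.univ.map (toEmb g)) (n := c)
    (by rwa [Finset.card_map, Finset.card_univ, ← Nat.card_eq_fintype_card])
    (by rwa [← Nat.card_eq_fintype_card])
  refine ⟨sub B, (⟨fun s => ⟨toEmb g s, hB (Finset.mem_map_of_mem _ (Finset.mem_univ s))⟩,
    fun s s' h => (toEmb g).injective (congrArg Subtype.val h)⟩ :
      S.carrier ↪ (sub B).carrier), subι B, by rw [card_sub, hc], rfl⟩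

/-- A module that is presented by modules generated in finite degree on all sufficiently large
sets is presented in finite degree. -/
lemma presentedInFiniteDegree_of_rightExactGE (h₀ : ∀ i, deg₀ i ≤ d) (h₁ : ∀ k, deg₁ k ≤ d)
    {r : free R deg₁ ⟶ free R deg₀} {p : free R deg₀ ⟶ M} (h : RightExactGE r p n) :
    presentedInFiniteDegree R M := by
  set D := max d n with hD
  have hdD : d ≤ D := le_max_left _ _
  have hnD : n ≤ D := le_max_right _ _
  -- The tautological presentation truncated at D: all elements of M on the standard sets of size at
  -- most D as generators, and all relations among these on the same sets. It is exact up to D by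
  -- construction and is compared with the given one beyond D.
  let deg₂ : (Σ m : Fin (D + 1), (M.obj (std m) : Type u)) → ℕ := fun x => x.1
  let q : free R deg₂ ⟶ M := freeLift deg₂ fun x => x.2
  let deg₃ : (Σ m : Fin (D + 1), LinearMap.ker (q.app (std m)).hom) → ℕ := fun x => x.1
  let t : free R deg₃ ⟶ free R deg₂ := freeLift deg₃ fun x => x.2.1
  have hqsmall : ∀ S : FI, S.card ≤ D → Function.Surjective (q.app S) := by
    intro S hS m
    obtain ⟨m', rfl⟩ := exists_map_std m
    refine ⟨(free R deg₂).map (ofStd S) (gen deg₂ ⟨⟨S.card, Nat.lt_succ_of_le hS⟩, m'⟩), ?_⟩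
    rw [app_map]
    exact congrArg (M.map (ofStd S)) (freeLift_gen deg₂ (fun x => x.2) _)
  have htsmall : ∀ S : FI, S.card ≤ D → ∀ y, q.app S y = 0 → ∃ z, t.app S z = y := by
    intro S hS y hy
    have hy' : q.app _ ((free R deg₂).map (toStd S) y) = 0 := by rw [app_map, hy, map_zero]
    refine ⟨(free R deg₃).map (ofStd S) (gen deg₃
      ⟨⟨S.card, Nat.lt_succ_of_le hS⟩, ⟨(free R deg₂).map (toStd S) y, hy'⟩⟩), ?_⟩
    rw [app_map]
    refine (congrArg ((free R deg₂).map (ofStd S)) (freeLift_gen deg₃ (fun x => x.2.1) _)).trans ?_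
    change (free R deg₂).map (ofStd S) ((free R deg₂).map (toStd S) y) = y
    rw [map_map_apply, toStd_ofStd, map_id_apply']
  have htq : t ≫ q = 0 := by
    refine free_hom_ext fun i => ?_
    exact (congrArg (q.app _) (freeLift_gen deg₃ (fun x => x.2.1) i)).trans i.2.2
  obtain ⟨s, hs⟩ := exists_free_lift p q fun i =>
    hqsmall _ (by rw [card_std]; exact (h₀ i).trans hdD)
  have hs' : ∀ (S : FI) (w : (free R deg₀).obj S), q.app S (s.app S w) = p.app S w := by
    intro S w
    rw [← hs]
    rfl
  have hqt : ∀ (S : FI) (z : (free R deg₃).obj S), q.app S (t.app S z) = 0 := fun S z =>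
    DFunLike.congr_fun (congrArg ModuleCat.Hom.hom (NatTrans.congr_app htq S)) z
  have hrs : ∀ (S : FI), n ≤ S.card → ∀ v : (free R deg₁).obj S,
      ∃ z, t.app S z = s.app S (r.app S v) := by
    intro S hnS v
    by_cases hS : S.card ≤ D
    · exact htsmall S hS _ (by rw [hs']; exact ((h S hnS).1 _).2 ⟨v, rfl⟩)
    refine free_induction (P := fun v => ∃ z, t.app S z = s.app S (r.app S v)) v
      ⟨0, by simp only [map_zero]⟩ ?_ fun k g c => ?_
    · rintro a b ⟨z, hz⟩ ⟨z', hz'⟩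
      exact ⟨z + z', by rw [map_add, map_add, map_add, hz, hz']⟩
    · have hk : deg₁ k ≤ D := (h₁ k).trans hdD
      -- A set with between n and D elements: large enough for the given sequence to be exact, small
      -- enough for the tautological one.
      obtain ⟨U, g₁, g₂, hU, rfl⟩ := exists_factor_card g (c := max (deg₁ k) n)
        (by rw [card_std]; exact le_max_left _ _) (by omega)
      obtain ⟨z, hz⟩ := htsmall U (by omega) (s.app U (r.app U ((free R deg₁).map g₁ (gen deg₁ k))))
        (by rw [hs']; exact ((h U (by omega)).1 _).2 ⟨_, rfl⟩)
      refine ⟨c • (free R deg₃).map g₂ z, ?_⟩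
      rw [map_smul, map_smul, map_smul, app_map, hz, ← app_map, ← app_map, map_map_apply]
  refine ⟨D, _, _, deg₂, deg₃, t, q, fun x => Nat.le_of_lt_succ x.1.2,
    fun x => Nat.le_of_lt_succ x.1.2, fun S => ?_⟩
  by_cases hS : S.card ≤ D
  · exact ⟨fun y => ⟨htsmall S hS y, by rintro ⟨z, rfl⟩; exact hqt S z⟩, hqsmall S hS⟩
  have hnS : n ≤ S.card := by omega
  refine ⟨fun y => ⟨fun hy => ?_, by rintro ⟨z, rfl⟩; exact hqt S z⟩, fun m => ?_⟩
  · obtain ⟨w, z, rfl⟩ : ∃ w z, s.app S w + t.app S z = y := by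
      refine free_induction (P := fun y => ∃ w z, s.app S w + t.app S z = y) y
        ⟨0, 0, by simp only [map_zero, add_zero]⟩ ?_ fun x g c => ?_
      · rintro a b ⟨w, z, rfl⟩ ⟨w', z', rfl⟩
        exact ⟨w + w', z + z', by rw [map_add, map_add]; abel⟩
      · have hx : deg₂ x ≤ D := Nat.le_of_lt_succ x.1.2
        obtain ⟨U, g₁, g₂, hU, rfl⟩ := exists_factor_card g (c := max (deg₂ x) n)
          (by rw [card_std]; exact le_max_left _ _) (by omega)
        obtain ⟨w, hw⟩ := (h U (by omega)).2 (q.app U ((free R deg₂).map g₁ (gen deg₂ x)))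
        obtain ⟨z, hz⟩ := htsmall U (by omega)
          ((free R deg₂).map g₁ (gen deg₂ x) - s.app U w) (by
            rw [map_sub, hs', hw, sub_self])
        refine ⟨c • (free R deg₀).map g₂ w, c • (free R deg₃).map g₂ z, ?_⟩
        rw [map_smul, map_smul, ← smul_add, app_map, app_map, ← map_add, hz, ← map_map_apply]
        congr 2
        abel
    rw [map_add, hqt, add_zero, hs'] at hy
    obtain ⟨v, rfl⟩ := ((h S hnS).1 w).1 hy
    obtain ⟨z', hz'⟩ := hrs S hnS v
    exact ⟨z' + z, by rw [map_add, hz']⟩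
  · obtain ⟨w, rfl⟩ := (h S hnS).2 m
    exact ⟨s.app S w, hs' S w⟩

end FIMod

/-! ### The unit and the counit -/

section

variable {R : Type u} [CommRing R] {M M' : FIMod R} {ι κ : Type u} {deg₀ : ι → ℕ} {deg₁ : κ → ℕ}
  {n d k ℓ : ℕ} {S T : FI}

instance (M : FIMod R) : ((tensorXi R).obj M).Additive where
  map_add {k ℓ ψ φ} := ModuleCat.hom_ext (tens_ext fun S m x => by
    change tensPush M (k := k) (ℓ := ℓ) (ψ + φ) (tens M k S m x) =
      tensPush M (k := k) (ℓ := ℓ) ψ (tens M k S m x) +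
        tensPush M (k := k) (ℓ := ℓ) φ (tens M k S m x)
    rw [tensPush_tens, tensPush_tens, tensPush_tens, ← map_add, ← AddMonoidHom.add_apply,
      ← wordMap_add])

namespace FIMod

lemma vanishesAbove_free (h : ∀ i, deg₀ i ≤ d) :
    VanishesAbove ((tensorXi R).obj (free R deg₀)) d := fun ℓ hℓ z =>
  tens_eq_zero_of_free h (p := 𝟙 _) (fun _ y => ⟨y, rfl⟩) (ℓ := ℓ) hℓ z

lemma vanishesAbove_of_isPresentedInDegreesLE (h : IsPresentedInDegreesLE M d) :
    VanishesAbove ((tensorXi R).obj M) d := by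
  obtain ⟨ι, κ, deg₀, deg₁, r, p, h₀, h₁, h⟩ := h
  exact fun ℓ hℓ z => tens_eq_zero_of_free h₀ (p := p) (fun S => (h S).2) (ℓ := ℓ) hℓ z

lemma unitLin_app (g : M ⟶ M') (m : M.obj S) (x : WordGroup ℓ S) :
    (unitLin M' S (g.app S m)).1 ℓ x = tensMap g ℓ ((unitLin M S m).1 ℓ x) :=
  (tensMap_tens g m x).symm

/-- The unit of the adjunction is bijective on sufficiently large sets at modules presented in
finite degree. -/
lemma unitLin_bijective (h : presentedInFiniteDegree R M) :
    ∃ n : ℕ, ∀ S : FI, n ≤ S.card → Function.Bijective (unitLin M S) := by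
  obtain ⟨d, hd⟩ := h
  have hM := vanishesAbove_of_isPresentedInDegreesLE hd
  obtain ⟨ι, κ, deg₀, deg₁, r, p, h₀, h₁, h⟩ := hd
  -- The presentation of M stays exact after tensoring with Ξ, and its natural families on large
  -- sets can be lifted. Comparison with the two free modules, where the unit is bijective, gives
  -- both halves by a diagram chase.
  obtain ⟨n, hn⟩ := exists_family_lift R d
  refine ⟨n, fun S hS => ⟨(injective_iff_map_eq_zero _).2 fun m hm => ?_, fun θ => ?_⟩⟩
  · obtain ⟨y, rfl⟩ := (h S).2 m
    obtain ⟨θ', hθ'⟩ := hn (vanishesAbove_free h₁) (vanishesAbove_free h₀) ((tensorXi R).map r)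
      ((tensorXi R).map p) (fun ℓ y hy => (tensMap_exact 0 (fun S _ => h S) ℓ y).1 hy) hS
      (unitLin _ S y) fun ℓ x => (unitLin_app p y x).symm.trans (congrArg (fun θ => θ.1 ℓ x) hm)
    obtain ⟨z, rfl⟩ := unitLin_surjective deg₁ S θ'
    have : r.app S z = y := unitLin_injective deg₀ S (family_ext fun ℓ x =>
      (unitLin_app r z x).trans (hθ' ℓ x))
    rw [← this]
    exact ((h S).1 _).2 ⟨z, rfl⟩
  · obtain ⟨θ', hθ'⟩ := hn (vanishesAbove_free h₀) hM ((tensorXi R).map p)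
      (0 : _ ⟶ (tensorXi R).obj M)
      (fun ℓ y _ => tensMap_surjective 0 (fun S _ => (h S).2) ℓ y) hS θ fun ℓ x => rfl
    obtain ⟨y, rfl⟩ := unitLin_surjective deg₀ S θ'
    exact ⟨p.app S y, family_ext fun ℓ x => (unitLin_app p y x).trans (hθ' ℓ x)⟩

end FIMod

namespace FJFunctor

variable {N : FJFunctor R}

lemma counitLin_tensMap {P : FIMod R} (p : P ⟶ toFIMod N) (y : P.obj S) (x : WordGroup ℓ S) :
    counitLin N ℓ (tensMap p ℓ (tens P ℓ S y x)) = (show families N S from p.app S y).1 ℓ x :=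
  (congrArg (counitLin N ℓ) (tensMap_tens p y x)).trans (counitLin_tens N ℓ _ x)

/-- Since the natural families on one large set [n] have values that generate N, one generator of
degree n for each family suffices. -/
lemma exists_generators [N.Additive] (hN : VanishesAbove N d) :
    ∃ (ι : Type u) (deg : ι → ℕ) (n : ℕ) (p : free R deg ⟶ toFIMod N), (∀ i, deg i ≤ n) ∧
      ∀ ℓ, Function.Surjective fun z => counitLin N ℓ (tensMap p ℓ z) := by
  obtain ⟨n, hn⟩ := exists_generation R d
  let deg : families N (std n) → ℕ := fun _ => n
  let a : ∀ θ : families N (std n), (toFIMod N).obj (std (deg θ)) := fun θ => θ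
  refine ⟨families N (std n), deg, n, freeLift deg a, fun _ => le_rfl, fun ℓ y => ?_⟩
  have hy := hn hN (fun _ => ⊤) (fun _ _ _ => AddSubgroup.mem_top _) (S := std n) (by simp) ℓ y
    (AddSubgroup.mem_top _)
  induction hy using AddSubgroup.closure_induction with
  | mem y hy =>
    obtain ⟨θ, -, x, rfl⟩ := hy
    refine ⟨tens (free R deg) ℓ (std n) (gen deg θ) x, ?_⟩
    exact (counitLin_tensMap (freeLift deg a) (gen deg θ) x).trans
      (congrArg (fun θ : families N (std n) => θ.1 ℓ x) (freeLift_gen deg a θ))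
  | zero => exact ⟨0, by simp only [map_zero]⟩
  | add a b _ _ ha hb =>
    obtain ⟨y, rfl⟩ := ha
    obtain ⟨z, rfl⟩ := hb
    exact ⟨y + z, by simp only [map_add]⟩
  | neg a _ ha =>
    obtain ⟨y, rfl⟩ := ha
    exact ⟨-y, by simp only [map_neg]⟩

/-- The kernel of q is again generated by the values of natural families on one set [n]. Each of
these families comes from an element of the free module, by surjectivity of the unit, and these
elements are the relations. -/
lemma exists_relations (h₀ : ∀ i, deg₀ i ≤ d) (q : (tensorXi R).obj (free R deg₀) ⟶ N) :
    ∃ (κ : Type u) (deg₁ : κ → ℕ) (n : ℕ) (r : free R deg₁ ⟶ free R deg₀), (∀ i, deg₁ i ≤ n) ∧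
      ∀ (ℓ : ℕ), Function.Exact (tensMap r ℓ) (q.app (FJ.of ℓ)).hom := by
  obtain ⟨n, hn⟩ := exists_generation R d
  let N₀ := (tensorXi R).obj (free R deg₀)
  let κ := {θ : families N₀ (std n) // ∀ ℓ x, q.app (FJ.of ℓ) (θ.1 ℓ x) = 0}
  choose a ha using fun θ : κ => unitLin_surjective deg₀ (std n) θ.1
  let deg : κ → ℕ := fun _ => n
  have hr : ∀ (θ : κ) (ℓ : ℕ) x, tensMap (freeLift deg a) ℓ
      (tens (free R deg) ℓ (std n) (gen deg θ) x) = θ.1.1 ℓ x := fun θ ℓ x => by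
    refine (tensMap_tens (freeLift deg a) (gen deg θ) x).trans ?_
    refine (congrArg (fun y => tens (free R deg₀) ℓ (std n) y x) (freeLift_gen deg a θ)).trans ?_
    exact congrArg (fun θ : families N₀ (std n) => θ.1 ℓ x) (ha θ)
  refine ⟨κ, deg, n, freeLift deg a, fun _ => le_rfl, fun ℓ y => ⟨fun hy => ?_, ?_⟩⟩
  · have hy' := hn (vanishesAbove_free h₀) (fun ℓ => (q.app (FJ.of ℓ)).hom.toAddMonoidHom.ker)
      (fun ψ y hy => by
        change q.app _ (N₀.map ψ y) = 0
        rw [NatTrans.naturality_apply]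
        exact (congrArg (N.map ψ) hy).trans (map_zero _)) (S := std n) (by simp) ℓ y hy
    clear hy
    induction hy' using AddSubgroup.closure_induction with
    | mem y hy =>
      obtain ⟨θ, hθ, x, rfl⟩ := hy
      exact ⟨_, hr ⟨θ, hθ⟩ ℓ x⟩
    | zero => exact ⟨0, map_zero _⟩
    | add a b _ _ ha hb =>
      obtain ⟨y, rfl⟩ := ha
      obtain ⟨z, rfl⟩ := hb
      exact ⟨y + z, map_add _ _ _⟩
    | neg a _ ha =>
      obtain ⟨y, rfl⟩ := ha
      exact ⟨-y, map_neg _ _⟩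
  · rintro ⟨z, rfl⟩
    refine tens_free_induction
      (P := fun z => (q.app (FJ.of ℓ)).hom (tensMap (freeLift deg a) ℓ z) = 0) z
      ((congrArg _ (map_zero _)).trans (map_zero _))
      (fun b c hb hc => ?_) fun S i g c x => ?_
    · refine (congrArg _ (map_add _ _ _)).trans ((map_add (q.app (FJ.of ℓ)).hom _ _).trans ?_)
      rw [hb, hc, add_zero]
    · refine (congrArg _ (map_smul _ _ _)).trans ((map_smul (q.app (FJ.of ℓ)).hom _ _).trans ?_)
      rw [tens_map]
      refine (congrArg (fun w => c • (q.app (FJ.of ℓ)).hom w) (hr i ℓ (res ℓ g x))).trans ?_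
      exact (congrArg (c • ·) (i.2 ℓ _)).trans (smul_zero c)

/-- For an `FJ`-module supported in finite degree, the `FI`-module of natural families is presented
in finite degree and the counit of the adjunction is bijective. -/
lemma presentedInFiniteDegree_toFIMod [N.Additive] (hN : VanishesAbove N d) :
    presentedInFiniteDegree R (toFIMod N) ∧ ∀ ℓ, Function.Bijective (counitLin N ℓ) := by
  obtain ⟨ι, deg₀, n₀, p, h₀, hp⟩ := exists_generators hN
  let q : (tensorXi R).obj (free R deg₀) ⟶ N := (tensorXi R).map p ≫ (tensorXiCounit R).app N
  have hq : ∀ ℓ z, q.app (FJ.of ℓ) z = counitLin N ℓ (tensMap p ℓ z) := fun ℓ z => rfl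
  have hqu : ∀ {S : FI} (y : (free R deg₀).obj S) ℓ x,
      q.app (FJ.of ℓ) ((unitLin _ S y).1 ℓ x) = (show families N S from p.app S y).1 ℓ x :=
    fun y ℓ x => counitLin_tensMap p y x
  obtain ⟨κ, deg₁, n₁, r, h₁, hr⟩ := exists_relations h₀ q
  -- One bound above which N and both tensored free modules vanish.
  obtain ⟨n, hn⟩ := exists_family_lift R (max d (max n₀ n₁))
  have hdeg₀ : ∀ i, deg₀ i ≤ max d (max n₀ n₁) := fun i => (h₀ i).trans (by omega)
  have hdeg₁ : ∀ i, deg₁ i ≤ max d (max n₀ n₁) := fun i => (h₁ i).trans (by omega)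
  have key : RightExactGE r p n := by
    refine fun S hS => ⟨fun y => ⟨fun hy => ?_, ?_⟩, fun θ => ?_⟩
    · obtain ⟨θ', hθ'⟩ := hn (vanishesAbove_free hdeg₁) (vanishesAbove_free hdeg₀)
        ((tensorXi R).map r) q (fun ℓ y hy => (hr ℓ y).1 hy) hS (unitLin _ S y)
        fun ℓ x => (hqu y ℓ x).trans (congrArg (fun θ : families N S => θ.1 ℓ x) hy)
      obtain ⟨z, rfl⟩ := unitLin_surjective deg₁ S θ'
      exact ⟨z, unitLin_injective deg₀ S (family_ext fun ℓ x =>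
        (unitLin_app r z x).trans (hθ' ℓ x))⟩
    · rintro ⟨z, rfl⟩
      refine family_ext fun ℓ x => ?_
      refine (hqu (r.app S z) ℓ x).symm.trans ?_
      exact (congrArg (q.app (FJ.of ℓ)) (unitLin_app r z x)).trans ((hr ℓ _).2 ⟨_, rfl⟩)
    · obtain ⟨θ', hθ'⟩ := hn (vanishesAbove_free hdeg₀) (fun ℓ hℓ => hN ℓ (by omega)) q
        (0 : N ⟶ N) (fun ℓ y _ => hp ℓ y) hS θ fun ℓ x => rfl
      obtain ⟨y, rfl⟩ := unitLin_surjective deg₀ S θ'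
      exact ⟨y, family_ext fun ℓ x => (hqu y ℓ x).symm.trans (hθ' ℓ x)⟩
  refine ⟨presentedInFiniteDegree_of_rightExactGE hdeg₀ hdeg₁ key, fun ℓ =>
    ⟨(injective_iff_map_eq_zero _).2 fun w hw => ?_, fun y => ?_⟩⟩
  -- A preimage of w lies in the kernel of q, hence in the image of r, and the map induced by p
  -- kills this image.
  · obtain ⟨y, rfl⟩ := tensMap_surjective n (fun S hS => (key S hS).2) ℓ w
    obtain ⟨z, rfl⟩ := (hr ℓ y).1 hw
    exact (tensMap_exact n key ℓ _).2 ⟨z, rfl⟩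
  · obtain ⟨z, hz⟩ := hp ℓ y
    exact ⟨_, hz⟩

end FJFunctor

end

/-! ### The equivalence -/

section

variable {R : Type u} [CommRing R]

namespace FIMod

variable {M M' : FIMod R}

lemma isZero_kernel_obj_iff (g : M ⟶ M') (S : FI) :
    IsZero ((kernel g).obj S) ↔ Function.Injective (g.app S) := by
  refine (PreservesKernel.iso ((evaluation FI (ModuleCat.{u} R)).obj S) g).isZero_iff.trans ?_
  rw [← ModuleCat.mono_iff_injective]
  exact ⟨fun h => Preadditive.mono_of_isZero_kernel _ h, fun h =>
    have : Mono (((evaluation FI (ModuleCat.{u} R)).obj S).map g) := h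
    isZero_kernel_of_mono _⟩

lemma isZero_cokernel_obj_iff (g : M ⟶ M') (S : FI) :
    IsZero ((cokernel g).obj S) ↔ Function.Surjective (g.app S) := by
  refine (PreservesCokernel.iso ((evaluation FI (ModuleCat.{u} R)).obj S) g).isZero_iff.trans ?_
  rw [← ModuleCat.epi_iff_surjective]
  exact ⟨fun h => Preadditive.epi_of_isZero_cokernel _ h, fun h =>
    have : Epi (((evaluation FI (ModuleCat.{u} R)).obj S).map g) := h
    isZero_cokernel_of_epi _⟩

lemma isoModSerre_supportedInFiniteDegree_iff (g : M ⟶ M') :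
    (supportedInFiniteDegree R).isoModSerre g ↔
      ∃ n : ℕ, ∀ S : FI, n ≤ S.card → Function.Bijective (g.app S) := by
  constructor
  · rintro ⟨⟨d, hd⟩, ⟨e, he⟩⟩
    exact ⟨max d e + 1, fun S hS => ⟨(isZero_kernel_obj_iff g S).1 (hd S (by omega)),
      (isZero_cokernel_obj_iff g S).1 (he S (by omega))⟩⟩
  · rintro ⟨n, hn⟩
    exact ⟨⟨n, fun S hS => (isZero_kernel_obj_iff g S).2 (hn S hS.le).1⟩,
      ⟨n, fun S hS => (isZero_cokernel_obj_iff g S).2 (hn S hS.le).2⟩⟩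

/-- Tensoring with Ξ only sees large sets. Conversely, on large sets the bijective units identify g
with the map on natural families induced by `(tensorXi R).map g`. -/
lemma isoModSerre_iff_isIso_tensorXi_map (hM : presentedInFiniteDegree R M)
    (hM' : presentedInFiniteDegree R M') (g : M ⟶ M') :
    (supportedInFiniteDegree R).isoModSerre g ↔ IsIso ((tensorXi R).map g) := by
  rw [isoModSerre_supportedInFiniteDegree_iff]
  constructor
  · rintro ⟨n, hn⟩
    rw [NatTrans.isIso_iff_isIso_app]
    exact fun ℓ => (ConcreteCategory.isIso_iff_bijective _).2 (tensMap_bijective n hn ℓ)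
  · intro _
    obtain ⟨n, hn⟩ := unitLin_bijective hM
    obtain ⟨n', hn'⟩ := unitLin_bijective hM'
    refine ⟨max n n', fun S hS => ?_⟩
    have h1 : ∀ m, unitLin M' S (g.app S m) =
        ((familiesFunctor R).map ((tensorXi R).map g)).app S (unitLin M S m) := fun m =>
      family_ext fun ℓ x => unitLin_app g m x
    have h2 : Function.Bijective (((familiesFunctor R).map ((tensorXi R).map g)).app S) :=
      (ConcreteCategory.isIso_iff_bijective _).1 inferInstance
    refine ((hn' S (by omega)).of_comp_iff' _).1 ?_
    rw [show unitLin M' S ∘ g.app S = _ from funext h1]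
    exact h2.comp (hn S (by omega))

end FIMod

lemma FJFunctor.exists_vanishesAbove {N : FJFunctor R} (h : isModuleSupportedInFiniteDegree R N) :
    ∃ d, VanishesAbove N d := by
  obtain ⟨-, d, hd⟩ := h
  refine ⟨d, fun ℓ hℓ n => ?_⟩
  have := ModuleCat.subsingleton_of_isZero (hd ℓ hℓ)
  exact Subsingleton.elim n 0

variable (R)

/-- The functor `M ↦ M ⊗_FI Ξ(-)` from modules presented in finite degree to `FJ`-modules supported
in finite degree. -/
noncomputable def tensorXiFin : (presentedInFiniteDegree R).FullSubcategory ⥤ FJModFin R :=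
  ObjectProperty.lift _ ((presentedInFiniteDegree R).ι ⋙ tensorXi R) fun M => by
    obtain ⟨d, hd⟩ := M.property
    refine ⟨inferInstanceAs ((tensorXi R).obj M.obj).Additive, d, fun ℓ hℓ => ?_⟩
    have : Subsingleton (FITensor M.obj (Xi ℓ)) :=
      subsingleton_of_forall_eq 0 (vanishesAbove_of_isPresentedInDegreesLE hd ℓ hℓ)
    exact ModuleCat.isZero_of_subsingleton (ModuleCat.of R (FITensor M.obj (Xi ℓ)))

/-- The functor of natural families from `FJ`-modules supported in finite degree to modules
presented in finite degree. -/
noncomputable def familiesFin : FJModFin R ⥤ (presentedInFiniteDegree R).FullSubcategory :=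
  ObjectProperty.lift _ ((isModuleSupportedInFiniteDegree R).ι ⋙ familiesFunctor R) fun N => by
    have := N.property.1
    obtain ⟨d, hd⟩ := exists_vanishesAbove N.property
    exact (presentedInFiniteDegree_toFIMod hd).1

/-- The restriction of the adjunction between `M ↦ M ⊗_FI Ξ(-)` and the functor of natural
families. -/
noncomputable def tensorXiFinAdjunction : tensorXiFin R ⊣ familiesFin R :=
  (tensorXiAdjunction R).restrictFullyFaithful (presentedInFiniteDegree R).fullyFaithfulι
    (isModuleSupportedInFiniteDegree R).fullyFaithfulι
    (Iso.refl ((presentedInFiniteDegree R).ι ⋙ tensorXi R))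
    (Iso.refl ((isModuleSupportedInFiniteDegree R).ι ⋙ familiesFunctor R))

instance : IsIso (tensorXiFinAdjunction R).counit := by
  rw [NatTrans.isIso_iff_isIso_app]
  intro N
  have := N.property.1
  obtain ⟨d, hd⟩ := exists_vanishesAbove N.property
  have h1 : IsIso ((tensorXiCounit R).app N.obj) := by
    rw [NatTrans.isIso_iff_isIso_app]
    exact fun ℓ => (ConcreteCategory.isIso_iff_bijective _).2
      ((presentedInFiniteDegree_toFIMod hd).2 ℓ)
  have h2 : (isModuleSupportedInFiniteDegree R).ι.map ((tensorXiFinAdjunction R).counit.app N) =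
      (tensorXiCounit R).app N.obj := by
    refine (Adjunction.map_restrictFullyFaithful_counit_app (tensorXiAdjunction R) _ _ _ _ N).trans ?_
    exact (Category.id_comp _).trans ((congrArg (· ≫ (tensorXiCounit R).app N.obj)
      ((tensorXi R).map_id _)).trans (Category.id_comp _))
  have : IsIso ((isModuleSupportedInFiniteDegree R).ι.map
      ((tensorXiFinAdjunction R).counit.app N)) := by
    rw [h2]
    exact h1
  exact isIso_of_reflects_iso _ (isModuleSupportedInFiniteDegree R).ι

lemma tailEquivalences_eq_inverseImage : tailEquivalences R =
    (MorphismProperty.isomorphisms (FJModFin R)).inverseImage (tensorXiFin R) := by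
  ext M M' g
  refine (isoModSerre_iff_isIso_tensorXi_map M.property M'.property g.hom).trans ?_
  change IsIso ((isModuleSupportedInFiniteDegree R).ι.map ((tensorXiFin R).map g)) ↔
    IsIso ((tensorXiFin R).map g)
  exact ⟨fun _ => isIso_of_reflects_iso _ (isModuleSupportedInFiniteDegree R).ι,
    fun _ => inferInstance⟩

/-- A left adjoint whose right adjoint is fully faithful is a localization at the morphisms that it
inverts; by the preceding lemma these are the tail equivalences. -/
instance : (tensorXiFin R).IsLocalization (tailEquivalences R) := by
  have := (tensorXiFinAdjunction R).fullyFaithfulROfIsIsoCounit.full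
  have := (tensorXiFinAdjunction R).fullyFaithfulROfIsIsoCounit.faithful
  rw [tailEquivalences_eq_inverseImage]
  exact (tensorXiFinAdjunction R).isLocalization

end

theorem theoremB (R : Type u) [CommRing R] :
    ∃ e : FITails R ≌ FJModFin R,
      Nonempty ((FIMod.tailEquivalences R).Q ⋙ e.functor ⋙
          (FJFunctor.isModuleSupportedInFiniteDegree R).ι ≅
        (FIMod.presentedInFiniteDegree R).ι ⋙ tensorXi R) :=
  ⟨Localization.equivalenceFromModel (tensorXiFin R) (tailEquivalences R),
    ⟨Functor.isoWhiskerRight (Localization.qCompEquivalenceFromModelFunctorIso (tensorXiFin R)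
      (tailEquivalences R)) (isModuleSupportedInFiniteDegree R).ι⟩⟩
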